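/- **Conventions.** A surface is a smoothly embedded surface without boundary $F\subset\mathbb R^3$; $\pi$ is the orthogonal projection to the $xy$-plane. A *profile curve* of $F$ is a connected component of the set of points of $F$ whose tangent plane is vertical (contains the $z$-direction); it is *generic* if at each of its points $\pi|_F$ has a fold or an ordinary (Whitney) cusp. For a closed curve $\gamma$ and a vector field $v$ along $\gamma$, consider the linking number of $\gamma$ with $\gamma+\varepsilon v$ for small $\varepsilon>0$. For $v$ a unit normal field of an orientable surface $F\supset\gamma$ it is the *surface linking number* $\lambda(\gamma,F)$; for $v$ a blackboard framing (a continuous horizontal unit vector field along $\gamma$ normal to $\dot\gamma$) it is the *writhe* $w(\gamma)$. The curve $\gamma$ *projects to a cusp* at a parameter $t$ with $\dot\gamma(t)$ vertical if $\pi\gamma$ has an ordinary cusp there, that is, $(\pi\gamma)''(t)$ and $(\pi\gamma)'''(t)$ are linearly independent; the cusp is right- or left-handed according to the sign of $\det\big((\pi\gamma)''(t),(\pi\gamma)'''(t)\big)$. **Theorem.** Let $F_0\subset\mathbb R^3$ be an orientable embedded surface and let $\gamma\subset F_0$ be a smooth, regular, embedded closed curve that is non-vertical except at an even (possibly zero)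 number of points, which project to cusps that all have the same chirality (so that $\pi\gamma$ is piecewise smooth). Then $w(\gamma)$ and $\lambda(\gamma,F_0)$ are well defined (they do not depend on small $\varepsilon>0$ nor on the choice of the framing or of the normal field), and the following are equivalent. 1. $F_0$ is isotopic, by a smooth ambient isotopy that fixes $\gamma$ pointwise, to a surface $F_1$ for which $\gamma$ is a profile curve. 2. $F_0$ is isotopic, by a smooth ambient isotopy that fixes $\gamma$ pointwise, to a surface $F_1$ for which $\gamma$ is a generic profile curve. 3. $w(\gamma)=\lambda(\gamma,F_0)$. -/

import Mathlib

open Filter Topology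
open scoped ContDiff

noncomputable section

namespace ProfileCurve

/-- Euclidean 3-space. The coordinates `0, 1, 2` are `x, y, z`; the orthogonal projection to the
`xy`-plane forgets the coordinate `2`. -/
abbrev E3 : Type := EuclideanSpace ℝ (Fin 3)

/-- The vertical unit vector. -/
def e3 : E3 := !₂[0, 0, 1]

/-! ### Surfaces -/

/-- `g = 0` is a regular smooth equation of `F` near `p`. -/
def IsLocalEquation (F : Set E3) (p : E3) (g : E3 → ℝ) : Prop :=
  ∃ U : Set E3, IsOpen U ∧ p ∈ U ∧ ContDiffOn ℝ ∞ g U ∧ (∀ x ∈ U, fderiv ℝ g x ≠ 0) ∧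
    ∀ x ∈ U, (x ∈ F ↔ g x = 0)

/-- `F` is a smooth embedded surface (without boundary) in 3-space: a subset that is locally the
zero set of a smooth function with nowhere vanishing differential. -/
def IsSmoothSurface (F : Set E3) : Prop :=
  ∀ p ∈ F, ∃ g : E3 → ℝ, IsLocalEquation F p g

/-- The tangent vectors of `F` at `p`: the velocities of smooth curves that run in `F`. -/
def tangentVectors (F : Set E3) (p : E3) : Set E3 :=
  {v | ∃ c : ℝ → E3, ContDiffAt ℝ ∞ c 0 ∧ c 0 = p ∧ (∀ᶠ t in 𝓝 (0 : ℝ), c t ∈ F) ∧ deriv c 0 = v}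

/-- `ν` is a (continuous) unit normal vector field on `F`. -/
structure IsUnitNormalField (F : Set E3) (ν : E3 → E3) : Prop where
  continuousOn : ContinuousOn ν F
  norm_eq_one : ∀ p ∈ F, ‖ν p‖ = 1
  normal : ∀ p ∈ F, ∀ v ∈ tangentVectors F p, inner ℝ (ν p) v = 0

/-- An orientable surface in 3-space is one that carries a unit normal field. -/
def IsOrientable (F : Set E3) : Prop := ∃ ν : E3 → E3, IsUnitNormalField F ν

/-- `F₀` is smoothly isotopic to `F₁` by an isotopy that fixes every point of `C`: a smooth family
`H s` of diffeomorphisms of 3-space (with inverses `K s`), which starts at the identity, fixes `C`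
pointwise, and carries `F₀` to `F₁` at time `1`. -/
def IsotopicFixing (C F₀ F₁ : Set E3) : Prop :=
  ∃ H K : ℝ → E3 → E3,
    ContDiff ℝ ∞ (fun q : ℝ × E3 => H q.1 q.2) ∧
    ContDiff ℝ ∞ (fun q : ℝ × E3 => K q.1 q.2) ∧
    (∀ s x, K s (H s x) = x) ∧ (∀ s x, H s (K s x) = x) ∧
    (∀ x, H 0 x = x) ∧ (∀ s, ∀ x ∈ C, H s x = x) ∧ H 1 '' F₀ = F₁

/-! ### Profile curves -/

/-- The points of `F` at which the tangent plane of `F` is vertical. -/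
def contour (F : Set E3) : Set E3 := {p | p ∈ F ∧ e3 ∈ tangentVectors F p}

/-- `C` is a profile curve of `F`: one of the components of the set of points of `F` with vertical
tangent plane. -/
def IsProfileCurve (F C : Set E3) : Prop :=
  ∃ p ∈ contour F, C = connectedComponentIn (contour F) p

/-- The vertical derivative `∂g/∂z`. -/
def dz (g : E3 → ℝ) : E3 → ℝ := fun x => fderiv ℝ g x e3

/-- The projection of `F = {g = 0}` to the `xy`-plane has a fold at `p`:
`g = g_z = 0` and `g_zz ≠ 0` at `p`. -/
def IsFoldPoint (F : Set E3) (p : E3) : Prop :=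
  p ∈ F ∧ ∃ g : E3 → ℝ, IsLocalEquation F p g ∧ dz g p = 0 ∧ dz (dz g) p ≠ 0

/-- The projection of `F = {g = 0}` to the `xy`-plane has an ordinary (Whitney) cusp at `p`:
`g = g_z = g_zz = 0`, `g_zzz ≠ 0` at `p`, and the singular set `g = g_z = 0` is cut out
transversally at `p`. -/
def IsCuspPoint (F : Set E3) (p : E3) : Prop :=
  p ∈ F ∧ ∃ g : E3 → ℝ, IsLocalEquation F p g ∧ dz g p = 0 ∧ dz (dz g) p = 0 ∧
    dz (dz (dz g)) p ≠ 0 ∧ LinearIndependent ℝ ![fderiv ℝ g p, fderiv ℝ (dz g) p]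

/-- `C` is a profile curve of `F` along which the projection of `F` to the `xy`-plane is generic,
that is, has only folds and ordinary cusps. -/
def IsGenericProfileCurve (F C : Set E3) : Prop :=
  IsProfileCurve F C ∧ ∀ p ∈ C, IsFoldPoint F p ∨ IsCuspPoint F p

/-! ### Closed curves and their cusps -/

/-- `γ` is a regular parametrization, of period `1`, of a smooth embedded closed curve. -/
structure IsSmoothClosedCurve (γ : ℝ → E3) : Prop where
  smooth : ContDiff ℝ ∞ γ
  periodic : Function.Periodic γ 1
  injOn : Set.InjOn γ (Set.Ico 0 1)
  regular : ∀ t, deriv γ t ≠ 0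

/-- The velocity of `γ` at the parameter `t` is vertical (its projection is zero). -/
def IsVerticalAt (γ : ℝ → E3) (t : ℝ) : Prop := deriv γ t 0 = 0 ∧ deriv γ t 1 = 0

/-- The parameters, in one period, of the points with vertical tangent line. -/
def verticalParams (γ : ℝ → E3) : Set ℝ := {t | t ∈ Set.Ico (0 : ℝ) 1 ∧ IsVerticalAt γ t}

/-- The planar determinant of the second and the third derivative of the projection of `γ`. -/
def cuspDet (γ : ℝ → E3) (t : ℝ) : ℝ :=
  iteratedDeriv 2 γ t 0 * iteratedDeriv 3 γ t 1 - iteratedDeriv 2 γ t 1 * iteratedDeriv 3 γ t 0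

/-- At `t` the projection of `γ` has an ordinary cusp and takes a right turn there, like
`t ↦ (t ^ 2, t ^ 3)` at `0`: the first derivative vanishes, and the second and the third form a
positive basis of the plane. -/
def IsRightCusp (γ : ℝ → E3) (t : ℝ) : Prop := IsVerticalAt γ t ∧ 0 < cuspDet γ t

/-- At `t` the projection of `γ` has an ordinary cusp and takes a left turn there, like
`t ↦ (t ^ 2, -t ^ 3)` at `0`. -/
def IsLeftCusp (γ : ℝ → E3) (t : ℝ) : Prop := IsVerticalAt γ t ∧ cuspDet γ t < 0

/-- `γ` has an even number of points with vertical tangent, all of them project to ordinary cusps,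
and these all have the same chirality. -/
def HasEvenCuspsOfOneChirality (γ : ℝ → E3) : Prop :=
  (verticalParams γ).Finite ∧ Even (verticalParams γ).ncard ∧
    ((∀ t ∈ verticalParams γ, IsRightCusp γ t) ∨ (∀ t ∈ verticalParams γ, IsLeftCusp γ t))

/-! ### Linking numbers, the writhe and the surface linking number -/

/-- The determinant of three vectors of 3-space. -/
def det3 (u v w : E3) : ℝ :=
  Matrix.det !![u 0, u 1, u 2; v 0, v 1, v 2; w 0, w 1, w 2]

/-- The linking number of two disjoint closed curves (of period `1`), as the Gauss integral. -/
def linkingNumber (γ η : ℝ → E3) : ℝ :=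
  (4 * Real.pi)⁻¹ * ∫ s in (0 : ℝ)..1, ∫ t in (0 : ℝ)..1,
    det3 (deriv γ s) (deriv η t) (γ s - η t) / ‖γ s - η t‖ ^ 3

/-- `n` is the linking number of `γ` with its push-offs `γ + ε v`, for all sufficiently small
`ε > 0`. -/
def IsPushOffLinkingNumber (γ v : ℝ → E3) (n : ℝ) : Prop :=
  ∀ᶠ ε in 𝓝[>] (0 : ℝ), linkingNumber γ (fun t => γ t + ε • v t) = n

/-- `β` is a blackboard framing of the closed curve `γ`: a continuous field of horizontal unit
vectors along `γ`, normal to `γ`. -/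
structure IsBlackboardFraming (γ β : ℝ → E3) : Prop where
  continuous : Continuous β
  periodic : Function.Periodic β 1
  norm_eq_one : ∀ t, ‖β t‖ = 1
  horizontal : ∀ t, β t 2 = 0
  normal : ∀ t, inner ℝ (β t) (deriv γ t) = 0

/-- `w` is the writhe of `γ`: there is a blackboard framing, and `w` is the linking number of `γ`
with its small push-offs along any blackboard framing. -/
def IsWrithe (γ : ℝ → E3) (w : ℝ) : Prop :=
  (∃ β, IsBlackboardFraming γ β) ∧ ∀ β, IsBlackboardFraming γ β → IsPushOffLinkingNumber γ β w

/-- `l` is the surface linking number of `γ` in the orientable surface `F`: the linking number of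
`γ` with its small push-offs along any unit normal field of `F`. -/
def IsSurfaceLinkingNumber (γ : ℝ → E3) (F : Set E3) (l : ℝ) : Prop :=
  IsOrientable F ∧
    ∀ ν, IsUnitNormalField F ν → IsPushOffLinkingNumber γ (fun t => ν (γ t)) l

end ProfileCurve

end

open ProfileCurve

noncomputable section

namespace ProfileCurve

/-! ### Coordinates, the cross product and orthonormal triples -/

/-! Up to homotopy, a unit normal framing of `γ` is determined by its winding relative to a fixed
framing `β`, and the linking number of the push-off detects this winding.

A surface through `γ` has vertical tangent planes along `γ` exactly when its normal there is
horizontal, that is, when the normal is a blackboard framing. An ambient isotopy fixing `γ` drags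
the normal field of `F₀` through nonvanishing normal fields of `γ`, so it preserves the surface
linking number. If `γ` becomes a profile curve, this number is therefore the writhe
(`exists_transported_framing`, `writhe_eq_of_profileCurve`).

Conversely, write the normal of `F₀` as `β` turned by an angle `θ`. Equality of the linking numbers
forces `θ 1 = θ 0` (`winding_eq_zero`). Hence `θ` is periodic, and a twist of a tube around `γ`
makes `β` normal to the surface (`exists_isotopy_normalAlong`). All tangent planes along `γ` are now
vertical, but `γ` need not yet be a component of the contour.

For a local equation `g`, put `ρ = dg(β)` and let `e` be the vertical component of the binormal. It
vanishes exactly at the vertical points of `γ`. There `g_zz = 0` automatically, and the sign of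
`g_zzz` is dictated by the chirality of the cusp (`cuspDet_mul`). If all chiralities equal the sign
`χ`, then `χ e g_zz ≥ 0` near the cusps for equations with `ρ > 0`. A shear tangent to the identity
along `γ` adds `2 Λ e⁴ ρ` to `χ e g_zz`, so a large `Λ` makes it positive at every nonvertical point
(`exists_generic`). These points are folds, the vertical ones are Whitney cusps, and the contour is
cut out transversally along `γ`. So `γ` is open and closed in the contour
(`isProfileCurve_of_transverse`).

Evenness of the number of cusps is what lets the blackboard framing close up. Linking numbers are
handled through the Gauss integral: Stokes' theorem for the closed solid angle form gives homotopy
invariance, and strict positivity of the integral over a small meridian replaces its exact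
evaluation. -/

theorem inner_eq_coords (u v : E3) : inner ℝ u v = u 0 * v 0 + u 1 * v 1 + u 2 * v 2 := by
  rw [PiLp.inner_apply, Fin.sum_univ_three]
  simp [mul_comm]

theorem norm_sq_eq_coords (u : E3) : ‖u‖ ^ 2 = u 0 ^ 2 + u 1 ^ 2 + u 2 ^ 2 := by
  rw [← real_inner_self_eq_norm_sq, inner_eq_coords]; ring

theorem det3_eq_coords (u v w : E3) :
    det3 u v w = u 0 * (v 1 * w 2 - v 2 * w 1) - u 1 * (v 0 * w 2 - v 2 * w 0) +
      u 2 * (v 0 * w 1 - v 1 * w 0) := by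
  unfold det3
  rw [Matrix.det_fin_three]
  simp
  ring

theorem ext_coords {u v : E3} (h0 : u 0 = v 0) (h1 : u 1 = v 1) (h2 : u 2 = v 2) : u = v := by
  ext i; fin_cases i <;> assumption

@[simp] theorem e3_zero : e3 0 = 0 := by simp [e3]
@[simp] theorem e3_one : e3 1 = 0 := by simp [e3]
@[simp] theorem e3_two : e3 2 = 1 := by simp [e3]

theorem inner_e3 (u : E3) : inner ℝ u e3 = u 2 := by simp [inner_eq_coords]

theorem contDiff_coord (i : Fin 3) {n : WithTop ℕ∞} : ContDiff ℝ n (fun x : E3 => x i) :=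
  (EuclideanSpace.proj (𝕜 := ℝ) i).contDiff

/-- The cross product of 3-space. -/
def cross (u v : E3) : E3 :=
  !₂[u 1 * v 2 - u 2 * v 1, u 2 * v 0 - u 0 * v 2, u 0 * v 1 - u 1 * v 0]

@[simp] theorem cross_zero (u v : E3) : cross u v 0 = u 1 * v 2 - u 2 * v 1 := by simp [cross]
@[simp] theorem cross_one (u v : E3) : cross u v 1 = u 2 * v 0 - u 0 * v 2 := by simp [cross]
@[simp] theorem cross_two (u v : E3) : cross u v 2 = u 0 * v 1 - u 1 * v 0 := by simp [cross]

theorem inner_cross (u v w : E3) : inner ℝ u (cross v w) = det3 u v w := by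
  rw [inner_eq_coords, det3_eq_coords]; simp; ring

theorem contDiff_of_coords {X : Type*} [NormedAddCommGroup X] [NormedSpace ℝ X]
    {n : WithTop ℕ∞} {f : X → E3} (h0 : ContDiff ℝ n fun x => f x 0)
    (h1 : ContDiff ℝ n fun x => f x 1) (h2 : ContDiff ℝ n fun x => f x 2) :
    ContDiff ℝ n f := by
  rw [contDiff_euclidean]
  intro i; fin_cases i <;> assumption

theorem ContDiff.coord {X : Type*} [NormedAddCommGroup X] [NormedSpace ℝ X]
    {n : WithTop ℕ∞} {f : X → E3} (h : ContDiff ℝ n f) (i : Fin 3) :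
    ContDiff ℝ n fun x => f x i := (contDiff_coord i).comp h

theorem ContDiff.cross {X : Type*} [NormedAddCommGroup X] [NormedSpace ℝ X]
    {n : WithTop ℕ∞} {f g : X → E3} (hf : ContDiff ℝ n f) (hg : ContDiff ℝ n g) :
    ContDiff ℝ n fun x => cross (f x) (g x) := by
  have f0 := ContDiff.coord hf 0
  have f1 := ContDiff.coord hf 1
  have f2 := ContDiff.coord hf 2
  have g0 := ContDiff.coord hg 0
  have g1 := ContDiff.coord hg 1
  have g2 := ContDiff.coord hg 2
  apply contDiff_of_coords
  · simpa using (f1.mul g2).sub (f2.mul g1)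
  · simpa using (f2.mul g0).sub (f0.mul g2)
  · simpa using (f0.mul g1).sub (f1.mul g0)

/-- An orthonormal triple expands every vector. -/
theorem orthonormal_expand {a b c : E3} (ha : ‖a‖ = 1) (hb : ‖b‖ = 1) (hc : ‖c‖ = 1)
    (hab : inner ℝ a b = 0) (hac : inner ℝ a c = 0) (hbc : inner ℝ b c = 0) (v : E3) :
    v = inner ℝ a v • a + inner ℝ b v • b + inner ℝ c v • c := by
  have ha' : a 0 ^ 2 + a 1 ^ 2 + a 2 ^ 2 = 1 := by rw [← norm_sq_eq_coords, ha]; norm_num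
  have hb' : b 0 ^ 2 + b 1 ^ 2 + b 2 ^ 2 = 1 := by rw [← norm_sq_eq_coords, hb]; norm_num
  have hc' : c 0 ^ 2 + c 1 ^ 2 + c 2 ^ 2 = 1 := by rw [← norm_sq_eq_coords, hc]; norm_num
  rw [inner_eq_coords] at hab hac hbc
  let M : Matrix (Fin 3) (Fin 3) ℝ := !![a 0, a 1, a 2; b 0, b 1, b 2; c 0, c 1, c 2]
  have h1 : M * M.transpose = 1 := by
    ext i j
    fin_cases i <;> fin_cases j <;>
      simp [M, Matrix.mul_apply, Fin.sum_univ_three] <;> linarith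
  have h2 := mul_eq_one_comm.mp h1
  have key : ∀ i j, M.transpose i 0 * M 0 j + M.transpose i 1 * M 1 j + M.transpose i 2 * M 2 j
      = (1 : Matrix (Fin 3) (Fin 3) ℝ) i j := by
    intro i j
    rw [← h2, Matrix.mul_apply, Fin.sum_univ_three]
  have k00 := key 0 0
  have k01 := key 0 1
  have k02 := key 0 2
  have k11 := key 1 1
  have k12 := key 1 2
  have k22 := key 2 2
  simp [M] at k00 k01 k02 k11 k12 k22
  apply ext_coords <;> simp [inner_eq_coords]
  · linear_combination (-v 0) * k00 - v 1 * k01 - v 2 * k02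
  · linear_combination (-v 0) * k01 - v 1 * k11 - v 2 * k12
  · linear_combination (-v 0) * k02 - v 1 * k12 - v 2 * k22

theorem norm_cross {u v : E3} (h : inner ℝ u v = 0) : ‖cross u v‖ = ‖u‖ * ‖v‖ := by
  rw [← sq_eq_sq₀ (by positivity) (by positivity), mul_pow, norm_sq_eq_coords, norm_sq_eq_coords,
    norm_sq_eq_coords]
  rw [inner_eq_coords] at h
  simp
  linear_combination (-(u 0 * v 0 + u 1 * v 1 + u 2 * v 2)) * h

theorem inner_cross_left (u v : E3) : inner ℝ u (cross u v) = 0 := by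
  rw [inner_eq_coords]; simp; ring

theorem inner_cross_right (u v : E3) : inner ℝ v (cross u v) = 0 := by
  rw [inner_eq_coords]; simp; ring

/-! ### The inverse function theorem and tangent planes -/

/-- The inverse function theorem in the form used throughout: in equal finite dimensions an
injective differential is already invertible. -/
theorem exists_smooth_local_inverse {X Y : Type*} [NormedAddCommGroup X] [NormedSpace ℝ X]
    [FiniteDimensional ℝ X] [NormedAddCommGroup Y] [NormedSpace ℝ Y] [FiniteDimensional ℝ Y]
    (hdim : Module.finrank ℝ X = Module.finrank ℝ Y) {f : X → Y} {x : X}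
    (hf : ContDiffAt ℝ ∞ f x) (hinj : ∀ v, fderiv ℝ f x v = 0 → v = 0) :
    ∃ e : OpenPartialHomeomorph X Y, ⇑e = f ∧ x ∈ e.source ∧ ContDiffAt ℝ ∞ e.symm (f x) := by
  have : CompleteSpace X := FiniteDimensional.complete ℝ X
  have hinj' : Function.Injective (fderiv ℝ f x : X →ₗ[ℝ] Y) := by
    rw [injective_iff_map_eq_zero]; exact hinj
  let L : X ≃L[ℝ] Y :=
    (LinearEquiv.ofInjectiveOfFinrankEq (fderiv ℝ f x : X →ₗ[ℝ] Y) hinj' hdim).toContinuousLinearEquiv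
  have hL : (L : X →L[ℝ] Y) = fderiv ℝ f x := by
    ext v; rfl
  have hd : HasFDerivAt f (L : X →L[ℝ] Y) x := by
    rw [hL]; exact (hf.differentiableAt (by simp)).hasFDerivAt
  exact ⟨hf.toOpenPartialHomeomorph f hd (by simp), rfl,
    hf.mem_toOpenPartialHomeomorph_source hd (by simp), hf.to_localInverse hd (by simp)⟩

theorem IsLocalEquation.contDiffAt {F : Set E3} {p : E3} {g : E3 → ℝ}
    (h : IsLocalEquation F p g) : ContDiffAt ℝ ∞ g p := by
  obtain ⟨U, hU, hp, hg, -, -⟩ := h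
  exact hg.contDiffAt (hU.mem_nhds hp)

theorem IsLocalEquation.fderiv_ne {F : Set E3} {p : E3} {g : E3 → ℝ}
    (h : IsLocalEquation F p g) : fderiv ℝ g p ≠ 0 := by
  obtain ⟨U, hU, hp, hg, h1, -⟩ := h
  exact h1 p hp

theorem IsLocalEquation.eventually_mem_iff {F : Set E3} {p : E3} {g : E3 → ℝ}
    (h : IsLocalEquation F p g) : ∀ᶠ x in 𝓝 p, (x ∈ F ↔ g x = 0) := by
  obtain ⟨U, hU, hp, hg, -, h1⟩ := h
  filter_upwards [hU.mem_nhds hp] with x hx using h1 x hx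

theorem IsLocalEquation.eventually {F : Set E3} {p : E3} {g : E3 → ℝ}
    (h : IsLocalEquation F p g) : ∀ᶠ x in 𝓝 p, IsLocalEquation F x g := by
  obtain ⟨U, hU, hp, hg⟩ := h
  filter_upwards [hU.mem_nhds hp] with x hx using ⟨U, hU, hx, hg⟩

theorem fderiv_of_mem_tangentVectors {F : Set E3} {p : E3} {g : E3 → ℝ}
    (h : IsLocalEquation F p g) {v : E3} (hv : v ∈ tangentVectors F p) : fderiv ℝ g p v = 0 := by
  obtain ⟨c, hc, hc0, hcF, rfl⟩ := hv
  have h1 : HasDerivAt c (deriv c 0) 0 := (hc.differentiableAt (by simp)).hasDerivAt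
  have h2 : HasFDerivAt g (fderiv ℝ g p) (c 0) := by
    rw [hc0]; exact (h.contDiffAt.differentiableAt (by simp)).hasFDerivAt
  have h3 := h2.comp_hasDerivAt (0 : ℝ) h1
  have h4 : (g ∘ c) =ᶠ[𝓝 0] fun _ => (0 : ℝ) := by
    have : Tendsto c (𝓝 0) (𝓝 p) := by
      have := hc.continuousAt; rwa [ContinuousAt, hc0] at this
    filter_upwards [hcF, this.eventually h.eventually_mem_iff] with t h5 h6 using h6.mp h5
  exact h3.unique ((hasDerivAt_const (0 : ℝ) (0 : ℝ)).congr_of_eventuallyEq h4)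

/-- The implicit function theorem in the plane through `p` spanned by `v` and a direction `n` with
`dg(n) ≠ 0`. There `f = (first coordinate, g)` is a local diffeomorphism, and the preimage of the
horizontal axis is a curve in `F` with velocity `v`. -/
theorem mem_tangentVectors_of_fderiv {F : Set E3} {p : E3} (hp : p ∈ F) {g : E3 → ℝ}
    (h : IsLocalEquation F p g) {v : E3} (hv : fderiv ℝ g p v = 0) : v ∈ tangentVectors F p := by
  have hgp : g p = 0 := (h.eventually_mem_iff.self_of_nhds).mp hp
  obtain ⟨n, hn⟩ : ∃ n, fderiv ℝ g p n ≠ 0 := by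
    by_contra! hcon
    exact h.fderiv_ne (ContinuousLinearMap.ext hcon)
  let A : ℝ × ℝ →L[ℝ] E3 :=
    (ContinuousLinearMap.fst ℝ ℝ ℝ).smulRight v + (ContinuousLinearMap.snd ℝ ℝ ℝ).smulRight n
  let f : ℝ × ℝ → ℝ × ℝ := fun q => (q.1, g (p + A q))
  have hgd : HasFDerivAt g (fderiv ℝ g p) (p + A 0) := by
    simpa using (h.contDiffAt.differentiableAt (by simp)).hasFDerivAt
  have hf : ContDiffAt ℝ ∞ f 0 := by
    refine contDiffAt_fst.prodMk (ContDiffAt.comp (0 : ℝ × ℝ) ?_ (contDiffAt_const.add A.contDiff.contDiffAt))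
    simpa using h.contDiffAt
  have hd : HasFDerivAt f ((ContinuousLinearMap.fst ℝ ℝ ℝ).prod ((fderiv ℝ g p).comp A)) 0 :=
    hasFDerivAt_fst.prodMk (hgd.comp (0 : ℝ × ℝ) (A.hasFDerivAt.const_add p))
  have hinj : ∀ w, fderiv ℝ f 0 w = 0 → w = 0 := by
    intro w hw
    rw [hd.fderiv] at hw
    simp [A, hv, Prod.ext_iff] at hw
    obtain ⟨h1, h2⟩ := hw
    rcases h2 with h2 | h2
    · exact Prod.ext h1 h2
    · exact absurd h2 hn
  obtain ⟨e, he, h0, hs⟩ := exists_smooth_local_inverse rfl hf hinj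
  have hf0 : f 0 = 0 := by simp [f, hgp, Prod.ext_iff]
  rw [hf0] at hs
  have hes0 : e.symm 0 = 0 := by
    have := e.left_inv h0
    rwa [he, hf0] at this
  have htgt : ∀ᶠ q in 𝓝 (0 : ℝ × ℝ), f (e.symm q) = q := by
    have : (0 : ℝ × ℝ) ∈ e.target := by rw [← hf0, ← he]; exact e.map_source h0
    filter_upwards [e.open_target.mem_nhds this] with q hq
    rw [← he]; exact e.right_inv hq
  let i : ℝ → ℝ × ℝ := fun t => (t, 0)
  have hi : ContDiff ℝ ∞ i := contDiff_id.prodMk contDiff_const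
  have hi0 : Tendsto i (𝓝 0) (𝓝 0) := hi.continuous.tendsto' 0 0 rfl
  let c : ℝ → E3 := fun t => p + A (e.symm (i t))
  have hsi : ContDiffAt ℝ ∞ (fun t => e.symm (i t)) 0 :=
    ContDiffAt.comp (0 : ℝ) (g := e.symm) (show ContDiffAt ℝ ∞ e.symm (i 0) from hs) hi.contDiffAt
  have hsd : DifferentiableAt ℝ (fun t => e.symm (i t)) 0 := hsi.differentiableAt (by simp)
  have hcont : Tendsto (fun t => e.symm (i t)) (𝓝 0) (𝓝 0) := by
    have := hsi.continuousAt
    rwa [ContinuousAt, show e.symm (i 0) = 0 from hes0] at this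
  have hw : fderiv ℝ f 0 (deriv (fun t => e.symm (i t)) 0) = (1, 0) := by
    have h1 : HasFDerivAt f (fderiv ℝ f 0) (e.symm (i 0)) := by
      rw [show e.symm (i 0) = 0 from hes0]
      exact (hf.differentiableAt (by simp)).hasFDerivAt
    have h2 := h1.comp_hasDerivAt (0 : ℝ) hsd.hasDerivAt
    have h3 : HasDerivAt i (1, 0) 0 := (hasDerivAt_id 0).prodMk (hasDerivAt_const (0 : ℝ) (0 : ℝ))
    have h4 : (f ∘ fun t => e.symm (i t)) =ᶠ[𝓝 0] i := by
      filter_upwards [hi0.eventually htgt] with t ht using ht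
    exact h2.unique (h3.congr_of_eventuallyEq h4)
  refine ⟨c, contDiffAt_const.add (A.contDiff.contDiffAt.comp (0 : ℝ) hsi), ?_, ?_, ?_⟩
  · simp [c, show e.symm (i 0) = 0 from hes0]
  · have hc0 : Tendsto c (𝓝 0) (𝓝 p) := by
      have : Tendsto (fun q => p + A q) (𝓝 0) (𝓝 p) :=
        (continuous_const.add A.continuous).tendsto' _ _ (by simp)
      exact this.comp hcont
    filter_upwards [hi0.eventually htgt, hc0.eventually h.eventually_mem_iff] with t h1 h2
    exact h2.mpr (congrArg Prod.snd h1)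
  · have h1 : HasDerivAt c (A (deriv (fun t => e.symm (i t)) 0)) 0 :=
      (A.hasFDerivAt.comp_hasDerivAt (0 : ℝ) hsd.hasDerivAt).const_add p
    rw [h1.deriv]
    rw [hd.fderiv] at hw
    generalize deriv (fun t => e.symm (i t)) 0 = w at hw
    simp [A, hv, Prod.ext_iff] at hw
    obtain ⟨h2, h3⟩ := hw
    rcases h3 with h3 | h3
    · simp [A, h2, h3]
    · exact absurd h3 hn

/-! ### Division by a simple zero -/

/-- Differentiating under the integral turns the weight `l ^ k` into `l ^ (k + 1)` and `h` into its
derivative. The class of such integrals is closed under differentiation, so smoothness follows by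
induction with `h` and `k` free. -/
theorem contDiff_integral_pow_smul {E : Type*} [NormedAddCommGroup E] [NormedSpace ℝ E]
    [CompleteSpace E] {h : ℝ → E} (hh : ContDiff ℝ ∞ h) (k : ℕ) :
    ContDiff ℝ ∞ fun t : ℝ => ∫ l in (0 : ℝ)..1, l ^ k • h (l * t) := by
  have hder : ∀ (h : ℝ → E), ContDiff ℝ ∞ h → ∀ (k : ℕ) (t : ℝ),
      HasDerivAt (fun t : ℝ => ∫ l in (0 : ℝ)..1, l ^ k • h (l * t))
        (∫ l in (0 : ℝ)..1, l ^ (k + 1) • deriv h (l * t)) t := by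
    intro h hh k t
    have hh' : Continuous (deriv h) := hh.continuous_deriv (by simp)
    have hc : Continuous fun q : ℝ × ℝ => q.2 ^ (k + 1) • deriv h (q.2 * q.1) := by fun_prop
    obtain ⟨C, hC⟩ := ((isCompact_closedBall t 1).prod (isCompact_Icc (a := (0 : ℝ)) (b := 1))).exists_bound_of_continuousOn
      hc.continuousOn
    have hh0 := hh.continuous
    refine (intervalIntegral.hasDerivAt_integral_of_dominated_loc_of_deriv_le
      (F := fun t l => l ^ k • h (l * t)) (F' := fun t l => l ^ (k + 1) • deriv h (l * t))
      (s := Metric.closedBall t 1) (bound := fun _ => C)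
      (Metric.closedBall_mem_nhds t one_pos) ?_ ?_ ?_ ?_ ?_ ?_).2
    · refine Eventually.of_forall fun x => Continuous.aestronglyMeasurable ?_
      fun_prop
    · apply Continuous.intervalIntegrable; fun_prop
    · apply Continuous.aestronglyMeasurable; fun_prop
    · refine Eventually.of_forall fun l hl x hx => ?_
      rw [Set.uIoc_of_le zero_le_one] at hl
      exact hC (x, l) ⟨hx, hl.1.le, hl.2⟩
    · exact intervalIntegrable_const
    · refine Eventually.of_forall fun l hl x hx => ?_
      have h1 : HasDerivAt h (deriv h (l * x)) (l * x) :=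
        (hh.differentiable (by simp) _).hasDerivAt
      have h2 : HasDerivAt (fun x => l * x) l x := by simpa using (hasDerivAt_id x).const_mul l
      have h3 := (h1.scomp x h2).const_smul (l ^ k)
      convert! h3 using 1
      rw [smul_smul, pow_succ]
  rw [contDiff_infty]
  intro n
  induction n generalizing h k with
  | zero =>
    exact contDiff_zero.mpr (continuous_iff_continuousAt.mpr fun t => (hder h hh k t).continuousAt)
  | succ n ih =>
    rw [show ((n + 1 : ℕ) : WithTop ℕ∞) = (n : WithTop ℕ∞) + 1 by push_cast; rfl,
      contDiff_succ_iff_deriv]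
    refine ⟨fun t => (hder h hh k t).differentiableAt, by simp, ?_⟩
    rw [show deriv (fun t : ℝ => ∫ l in (0 : ℝ)..1, l ^ k • h (l * t)) =
      fun t : ℝ => ∫ l in (0 : ℝ)..1, l ^ (k + 1) • deriv h (l * t) from
      funext fun t => (hder h hh k t).deriv]
    exact ih ((contDiff_infty_iff_deriv.mp hh).2) (k + 1)

/-- Hadamard's lemma: the quotient is the average of the derivative over the segment from `a` to
`t`. -/
theorem exists_smooth_factor {E : Type*} [NormedAddCommGroup E] [NormedSpace ℝ E]
    [CompleteSpace E] {f : ℝ → E} (hf : ContDiff ℝ ∞ f) {a : ℝ} (h0 : f a = 0) :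
    ∃ g : ℝ → E, ContDiff ℝ ∞ g ∧ ∀ t, f t = (t - a) • g t := by
  let h : ℝ → E := fun t => f (a + t)
  have hh : ContDiff ℝ ∞ h := hf.comp (contDiff_const.add contDiff_id)
  refine ⟨fun t => ∫ l in (0 : ℝ)..1, l ^ 0 • deriv h (l * (t - a)),
    (contDiff_integral_pow_smul (contDiff_infty_iff_deriv.mp hh).2 0).comp
      (contDiff_id.sub contDiff_const), fun t => ?_⟩
  simp only [pow_zero, one_smul]
  rw [← intervalIntegral.integral_smul]
  have := intervalIntegral.integral_eq_sub_of_hasDerivAt (a := 0) (b := 1)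
    (f := fun l : ℝ => h (l * (t - a))) (f' := fun l => (t - a) • deriv h (l * (t - a))) ?_ ?_
  · rw [this]; simp [h, h0]
  · intro l _
    have h1 : HasDerivAt h (deriv h (l * (t - a))) (l * (t - a)) :=
        (hh.differentiable (by simp) _).hasDerivAt
    have h2 : HasDerivAt (fun l => l * (t - a)) (t - a) l := by
      simpa using (hasDerivAt_id l).mul_const (t - a)
    exact HasDerivAt.scomp (g₁ := h) l h1 h2
  · apply Continuous.intervalIntegrable
    have : Continuous (deriv h) := hh.continuous_deriv (by simp)
    fun_prop

/-! ### Dividing out simple zeros of periodic functions -/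

/-- Near a zero of `p` the quotient is that of the two Hadamard factors. The value there, given by
l'Hôpital's rule, is exported because it is needed to check periodicity. -/
theorem exists_smooth_quotient {E : Type*} [NormedAddCommGroup E] [NormedSpace ℝ E]
    [CompleteSpace E] {f : ℝ → E} {p : ℝ → ℝ} (hf : ContDiff ℝ ∞ f) (hp : ContDiff ℝ ∞ p)
    (hz : ∀ t, p t = 0 → f t = 0) (hs : ∀ t, p t = 0 → deriv p t ≠ 0) :
    ∃ g : ℝ → E, ContDiff ℝ ∞ g ∧ (∀ t, f t = p t • g t) ∧
      ∀ t, p t = 0 → g t = (deriv p t)⁻¹ • deriv f t := by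
  classical
  let g : ℝ → E := fun t => if p t = 0 then (deriv p t)⁻¹ • deriv f t else (p t)⁻¹ • f t
  refine ⟨g, ?_, fun t => ?_, fun t ht => by simp [g, ht]⟩
  · rw [contDiff_iff_contDiffAt]
    intro a
    by_cases ha : p a = 0
    · obtain ⟨F, hF, hfF⟩ := exists_smooth_factor hf (hz a ha)
      obtain ⟨P, hP, hpP⟩ := exists_smooth_factor hp ha
      have dP : deriv p a = P a := by
        have h1 : HasDerivAt (fun t => (t - a) • P t) ((a - a) • deriv P a + (1 : ℝ) • P a) a :=
          ((hasDerivAt_id a).sub_const a).smul ((hP.differentiable (by simp)) a).hasDerivAt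
        rw [show p = fun t => (t - a) • P t from funext hpP, h1.deriv]; simp
      have dF : deriv f a = F a := by
        have h1 : HasDerivAt (fun t => (t - a) • F t) ((a - a) • deriv F a + (1 : ℝ) • F a) a :=
          ((hasDerivAt_id a).sub_const a).smul ((hF.differentiable (by simp)) a).hasDerivAt
        rw [show f = fun t => (t - a) • F t from funext hfF, h1.deriv]; simp
      have hPa : P a ≠ 0 := dP ▸ hs a ha
      have h2 : g =ᶠ[𝓝 a] fun t => (P t)⁻¹ • F t := by
        filter_upwards [hP.continuous.continuousAt.eventually_ne hPa] with t ht
        by_cases hta : t = a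
        · subst hta; simp [g, ha, dP, dF]
        · have : p t ≠ 0 := by
            rw [hpP]; exact smul_ne_zero (sub_ne_zero.mpr hta) ht
          simp only [g, this, if_false]
          rw [hfF, hpP, smul_eq_mul, smul_smul]
          congr 1
          field_simp [sub_ne_zero.mpr hta]
      exact ((hP.contDiffAt.inv hPa).smul hF.contDiffAt).congr_of_eventuallyEq h2
    · have h2 : g =ᶠ[𝓝 a] fun t => (p t)⁻¹ • f t := by
        filter_upwards [hp.continuous.continuousAt.eventually_ne ha] with t ht
        simp [g, ht]
      exact ((hp.contDiffAt.inv ha).smul hf.contDiffAt).congr_of_eventuallyEq h2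
  · by_cases h : p t = 0
    · simp [h, hz t h]
    · simp [g, h, smul_smul]

theorem eq_smul_fract {E : Type*} [NormedAddCommGroup E] [NormedSpace ℝ E] {f : ℝ → E} {ε : ℝ}
    (hε : ε ≠ 0) (hf : ∀ t, f (t + 1) = ε • f t) (t : ℝ) (n : ℤ) : f (t + n) = ε ^ n • f t := by
  induction n with
  | zero => simp
  | succ n ih =>
    rw [show t + ((n + 1 : ℤ) : ℝ) = t + (n : ℤ) + 1 by push_cast; ring, hf, ih, smul_smul,
      zpow_add_one₀ hε, mul_comm]
  | pred n ih =>
    have h := hf (t + ((-(n : ℤ) - 1 : ℤ) : ℝ))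
    rw [show t + ((-(n : ℤ) - 1 : ℤ) : ℝ) + 1 = t + ((-(n : ℤ) : ℤ) : ℝ) by push_cast; ring, ih] at h
    rw [zpow_sub_one₀ hε, mul_comm, mul_smul, h, inv_smul_smul₀ hε]

theorem deriv_quasiperiodic {E : Type*} [NormedAddCommGroup E] [NormedSpace ℝ E] {f : ℝ → E}
    {ε : ℝ} (hd : Differentiable ℝ f) (hf : ∀ t, f (t + 1) = ε • f t) (t : ℝ) :
    deriv f (t + 1) = ε • deriv f t := by
  have h1 : HasDerivAt (fun t => f (t + 1)) (deriv f (t + 1)) t :=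
    HasDerivAt.comp_add_const t 1 (hd (t + 1)).hasDerivAt
  have h2 : HasDerivAt (fun t => f (t + 1)) (ε • deriv f t) t := by
    simp_rw [hf]; exact (hd t).hasDerivAt.const_smul ε
  exact h1.unique h2

theorem periodic_deriv {E : Type*} [NormedAddCommGroup E] [NormedSpace ℝ E] {f : ℝ → E}
    (hd : Differentiable ℝ f) (hf : Function.Periodic f 1) : Function.Periodic (deriv f) 1 :=
  fun t => by
    have := deriv_quasiperiodic (ε := 1) hd (fun t => by rw [one_smul]; exact hf t) t
    rwa [one_smul] at this

/-- Each zero `a` is removed by dividing by `sin (π (t - a))`, which changes sign under `t ↦ t + 1`.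
The multiplier `ε` keeps track of these signs in the induction. After all divisions it has gained
the factor `(-1) ^ S.card`, which is the parity obstruction to a blackboard framing. -/
theorem exists_factor_simple_zeros {E : Type*} [NormedAddCommGroup E] [NormedSpace ℝ E]
    [CompleteSpace E] (S : Finset ℝ) : (∀ t ∈ S, t ∈ Set.Ico (0 : ℝ) 1) → ∀ (f : ℝ → E) (ε : ℝ),
    ContDiff ℝ ∞ f → ε ≠ 0 → (∀ t, f (t + 1) = ε • f t) →
    (∀ t ∈ Set.Ico (0 : ℝ) 1, f t = 0 → t ∈ S) → (∀ t ∈ S, f t = 0 ∧ deriv f t ≠ 0) →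
    ∃ (p : ℝ → ℝ) (m : ℝ → E), ContDiff ℝ ∞ m ∧ (∀ t, f t = p t • m t) ∧ (∀ t, m t ≠ 0) ∧
      ∀ t, m (t + 1) = ((-1) ^ S.card * ε) • m t := by
  induction S using Finset.induction_on with
  | empty =>
    intro _ f ε hf hε hper hz _
    refine ⟨fun _ => 1, f, hf, by simp, fun t ht => ?_, by simpa using hper⟩
    have h := eq_smul_fract hε hper t (-⌊t⌋)
    rw [ht, smul_zero] at h
    refine absurd (hz (Int.fract t) ⟨Int.fract_nonneg t, Int.fract_lt_one t⟩ ?_) (by simp)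
    rw [← h, Int.fract]; push_cast; ring_nf
  | insert a S haS ih =>
    intro hS f ε hf hε hper hz hsimple
    let s : ℝ → ℝ := fun t => Real.sin (Real.pi * (t - a))
    have hsd : ∀ t, HasDerivAt s (Real.cos (Real.pi * (t - a)) * Real.pi) t := fun t => by
      have h1 : HasDerivAt (fun t => Real.pi * (t - a)) Real.pi t := by
        simpa using ((hasDerivAt_id t).sub_const a).const_mul Real.pi
      exact (Real.hasDerivAt_sin _).comp t h1
    have hs0 : ∀ t, s t = 0 → ∃ n : ℤ, t = a + n := by
      intro t ht
      obtain ⟨n, hn⟩ := Real.sin_eq_zero_iff.mp ht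
      refine ⟨n, ?_⟩
      have := mul_left_cancel₀ Real.pi_ne_zero (show Real.pi * n = Real.pi * (t - a) by linarith)
      linarith
    have hs1 : ∀ t, s (t + 1) = -s t := fun t => by
      simp only [s]; rw [← Real.sin_add_pi]; ring_nf
    have hsc : ContDiff ℝ ∞ s := by
      apply Real.contDiff_sin.comp
      fun_prop
    have hsz : ∀ t, s t = 0 → deriv s t ≠ 0 := fun t ht => by
      rw [(hsd t).deriv]
      refine mul_ne_zero (fun hc => ?_) Real.pi_ne_zero
      have := Real.sin_sq_add_cos_sq (Real.pi * (t - a))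
      rw [hc, show Real.sin (Real.pi * (t - a)) = 0 from ht] at this
      norm_num at this
    have ha := hsimple a (Finset.mem_insert_self a S)
    obtain ⟨g, hg, hfg, hgz⟩ := exists_smooth_quotient hf hsc (fun t ht => by
      obtain ⟨n, rfl⟩ := hs0 t ht
      rw [eq_smul_fract hε hper, ha.1, smul_zero]) hsz
    have hsa : s a = 0 := by simp [s]
    have dfg : ∀ t, deriv f t = s t • deriv g t + deriv s t • g t := fun t => by
      rw [show f = fun t => s t • g t from funext hfg]
      exact (((hsd t).differentiableAt.hasDerivAt).smul
        ((hg.differentiable (by simp)) t).hasDerivAt).deriv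
    have hgper : ∀ t, g (t + 1) = (-ε) • g t := fun t => by
      by_cases ht : s t = 0
      · rw [hgz t ht, hgz (t + 1) (by rw [hs1, ht, neg_zero]),
          deriv_quasiperiodic (hf.differentiable (by simp)) hper,
          deriv_quasiperiodic (ε := -1) (hsc.differentiable (by simp)) (by simpa using hs1),
          smul_smul, smul_smul]
        congr 1
        rw [smul_eq_mul, mul_inv]; norm_num; ring
      · have h1 := hfg (t + 1)
        rw [hper, hfg t, hs1, smul_smul] at h1
        have h2 : s t • g (t + 1) = s t • ((-ε) • g t) := by
          rw [smul_smul, mul_neg, neg_smul, mul_comm, h1, neg_smul, neg_neg]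
        exact smul_right_injective E ht h2
    have hne : ∀ t ∈ S, s t ≠ 0 := fun t ht h0 => by
      obtain ⟨n, hn⟩ := hs0 t h0
      have h1 := hS t (Finset.mem_insert_of_mem ht)
      have h2 := hS a (Finset.mem_insert_self a S)
      have h3 : n < 1 := by
        have : (n : ℝ) < 1 := by linarith [h1.2, h2.1]
        exact_mod_cast this
      have h4 : -1 < n := by
        have : (-1 : ℝ) < n := by linarith [h1.1, h2.2]
        exact_mod_cast this
      have h5 : n = 0 := by omega
      rw [h5] at hn
      simp at hn
      exact haS (hn ▸ ht)
    -- The zero of `f` at `a` is simple, so `g` no longer vanishes there; at the other points of `S`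
    -- simple zeros stay simple.
    obtain ⟨p, m, hm, hgm, hm0, hmper⟩ := ih (fun t ht => hS t (Finset.mem_insert_of_mem ht)) g (-ε)
      hg (neg_ne_zero.mpr hε) hgper (fun t ht h0 => by
        have h1 := hz t ht (by rw [hfg, h0, smul_zero])
        rcases Finset.mem_insert.mp h1 with rfl | h2
        · have := ha.2
          rw [dfg, hsa, h0] at this
          simp at this
        · exact h2) (fun t ht => by
        have h1 := hsimple t (Finset.mem_insert_of_mem ht)
        have h2 : g t = 0 := by
          have := h1.1
          rw [hfg] at this
          exact (smul_eq_zero.mp this).resolve_left (hne t ht)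
        refine ⟨h2, fun h3 => h1.2 ?_⟩
        rw [dfg, h2, h3]; simp)
    refine ⟨fun t => s t * p t, m, hm, fun t => by rw [hfg, hgm, smul_smul], hm0, fun t => ?_⟩
    rw [hmper, Finset.card_insert_of_notMem haS, pow_succ]
    congr 1; ring

/-! ### Blackboard framings -/

theorem hasDerivAt_coord {c : ℝ → E3} {c' : E3} {t : ℝ} (h : HasDerivAt c c' t) (i : Fin 3) :
    HasDerivAt (fun t => c t i) (c' i) t :=
  (EuclideanSpace.proj i : E3 →L[ℝ] ℝ).hasFDerivAt.comp_hasDerivAt t h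

theorem cuspDet_eq (γ : ℝ → E3) (t : ℝ) : cuspDet γ t =
    deriv (deriv γ) t 0 * deriv (deriv (deriv γ)) t 1 -
      deriv (deriv γ) t 1 * deriv (deriv (deriv γ)) t 0 := by
  have h2 : iteratedDeriv 2 γ = deriv (deriv γ) := by rw [iteratedDeriv_succ, iteratedDeriv_one]
  have h3 : iteratedDeriv 3 γ = deriv (deriv (deriv γ)) := by rw [iteratedDeriv_succ, h2]
  rw [cuspDet, h2, h3]

section Curve

variable {γ : ℝ → E3} (hγ : IsSmoothClosedCurve γ)
include hγ

theorem IsSmoothClosedCurve.contDiff_deriv : ContDiff ℝ ∞ (deriv γ) :=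
  (contDiff_infty_iff_deriv.mp hγ.smooth).2

theorem IsSmoothClosedCurve.contDiff_deriv_two : ContDiff ℝ ∞ (deriv (deriv γ)) :=
  (contDiff_infty_iff_deriv.mp hγ.contDiff_deriv).2

theorem IsSmoothClosedCurve.hasDerivAt (t : ℝ) : HasDerivAt γ (deriv γ t) t :=
  (hγ.smooth.differentiable (by simp) t).hasDerivAt

theorem IsSmoothClosedCurve.hasDerivAt_deriv (t : ℝ) :
    HasDerivAt (deriv γ) (deriv (deriv γ) t) t :=
  (hγ.contDiff_deriv.differentiable (by simp) t).hasDerivAt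

theorem IsSmoothClosedCurve.periodic_deriv : Function.Periodic (deriv γ) 1 :=
  ProfileCurve.periodic_deriv (hγ.smooth.differentiable (by simp)) hγ.periodic

theorem IsSmoothClosedCurve.eq_add_int {s t : ℝ} (h : γ s = γ t) : ∃ n : ℤ, s = t + n := by
  have h1 : γ (Int.fract s) = γ (Int.fract t) := by
    have hs := hγ.periodic.sub_zsmul_eq ⌊s⌋ (x := s)
    have ht := hγ.periodic.sub_zsmul_eq ⌊t⌋ (x := t)
    simp only [zsmul_eq_mul, mul_one] at hs ht
    rw [Int.fract, Int.fract, hs, ht, h]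
  have h2 := hγ.injOn ⟨Int.fract_nonneg s, Int.fract_lt_one s⟩
    ⟨Int.fract_nonneg t, Int.fract_lt_one t⟩ h1
  refine ⟨⌊s⌋ - ⌊t⌋, ?_⟩
  rw [Int.fract, Int.fract] at h2
  push_cast; linarith

theorem IsSmoothClosedCurve.fract_mem_verticalParams {t : ℝ} (h : IsVerticalAt γ t) :
    Int.fract t ∈ verticalParams γ := by
  refine ⟨⟨Int.fract_nonneg t, Int.fract_lt_one t⟩, ?_⟩
  have h1 : deriv γ (Int.fract t) = deriv γ t := by
    have := hγ.periodic_deriv.sub_zsmul_eq ⌊t⌋ (x := t)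
    rwa [zsmul_eq_mul, mul_one] at this
  rwa [IsVerticalAt, h1]

theorem IsSmoothClosedCurve.cuspDet_eq_fract (t : ℝ) : cuspDet γ (Int.fract t) = cuspDet γ t := by
  have h2 := ProfileCurve.periodic_deriv (hγ.contDiff_deriv.differentiable (by simp)) hγ.periodic_deriv
  have h3 := ProfileCurve.periodic_deriv (hγ.contDiff_deriv_two.differentiable (by simp)) h2
  have h2' := h2.sub_zsmul_eq ⌊t⌋ (x := t)
  have h3' := h3.sub_zsmul_eq ⌊t⌋ (x := t)
  simp only [zsmul_eq_mul, mul_one] at h2' h3'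
  rw [cuspDet_eq, cuspDet_eq, Int.fract, h2', h3']

theorem IsSmoothClosedCurve.dense_nonvertical (hfin : (verticalParams γ).Finite) :
    Dense {t | ¬ IsVerticalAt γ t} := by
  have : {t | IsVerticalAt γ t} ⊆ ⋃ n : ℤ, (fun x : ℝ => x + n) '' verticalParams γ := by
    intro t ht
    exact Set.mem_iUnion.mpr ⟨⌊t⌋, Int.fract t, hγ.fract_mem_verticalParams ht, Int.fract_add_floor t⟩
  have hc : {t | IsVerticalAt γ t}.Countable :=
    (Set.countable_iUnion fun n => (hfin.countable.image _)).mono this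
  exact hc.dense_compl ℝ

/-- The horizontal velocity is `p • m` with `m` nowhere zero, and `β` is the normalized quarter turn
of `m`. An ordinary cusp is a simple zero of the horizontal velocity, and an even number of them
makes `m` periodic rather than antiperiodic. -/
theorem exists_blackboardFraming (hcusp : HasEvenCuspsOfOneChirality γ) :
    ∃ β, IsBlackboardFraming γ β ∧ ContDiff ℝ ∞ β := by
  obtain ⟨hfin, heven, hchi⟩ := hcusp
  have hdet : ∀ t ∈ verticalParams γ, cuspDet γ t ≠ 0 := fun t ht =>
    hchi.elim (fun h => (h t ht).2.ne') (fun h => (h t ht).2.ne)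
  let u : ℝ → ℝ × ℝ := fun t => (deriv γ t 0, deriv γ t 1)
  have hu : ContDiff ℝ ∞ u :=
    (ContDiff.coord hγ.contDiff_deriv 0).prodMk (ContDiff.coord hγ.contDiff_deriv 1)
  have hud : ∀ t, HasDerivAt u (deriv (deriv γ) t 0, deriv (deriv γ) t 1) t := fun t =>
    (hasDerivAt_coord (hγ.hasDerivAt_deriv t) 0).prodMk (hasDerivAt_coord (hγ.hasDerivAt_deriv t) 1)
  obtain ⟨p, m, hm, hum, hm0, hmper⟩ := exists_factor_simple_zeros hfin.toFinset
    (fun t ht => ((Set.Finite.mem_toFinset _).mp ht).1) u 1 hu one_ne_zero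
    (fun t => by simp [u, hγ.periodic_deriv t])
    (fun t ht h0 => by
      simp only [u, Prod.mk_eq_zero] at h0
      exact (Set.Finite.mem_toFinset _).mpr ⟨ht, h0⟩)
    (fun t ht => by
      have ht' := (Set.Finite.mem_toFinset _).mp ht
      refine ⟨by simpa [u] using (show deriv γ t 0 = 0 ∧ deriv γ t 1 = 0 from ht'.2), fun h0 => hdet t ht' ?_⟩
      rw [(hud t).deriv] at h0
      simp only [Prod.mk_eq_zero] at h0
      simp [cuspDet_eq, h0.1, h0.2])
  have hcard : (-1 : ℝ) ^ hfin.toFinset.card * 1 = 1 := by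
    rw [← Set.ncard_eq_toFinset_card _ hfin, heven.neg_one_pow, one_mul]
  rw [hcard] at hmper
  let q : ℝ → ℝ := fun t => (m t).1 ^ 2 + (m t).2 ^ 2
  have hq : ∀ t, 0 < q t := fun t => by
    have : (m t).1 ≠ 0 ∨ (m t).2 ≠ 0 := by
      by_contra! h
      exact hm0 t (Prod.ext h.1 h.2)
    rcases this with h | h
    · have := sq_pos_of_ne_zero h; positivity
    · have := sq_pos_of_ne_zero h; positivity
  let r : ℝ → ℝ := fun t => (√(q t))⁻¹
  have hr2 : ∀ t, r t ^ 2 * q t = 1 := fun t => by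
    simp only [r]; rw [inv_pow, Real.sq_sqrt (hq t).le, inv_mul_cancel₀ (hq t).ne']
  have hqc : ContDiff ℝ ∞ q := (hm.fst.pow 2).add (hm.snd.pow 2)
  have hr : ContDiff ℝ ∞ r :=
    (hqc.sqrt fun t => (hq t).ne').inv fun t => (Real.sqrt_pos.mpr (hq t)).ne'
  let β : ℝ → E3 := fun t => !₂[-(r t * (m t).2), r t * (m t).1, 0]
  have hβ : ContDiff ℝ ∞ β := by
    apply contDiff_of_coords
    · simpa [β] using (hr.mul hm.snd).neg
    · simpa [β] using hr.mul hm.fst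
    · simpa [β] using contDiff_const
  refine ⟨β, ⟨hβ.continuous, fun t => ?_, fun t => ?_, fun t => by simp [β], fun t => ?_⟩, hβ⟩
  · have h1 : m (t + 1) = m t := by simpa using hmper t
    simp [β, r, q, h1]
  · have : ‖β t‖ ^ 2 = 1 := by
      rw [norm_sq_eq_coords, ← hr2 t]; simp [β, q]; ring
    exact (pow_eq_one_iff_of_nonneg (norm_nonneg _) two_ne_zero).mp this
  · have h0 : deriv γ t 0 = p t * (m t).1 := congrArg Prod.fst (hum t)
    have h1 : deriv γ t 1 = p t * (m t).2 := congrArg Prod.snd (hum t)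
    rw [inner_eq_coords, h0, h1]; simp [β]; ring

omit hγ in
theorem unit_eq_smul_of_inner {u v : E3} (hu : ‖u‖ = 1) (hv : ‖v‖ = 1)
    (h : inner ℝ u v ^ 2 = 1) : u = inner ℝ u v • v := by
  rw [← sub_eq_zero, ← norm_eq_zero, ← sq_eq_zero_iff, norm_sub_sq_real, norm_smul,
    inner_smul_right, hu, hv, mul_pow, Real.norm_eq_abs, sq_abs]
  linarith

omit hγ in
theorem const_sign {σ : ℝ → ℝ} (hσ : Continuous σ) (h : ∀ t, σ t ^ 2 = 1) :
    (∀ t, σ t = 1) ∨ ∀ t, σ t = -1 := by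
  rcases isPreconnected_univ.eq_one_or_eq_neg_one_of_sq_eq (f := σ) hσ.continuousOn
    (fun t _ => h t) with h | h
  · exact Or.inl fun t => h (Set.mem_univ t)
  · exact Or.inr fun t => h (Set.mem_univ t)

/-- At a nonvertical point the horizontal unit normals form a pair `±β`. Nonvertical parameters are
dense, so `⟨β', β⟩ ^ 2 = 1` everywhere, and connectedness makes the sign constant. -/
theorem blackboardFraming_unique (hfin : (verticalParams γ).Finite) {β β' : ℝ → E3}
    (hβ : IsBlackboardFraming γ β) (hβ' : IsBlackboardFraming γ β') :
    β' = β ∨ β' = fun t => -β t := by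
  have hc : Continuous fun t => inner ℝ (β' t) (β t) := hβ'.continuous.inner hβ.continuous
  have hsq : ∀ t, inner ℝ (β' t) (β t) ^ 2 = 1 := by
    have hcl : IsClosed {t | inner ℝ (β' t) (β t) ^ 2 = 1} :=
      isClosed_eq (hc.pow 2) continuous_const
    have hsub : {t | ¬ IsVerticalAt γ t} ⊆ {t | inner ℝ (β' t) (β t) ^ 2 = 1} := by
      intro t ht
      have n1 : ‖β t‖ ^ 2 = 1 := by rw [hβ.norm_eq_one]; norm_num
      have n2 : ‖β' t‖ ^ 2 = 1 := by rw [hβ'.norm_eq_one]; norm_num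
      have i1 := hβ.normal t
      have i2 := hβ'.normal t
      rw [norm_sq_eq_coords, hβ.horizontal] at n1
      rw [norm_sq_eq_coords, hβ'.horizontal] at n2
      rw [inner_eq_coords, hβ.horizontal] at i1
      rw [inner_eq_coords, hβ'.horizontal] at i2
      have hd : β t 0 * β' t 1 - β t 1 * β' t 0 = 0 := by
        by_contra hne
        apply ht
        constructor
        · apply mul_left_cancel₀ hne
          linear_combination (β' t 1) * i1 - (β t 1) * i2
        · apply mul_left_cancel₀ hne
          linear_combination (-β' t 0) * i1 + (β t 0) * i2
      show inner ℝ (β' t) (β t) ^ 2 = 1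
      rw [inner_eq_coords, hβ.horizontal]
      linear_combination (β' t 0 ^ 2 + β' t 1 ^ 2) * n1 + n2 -
        (β t 0 * β' t 1 - β t 1 * β' t 0) * hd
    intro t
    have := (hγ.dense_nonvertical hfin).mono hsub
    exact (hcl.closure_eq ▸ this.closure_eq ▸ Set.mem_univ t : t ∈ {t | _})
  rcases const_sign hc hsq with h | h
  · left; ext1 t
    have := unit_eq_smul_of_inner (hβ'.norm_eq_one t) (hβ.norm_eq_one t) (hsq t)
    rw [this, h, one_smul]
  · right; ext1 t
    have := unit_eq_smul_of_inner (hβ'.norm_eq_one t) (hβ.norm_eq_one t) (hsq t)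
    rw [this, h, neg_one_smul]

end Curve

/-! ### Unit normal fields along curves -/

theorem inner_gradient (g : E3 → ℝ) (x v : E3) : inner ℝ (gradient g x) v = fderiv ℝ g x v := by
  rw [← toDual_gradient]; simp

theorem IsLocalEquation.contDiffAt_gradient {F : Set E3} {p : E3} {g : E3 → ℝ}
    (h : IsLocalEquation F p g) : ContDiffAt ℝ ∞ (gradient g) p := by
  have : ContDiffAt ℝ ∞ (fderiv ℝ g) p := h.contDiffAt.fderiv_right (by simp)
  exact (InnerProductSpace.toDual ℝ E3).symm.toContinuousLinearEquiv.contDiff.contDiffAt.comp p this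

theorem IsLocalEquation.gradient_ne {F : Set E3} {p : E3} {g : E3 → ℝ}
    (h : IsLocalEquation F p g) : gradient g p ≠ 0 := fun h0 =>
  h.fderiv_ne (ContinuousLinearMap.ext fun v => by rw [← inner_gradient, h0]; simp)

theorem gradient_eq_smul_of_normal {F : Set E3} {p n : E3} (hp : p ∈ F) (hn1 : ‖n‖ = 1)
    (hnor : ∀ v ∈ tangentVectors F p, inner ℝ n v = 0) {g : E3 → ℝ} (h : IsLocalEquation F p g) :
    gradient g p = inner ℝ n (gradient g p) • n := by
  set G := gradient g p with hG
  set c := inner ℝ n G with hc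
  have hGG : inner ℝ G G ≠ 0 := inner_self_ne_zero.mpr h.gradient_ne
  have hn : inner ℝ n n = (1 : ℝ) := by
    rw [real_inner_self_eq_norm_sq, hn1]; norm_num
  -- The component of `n` orthogonal to the gradient is tangent. Orthogonality to `n` then gives
  -- equality in the Cauchy–Schwarz inequality.
  have htan : n - (c / inner ℝ G G) • G ∈ tangentVectors F p := by
    apply mem_tangentVectors_of_fderiv hp h
    rw [← inner_gradient, ← hG, inner_sub_right, inner_smul_right, real_inner_comm, ← hc]
    field_simp; ring
  have h1 := hnor _ htan
  rw [inner_sub_right, inner_smul_right, hn, ← hc] at h1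
  have h2 : c ^ 2 = inner ℝ G G := by field_simp at h1; linarith
  have : inner ℝ (G - c • n) (G - c • n) = 0 := by
    rw [inner_sub_left, inner_sub_right, inner_sub_right, inner_smul_right, inner_smul_left,
      inner_smul_left, inner_smul_right, hn, real_inner_comm n G, ← hc, ← h2]
    simp; ring
  exact sub_eq_zero.mp (inner_self_eq_zero.mp this)

theorem IsUnitNormalField.gradient_eq {F : Set E3} {ν : E3 → E3} (hν : IsUnitNormalField F ν)
    {p : E3} (hp : p ∈ F) {g : E3 → ℝ} (h : IsLocalEquation F p g) :
    gradient g p = inner ℝ (ν p) (gradient g p) • ν p :=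
  gradient_eq_smul_of_normal hp (hν.norm_eq_one p hp) (hν.normal p hp) h

/-- A unit normal is only assumed continuous, but locally it is the normalized gradient of an
equation up to a sign, and continuity fixes that sign. -/
theorem IsUnitNormalField.contDiff_comp {F : Set E3} (hF : IsSmoothSurface F) {ν : E3 → E3}
    (hν : IsUnitNormalField F ν) {γ : ℝ → E3} (hγ : ContDiff ℝ ∞ γ) (hγF : ∀ t, γ t ∈ F) :
    ContDiff ℝ ∞ fun t => ν (γ t) := by
  have hνc : Continuous fun t => ν (γ t) := hν.continuousOn.comp_continuous hγ.continuous hγF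
  rw [contDiff_iff_contDiffAt]
  intro t₀
  obtain ⟨g, hg⟩ := hF _ (hγF t₀)
  let c : ℝ → ℝ := fun t => inner ℝ (ν (γ t)) (gradient g (γ t))
  have hG : ContDiffAt ℝ ∞ (fun t => gradient g (γ t)) t₀ :=
    hg.contDiffAt_gradient.comp t₀ hγ.contDiffAt
  have hev : ∀ᶠ t in 𝓝 t₀, gradient g (γ t) = c t • ν (γ t) := by
    filter_upwards [hγ.continuous.continuousAt.eventually hg.eventually] with t ht
    exact hν.gradient_eq (hγF t) ht
  have hc : ContinuousAt c t₀ := hνc.continuousAt.inner hG.continuousAt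
  have hc0 : c t₀ ≠ 0 := fun h0 => by
    have := hev.self_of_nhds
    rw [h0, zero_smul] at this
    exact hg.gradient_ne this
  have hG0 : gradient g (γ t₀) ≠ 0 := hg.gradient_ne
  obtain ⟨σ, hσ, hcσ⟩ : ∃ σ : ℝ, σ ^ 2 = 1 ∧ ∀ᶠ t in 𝓝 t₀, 0 < σ * c t := by
    rcases lt_or_gt_of_ne hc0 with h | h
    · refine ⟨-1, by norm_num, ?_⟩
      filter_upwards [hc.eventually (gt_mem_nhds h)] with t ht using by linarith
    · refine ⟨1, by norm_num, ?_⟩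
      filter_upwards [hc.eventually (lt_mem_nhds h)] with t ht using by linarith
  have heq : (fun t => ν (γ t)) =ᶠ[𝓝 t₀]
      fun t => σ • ((‖gradient g (γ t)‖)⁻¹ • gradient g (γ t)) := by
    filter_upwards [hev, hcσ] with t h1 h2
    have hcn : ‖gradient g (γ t)‖ = σ * c t := by
      rw [h1, norm_smul, hν.norm_eq_one _ (hγF t), mul_one, Real.norm_eq_abs,
        ← abs_of_pos h2, abs_mul, show |σ| = 1 from
          (pow_eq_one_iff_of_nonneg (abs_nonneg σ) two_ne_zero).mp (by rw [sq_abs, hσ]), one_mul]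
    have hct : c t ≠ 0 := fun h0 => by simp [h0] at h2
    have hσ0 : σ ≠ 0 := fun h0 => by simp [h0] at h2
    rw [hcn]
    rw [h1]
    rw [smul_smul, smul_smul]
    have : σ * (σ * c t)⁻¹ * c t = 1 := by field_simp
    rw [this, one_smul]
  have hsm : ContDiffAt ℝ ∞ (fun t => σ • ((‖gradient g (γ t)‖)⁻¹ • gradient g (γ t))) t₀ :=
by
    have h1 : ContDiffAt ℝ ∞ (fun t => (‖gradient g (γ t)‖)⁻¹) t₀ :=
      (hG.norm ℝ hG0).inv (norm_ne_zero_iff.mpr hG0)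
    exact (contDiffAt_const (c := σ)).smul (h1.smul hG)
  exact hsm.congr_of_eventuallyEq heq

theorem IsUnitNormalField.unique_along {F : Set E3} (hF : IsSmoothSurface F) {ν ν' : E3 → E3}
    (hν : IsUnitNormalField F ν) (hν' : IsUnitNormalField F ν') {γ : ℝ → E3} (hγ : Continuous γ)
    (hγF : ∀ t, γ t ∈ F) :
    ((fun t => ν' (γ t)) = fun t => ν (γ t)) ∨ (fun t => ν' (γ t)) = fun t => -ν (γ t) := by
  have hc : Continuous fun t => inner ℝ (ν' (γ t)) (ν (γ t)) :=
    (hν'.continuousOn.comp_continuous hγ hγF).inner (hν.continuousOn.comp_continuous hγ hγF)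
  have hsq : ∀ t, inner ℝ (ν' (γ t)) (ν (γ t)) ^ 2 = 1 := fun t => by
    obtain ⟨g, hg⟩ := hF _ (hγF t)
    have h1 := hν.gradient_eq (hγF t) hg
    have h2 := hν'.gradient_eq (hγF t) hg
    set c := inner ℝ (ν (γ t)) (gradient g (γ t))
    set c' := inner ℝ (ν' (γ t)) (gradient g (γ t))
    have n1 : ‖gradient g (γ t)‖ ^ 2 = c ^ 2 := by
      rw [h1, norm_smul, hν.norm_eq_one _ (hγF t), mul_one, Real.norm_eq_abs, sq_abs]
    have n2 : c' = c * inner ℝ (ν' (γ t)) (ν (γ t)) := by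
      simp only [c']; rw [h1, inner_smul_right]
    have n3 : ‖gradient g (γ t)‖ ^ 2 = c' ^ 2 := by
      rw [h2, norm_smul, hν'.norm_eq_one _ (hγF t), mul_one, Real.norm_eq_abs, sq_abs]
    have hc0 : c ^ 2 ≠ 0 := by
      rw [← n1]; exact pow_ne_zero _ (norm_ne_zero_iff.mpr hg.gradient_ne)
    apply mul_left_cancel₀ hc0
    rw [mul_one, ← mul_pow, ← n2, ← n3, n1]
  rcases const_sign hc hsq with h | h
  · left; ext1 t
    have := unit_eq_smul_of_inner (hν'.norm_eq_one _ (hγF t)) (hν.norm_eq_one _ (hγF t)) (hsq t)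
    rw [this, h, one_smul]
  · right; ext1 t
    have := unit_eq_smul_of_inner (hν'.norm_eq_one _ (hγF t)) (hν.norm_eq_one _ (hγF t)) (hsq t)
    rw [this, h, neg_one_smul]

theorem IsUnitNormalField.inner_deriv {F : Set E3} {ν : E3 → E3} (hν : IsUnitNormalField F ν)
    {γ : ℝ → E3} (hγ : ContDiff ℝ ∞ γ) (hγF : ∀ t, γ t ∈ F) (t : ℝ) :
    inner ℝ (ν (γ t)) (deriv γ t) = 0 := by
  apply hν.normal _ (hγF t)
  refine ⟨fun s => γ (t + s), (hγ.comp (contDiff_const.add contDiff_id)).contDiffAt, by simp,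
    Eventually.of_forall fun s => hγF _, ?_⟩
  rw [deriv_comp_const_add, add_zero]

/-! ### Framed curves and their tubular neighbourhoods -/

/-- `β` is a smooth unit normal field along the smooth closed curve `γ`. -/
structure IsFramed (γ β : ℝ → E3) : Prop where
  curve : IsSmoothClosedCurve γ
  smooth : ContDiff ℝ ∞ β
  periodic : Function.Periodic β 1
  norm_eq_one : ∀ t, ‖β t‖ = 1
  normal : ∀ t, inner ℝ (β t) (deriv γ t) = 0

/-- The unit tangent vector. -/
def unitTangent (γ : ℝ → E3) (t : ℝ) : E3 := ‖deriv γ t‖⁻¹ • deriv γ t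

/-- The vector that completes the unit tangent and `β` to a positive orthonormal frame. -/
def binormal (γ β : ℝ → E3) (t : ℝ) : E3 := cross (unitTangent γ t) (β t)

/-- Tubular coordinates around a framed curve. -/
def tubeMap (γ β : ℝ → E3) (q : ℝ × ℝ × ℝ) : E3 :=
  γ q.1 + q.2.1 • β q.1 + q.2.2 • binormal γ β q.1

namespace IsFramed

variable {γ β : ℝ → E3} (h : IsFramed γ β)
include h

theorem norm_deriv_pos (t : ℝ) : 0 < ‖deriv γ t‖ := norm_pos_iff.mpr (h.curve.regular t)

theorem norm_unitTangent (t : ℝ) : ‖unitTangent γ t‖ = 1 := by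
  rw [unitTangent, norm_smul, norm_inv, norm_norm, inv_mul_cancel₀ (h.norm_deriv_pos t).ne']

theorem deriv_eq_smul (t : ℝ) : deriv γ t = ‖deriv γ t‖ • unitTangent γ t := by
  rw [unitTangent, smul_smul, mul_inv_cancel₀ (h.norm_deriv_pos t).ne', one_smul]

theorem contDiff_unitTangent : ContDiff ℝ ∞ (unitTangent γ) := by
  have h1 : ContDiff ℝ ∞ fun t => ‖deriv γ t‖⁻¹ :=
    (h.curve.contDiff_deriv.norm ℝ fun t => h.curve.regular t).inv fun t => (h.norm_deriv_pos t).ne'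
  exact h1.smul h.curve.contDiff_deriv

theorem inner_unitTangent (t : ℝ) : inner ℝ (unitTangent γ t) (β t) = 0 := by
  rw [unitTangent, inner_smul_left, real_inner_comm, h.normal, mul_zero]

theorem contDiff_binormal : ContDiff ℝ ∞ (binormal γ β) :=
  ContDiff.cross h.contDiff_unitTangent h.smooth

theorem periodic_binormal : Function.Periodic (binormal γ β) 1 := fun t => by
  rw [binormal, binormal, unitTangent, unitTangent, h.curve.periodic_deriv t, h.periodic t]

theorem norm_binormal (t : ℝ) : ‖binormal γ β t‖ = 1 := by
  rw [binormal, norm_cross (h.inner_unitTangent t), h.norm_unitTangent, h.norm_eq_one, one_mul]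

omit h in
theorem inner_binormal (t : ℝ) : inner ℝ (β t) (binormal γ β t) = 0 := inner_cross_right _ _

omit h in
theorem unitTangent_inner_binormal (t : ℝ) : inner ℝ (unitTangent γ t) (binormal γ β t) = 0 :=
  inner_cross_left _ _

theorem binormal_normal (t : ℝ) : inner ℝ (binormal γ β t) (deriv γ t) = 0 := by
  rw [h.deriv_eq_smul, inner_smul_right, real_inner_comm, unitTangent_inner_binormal, mul_zero]

theorem expand (t : ℝ) (v : E3) : v = inner ℝ (unitTangent γ t) v • unitTangent γ t +
    inner ℝ (β t) v • β t + inner ℝ (binormal γ β t) v • binormal γ β t :=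
  orthonormal_expand (h.norm_unitTangent t) (h.norm_eq_one t) (h.norm_binormal t)
    (h.inner_unitTangent t) (unitTangent_inner_binormal t) (inner_binormal t) v

theorem expand_normal {t : ℝ} {v : E3} (hv : inner ℝ v (deriv γ t) = 0) :
    v = inner ℝ (β t) v • β t + inner ℝ (binormal γ β t) v • binormal γ β t := by
  have h1 : inner ℝ (unitTangent γ t) v = 0 := by
    rw [unitTangent, inner_smul_left, real_inner_comm, hv, mul_zero]
  have h2 := h.expand t v
  rwa [h1, zero_smul, zero_add] at h2

theorem inner_self_frame (t : ℝ) :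
    inner ℝ (β t) (β t) = (1 : ℝ) ∧ inner ℝ (binormal γ β t) (binormal γ β t) = (1 : ℝ) ∧
      inner ℝ (binormal γ β t) (β t) = 0 := by
  refine ⟨?_, ?_, ?_⟩
  · rw [real_inner_self_eq_norm_sq, h.norm_eq_one]; norm_num
  · rw [real_inner_self_eq_norm_sq, h.norm_binormal]; norm_num
  · rw [real_inner_comm, inner_binormal]

theorem inner_combination (t a b : ℝ) :
    inner ℝ (β t) (a • β t + b • binormal γ β t) = a ∧
      inner ℝ (binormal γ β t) (a • β t + b • binormal γ β t) = b := by
  obtain ⟨h1, h2, h3⟩ := h.inner_self_frame t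
  constructor <;> simp only [inner_add_right, inner_smul_right, h1, h2, h3, inner_binormal] <;> ring

theorem norm_sq_combination (t a b : ℝ) : ‖a • β t + b • binormal γ β t‖ ^ 2 = a ^ 2 + b ^ 2 := by
  rw [← real_inner_self_eq_norm_sq, inner_add_left, inner_smul_left, inner_smul_left,
    (h.inner_combination t a b).1, (h.inner_combination t a b).2]
  simp; ring

theorem contDiff_tubeMap : ContDiff ℝ ∞ (tubeMap γ β) := by
  have h1 := h.curve.smooth
  have h2 := h.smooth
  have h3 := h.contDiff_binormal
  unfold tubeMap
  fun_prop

theorem tubeMap_add_int (t a b : ℝ) (n : ℤ) : tubeMap γ β (t + n, a, b) = tubeMap γ β (t, a, b) := by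
  have h1 := h.curve.periodic.int_mul n t
  have h2 := h.periodic.int_mul n t
  have h3 := h.periodic_binormal.int_mul n t
  simp only [mul_one] at h1 h2 h3
  simp [tubeMap, h1, h2, h3]

theorem fderiv_tubeMap (q v : ℝ × ℝ × ℝ) : fderiv ℝ (tubeMap γ β) q v =
    v.1 • (deriv γ q.1 + q.2.1 • deriv β q.1 + q.2.2 • deriv (binormal γ β) q.1) +
      v.2.1 • β q.1 + v.2.2 • binormal γ β q.1 := by
  have hd1 := (h.curve.hasDerivAt q.1).hasFDerivAt.comp q (hasFDerivAt_fst (𝕜 := ℝ) (p := q))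
  have hd2 := ((h.smooth.differentiable (by simp) q.1).hasDerivAt).hasFDerivAt.comp q
    (hasFDerivAt_fst (𝕜 := ℝ) (p := q))
  have hd3 := ((h.contDiff_binormal.differentiable (by simp) q.1).hasDerivAt).hasFDerivAt.comp q
    (hasFDerivAt_fst (𝕜 := ℝ) (p := q))
  have ha : HasFDerivAt (fun q : ℝ × ℝ × ℝ => q.2.1) _ q :=
    (hasFDerivAt_fst (𝕜 := ℝ) (p := q.2)).comp q (hasFDerivAt_snd (𝕜 := ℝ) (p := q))
  have hb : HasFDerivAt (fun q : ℝ × ℝ × ℝ => q.2.2) _ q :=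
    (hasFDerivAt_snd (𝕜 := ℝ) (p := q.2)).comp q (hasFDerivAt_snd (𝕜 := ℝ) (p := q))
  have hall : HasFDerivAt (tubeMap γ β) _ q := (hd1.add (ha.smul hd2)).add (hb.smul hd3)
  rw [hall.fderiv]
  simp
  module

/-- The factor by which the tubular coordinates change the volume, up to a positive factor. -/
theorem fderiv_tubeMap_injective {q : ℝ × ℝ × ℝ}
    (hq : inner ℝ (deriv γ q.1) (deriv γ q.1 + q.2.1 • deriv β q.1 +
      q.2.2 • deriv (binormal γ β) q.1) ≠ 0) (v : ℝ × ℝ × ℝ)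
    (hv : fderiv ℝ (tubeMap γ β) q v = 0) : v = 0 := by
  rw [h.fderiv_tubeMap] at hv
  have h1 := congrArg (fun w => inner ℝ (deriv γ q.1) w) hv
  simp only [inner_add_right (deriv γ q.1) _ (v.2.2 • _),
    inner_add_right (deriv γ q.1) _ (v.2.1 • _), inner_smul_right, inner_zero_right] at h1
  rw [real_inner_comm (β q.1), real_inner_comm (binormal γ β q.1), h.normal, h.binormal_normal,
    mul_zero, mul_zero, add_zero, add_zero] at h1
  have h2 : v.1 = 0 := (mul_eq_zero.mp h1).resolve_right hq
  rw [h2, zero_smul, zero_add] at hv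
  have h3 := (h.inner_combination q.1 v.2.1 v.2.2).1
  have h4 := (h.inner_combination q.1 v.2.1 v.2.2).2
  rw [hv, inner_zero_right] at h3 h4
  exact Prod.ext h2 (Prod.ext h3.symm h4.symm)

end IsFramed

/-- `r` is the radius of an embedded tube around the framed curve. -/
structure IsTubeRadius (γ β : ℝ → E3) (r : ℝ) : Prop where
  pos : 0 < r
  local_inverse : ∀ t a b, a ^ 2 + b ^ 2 < r ^ 2 →
    ∀ v, fderiv ℝ (tubeMap γ β) (t, a, b) v = 0 → v = 0
  inj : ∀ t a b t' a' b', a ^ 2 + b ^ 2 < r ^ 2 → a' ^ 2 + b' ^ 2 < r ^ 2 →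
    tubeMap γ β (t, a, b) = tubeMap γ β (t', a', b') → (∃ n : ℤ, t' = t + n) ∧ a' = a ∧ b' = b

/-- The tubular neighbourhood theorem, by compactness in the parameters. Two nearby parameters are
separated by the local inverse, two distant ones by the embeddedness of `γ`. -/
theorem IsFramed.exists_tubeRadius {γ β : ℝ → E3} (h : IsFramed γ β) :
    ∃ r, IsTubeRadius γ β r := by
  let J : ℝ × ℝ × ℝ → ℝ := fun q => inner ℝ (deriv γ q.1) (deriv γ q.1 + q.2.1 • deriv β q.1 +
      q.2.2 • deriv (binormal γ β) q.1)
  have hJ : Continuous J := by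
    have h1 := h.curve.contDiff_deriv.continuous
    have h2 : Continuous (deriv β) := h.smooth.continuous_deriv (by simp)
    have h3 : Continuous (deriv (binormal γ β)) := h.contDiff_binormal.continuous_deriv (by simp)
    fun_prop
  have hJ0 : ∀ t, J (t, 0, 0) ≠ 0 := fun t => by
    simpa [J] using h.curve.regular t
  -- Here `x = (t, d)` holds a parameter and the difference of two parameters, and `y` holds the two
  -- pairs of normal coordinates. By periodicity `t ∈ [0, 1]` and `|d| ≤ 1 / 2` suffice.
  let P : (ℝ × ℝ) × (ℝ × ℝ) → ℝ × ℝ → Prop := fun y x => J (x.1, y.1) ≠ 0 ∧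
    (tubeMap γ β (x.1, y.1) = tubeMap γ β (x.1 + x.2, y.2) → x.2 = 0 ∧ y.2 = y.1)
  have hΦ := h.contDiff_tubeMap.continuous
  have key : ∀ᶠ y in 𝓝 (0 : (ℝ × ℝ) × (ℝ × ℝ)), ∀ x ∈ Set.Icc (0 : ℝ) 1 ×ˢ Set.Icc (-(1 / 2) : ℝ) (1 / 2),
      P y x := by
    refine (isCompact_Icc.prod isCompact_Icc).eventually_forall_of_forall_eventually ?_
    rintro ⟨t, d⟩ ⟨-, hd⟩
    have c1 : Continuous fun z : ((ℝ × ℝ) × (ℝ × ℝ)) × ℝ × ℝ => (z.2.1, z.1.1) := by fun_prop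
    have c2 : Continuous fun z : ((ℝ × ℝ) × (ℝ × ℝ)) × ℝ × ℝ => (z.2.1 + z.2.2, z.1.2) := by fun_prop
    have t1 : Tendsto (fun z : ((ℝ × ℝ) × (ℝ × ℝ)) × ℝ × ℝ => (z.2.1, z.1.1)) (𝓝 (0, (t, d)))
        (𝓝 (t, 0, 0)) := c1.tendsto' _ _ rfl
    have t2 : Tendsto (fun z : ((ℝ × ℝ) × (ℝ × ℝ)) × ℝ × ℝ => (z.2.1 + z.2.2, z.1.2)) (𝓝 (0, (t, d)))
        (𝓝 (t + d, 0, 0)) := c2.tendsto' _ _ rfl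
    refine Eventually.and (t1.eventually (hJ.continuousAt.eventually_ne (hJ0 t))) ?_
    by_cases hd0 : d = 0
    · subst hd0
      rw [add_zero] at t2
      obtain ⟨e, he, hes, -⟩ := exists_smooth_local_inverse (by simp [Module.finrank_prod]) h.contDiff_tubeMap.contDiffAt
        (h.fderiv_tubeMap_injective (q := (t, 0, 0)) (hJ0 t))
      filter_upwards [t1.eventually (e.open_source.mem_nhds hes),
        t2.eventually (e.open_source.mem_nhds hes)] with z h1 h2 h3
      have := e.injOn h1 h2 (by rw [he]; exact h3)
      simp only [Prod.mk.injEq] at this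
      exact ⟨by linarith [this.1], this.2.symm⟩
    · have hne : tubeMap γ β (t, 0, 0) ≠ tubeMap γ β (t + d, 0, 0) := by
        intro heq
        simp only [tubeMap, zero_smul, add_zero] at heq
        obtain ⟨n, hn⟩ := h.curve.eq_add_int heq
        have hn' : d = -n := by linarith
        have : |(n : ℝ)| < 1 := by
          rw [abs_lt]; constructor <;> linarith [hd.1, hd.2]
        have hn0 : n = 0 := by
          rw [← Int.abs_lt_one_iff]; exact_mod_cast this
        rw [hn0] at hn'; simp at hn'; exact hd0 hn'
      have t3 := (hΦ.continuousAt.tendsto.comp t1).prodMk_nhds (hΦ.continuousAt.tendsto.comp t2)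
      filter_upwards [t3.eventually ((isClosed_diagonal (X := E3)).isOpen_compl.mem_nhds
        (show (_, _) ∈ (Set.diagonal E3)ᶜ from hne))] with z h1 h2
      exact absurd h2 h1
  obtain ⟨r, hr, hball⟩ := Metric.eventually_nhds_iff.mp key
  have hsmall : ∀ a b : ℝ, a ^ 2 + b ^ 2 < r ^ 2 → dist ((a, b) : ℝ × ℝ) 0 < r := by
    intro a b hab
    rw [dist_zero_right, Prod.norm_mk, max_lt_iff, Real.norm_eq_abs, Real.norm_eq_abs]
    constructor <;> apply abs_lt_of_sq_lt_sq _ hr.le <;> nlinarith [sq_nonneg a, sq_nonneg b]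
  have hfr : ∀ t, Int.fract t ∈ Set.Icc (0 : ℝ) 1 := fun t =>
    ⟨Int.fract_nonneg t, (Int.fract_lt_one t).le⟩
  have hper : ∀ t a b, tubeMap γ β (Int.fract t, a, b) = tubeMap γ β (t, a, b) := fun t a b => by
    rw [← h.tubeMap_add_int (Int.fract t) a b ⌊t⌋, Int.fract_add_floor]
  refine ⟨r, hr, fun t a b hab => ?_, fun t a b t' a' b' hab hab' heq => ?_⟩
  · have h1 := (@hball ((a, b), (a, b)) (max_lt (hsmall a b hab) (hsmall a b hab)) (Int.fract t, 0)
      ⟨hfr t, by norm_num⟩).1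
    have e1 : deriv γ (Int.fract t) = deriv γ t := by
      have := h.curve.periodic_deriv.sub_zsmul_eq ⌊t⌋ (x := t)
      rwa [zsmul_eq_mul, mul_one] at this
    have e2 : deriv β (Int.fract t) = deriv β t := by
      have := (periodic_deriv (h.smooth.differentiable (by simp)) h.periodic).sub_zsmul_eq ⌊t⌋ (x := t)
      rwa [zsmul_eq_mul, mul_one] at this
    have e3 : deriv (binormal γ β) (Int.fract t) = deriv (binormal γ β) t := by
      have := (periodic_deriv (h.contDiff_binormal.differentiable (by simp))
        h.periodic_binormal).sub_zsmul_eq ⌊t⌋ (x := t)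
      rwa [zsmul_eq_mul, mul_one] at this
    simp only [J, e1, e2, e3] at h1
    exact h.fderiv_tubeMap_injective (q := (t, a, b)) h1
  · set n := round (t' - t)
    set d := t' - t - n
    have hd : |d| ≤ 1 / 2 := abs_sub_round _
    have h1 := (@hball ((a, b), (a', b')) (max_lt (hsmall a b hab) (hsmall a' b' hab'))
      (Int.fract t, d) ⟨hfr t, abs_le.mp hd⟩).2 (by
        show tubeMap γ β (Int.fract t, a, b) = tubeMap γ β (Int.fract t + d, a', b')
        rw [hper, heq, ← h.tubeMap_add_int (Int.fract t + d) a' b' (⌊t⌋ + n)]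
        congr 2
        simp only [d, Int.fract]; push_cast; ring)
    refine ⟨⟨n, ?_⟩, congrArg Prod.fst h1.2, congrArg Prod.snd h1.2⟩
    have : t' - t - n = 0 := h1.1
    linarith

/-- The open tube of radius `r`. -/
def tube (γ β : ℝ → E3) (r : ℝ) : Set E3 :=
  {x | ∃ t a b, a ^ 2 + b ^ 2 < r ^ 2 ∧ tubeMap γ β (t, a, b) = x}

namespace IsTubeRadius

variable {γ β : ℝ → E3} {r : ℝ} (hr : IsTubeRadius γ β r) (h : IsFramed γ β)
include hr h

/-- Functions of the tubular coordinates that vanish near the boundary of the tube extend by zero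
to smooth functions on 3-space. -/
theorem transfer {V : Type*} [NormedAddCommGroup V] [NormedSpace ℝ V] {G : ℝ × ℝ × ℝ → V}
    (hG : ContDiff ℝ ∞ G) (hper : ∀ t a b, G (t + 1, a, b) = G (t, a, b)) {ρ : ℝ} (hρ : ρ < r)
    (hρ0 : 0 ≤ ρ) (hzero : ∀ t a b, ρ ^ 2 ≤ a ^ 2 + b ^ 2 → G (t, a, b) = 0) :
    ∃ F : E3 → V, ContDiff ℝ ∞ F ∧ HasCompactSupport F ∧
      (∀ t a b, a ^ 2 + b ^ 2 < r ^ 2 → F (tubeMap γ β (t, a, b)) = G (t, a, b)) ∧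
      ∀ x ∉ tube γ β r, F x = 0 := by
  classical
  have hperZ : ∀ t a b (n : ℤ), G (t + n, a, b) = G (t, a, b) := fun t a b n => by
    have := (show Function.Periodic (fun t => G (t, a, b)) 1 from fun t => hper t a b).int_mul n t
    simpa using this
  -- The chosen tubular coordinates are unique up to an integer shift of the parameter, which does
  -- not affect `G`.
  let F : E3 → V := fun x => if hx : ∃ q : ℝ × ℝ × ℝ, q.2.1 ^ 2 + q.2.2 ^ 2 < r ^ 2 ∧
    tubeMap γ β q = x then G hx.choose else 0
  have hFG : ∀ t a b, a ^ 2 + b ^ 2 < r ^ 2 → F (tubeMap γ β (t, a, b)) = G (t, a, b) := by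
    intro t a b hab
    have hx : ∃ q : ℝ × ℝ × ℝ, q.2.1 ^ 2 + q.2.2 ^ 2 < r ^ 2 ∧
      tubeMap γ β q = tubeMap γ β (t, a, b) := ⟨(t, a, b), hab, rfl⟩
    simp only [F, dif_pos hx]
    obtain ⟨h1, h2⟩ := hx.choose_spec
    generalize hx.choose = q at h1 h2 ⊢
    obtain ⟨⟨n, hn⟩, h3, h4⟩ := hr.inj _ _ _ _ _ _ h1 hab h2
    rw [hn, h3, h4, hperZ]
  have hF0 : ∀ x ∉ tube γ β r, F x = 0 := by
    intro x hx
    refine dif_neg fun ⟨q, h1, h2⟩ => hx ⟨q.1, q.2.1, q.2.2, h1, h2⟩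
  let D : Set (ℝ × ℝ × ℝ) := Set.Icc (0 : ℝ) 1 ×ˢ {y : ℝ × ℝ | y.1 ^ 2 + y.2 ^ 2 ≤ ρ ^ 2}
  have hD : IsCompact D := by
    refine isCompact_Icc.prod (Metric.isCompact_of_isClosed_isBounded
      (isClosed_le (by fun_prop) continuous_const) ?_)
    refine (Metric.isBounded_closedBall (x := (0 : ℝ × ℝ)) (r := ρ)).subset fun y hy => ?_
    rw [Metric.mem_closedBall, dist_zero_right]
    have hy' : y.1 ^ 2 + y.2 ^ 2 ≤ ρ ^ 2 := hy
    refine max_le (abs_le_of_sq_le_sq (by nlinarith [sq_nonneg y.2]) hρ0)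
      (abs_le_of_sq_le_sq (by nlinarith [sq_nonneg y.1]) hρ0)
  have hK : IsCompact (tubeMap γ β '' D) := hD.image h.contDiff_tubeMap.continuous
  have hFK : ∀ x ∉ tubeMap γ β '' D, F x = 0 := by
    intro x hx
    by_cases hxt : x ∈ tube γ β r
    · obtain ⟨t, a, b, hab, rfl⟩ := hxt
      rw [hFG t a b hab]
      apply hzero
      by_contra! hlt
      refine hx ⟨(Int.fract t, a, b), ⟨⟨Int.fract_nonneg t, (Int.fract_lt_one t).le⟩, hlt.le⟩, ?_⟩
      rw [← h.tubeMap_add_int (Int.fract t) a b ⌊t⌋, Int.fract_add_floor]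
    · exact hF0 x hxt
  refine ⟨F, ?_, HasCompactSupport.intro hK hFK, hFG, hF0⟩
  rw [contDiff_iff_contDiffAt]
  intro x
  by_cases hxt : x ∈ tube γ β r
  · obtain ⟨t, a, b, hab, rfl⟩ := hxt
    obtain ⟨e, he, hes, hinv⟩ := exists_smooth_local_inverse (by simp [Module.finrank_prod])
      h.contDiff_tubeMap.contDiffAt (hr.local_inverse t a b hab)
    have hx : e.symm (tubeMap γ β (t, a, b)) = (t, a, b) := by
      have := e.left_inv hes; rwa [he] at this
    have hxt : tubeMap γ β (t, a, b) ∈ e.target := by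
      have := e.map_source hes; rwa [he] at this
    have hopen : IsOpen {q : ℝ × ℝ × ℝ | q.2.1 ^ 2 + q.2.2 ^ 2 < r ^ 2} :=
      isOpen_lt (by fun_prop) continuous_const
    have hcont : Tendsto e.symm (𝓝 (tubeMap γ β (t, a, b))) (𝓝 (t, a, b)) := by
      have := hinv.continuousAt; rwa [ContinuousAt, hx] at this
    have heq : F =ᶠ[𝓝 (tubeMap γ β (t, a, b))] fun y => G (e.symm y) := by
      filter_upwards [hcont.eventually (hopen.mem_nhds hab), e.open_target.mem_nhds hxt] with y h1 h2
      have h3 := e.right_inv h2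
      rw [he] at h3
      conv_lhs => rw [← h3]
      exact hFG _ _ _ h1
    exact (hG.contDiffAt.comp _ hinv).congr_of_eventuallyEq heq
  · have hxK : x ∉ tubeMap γ β '' D := by
      rintro ⟨q, hq, rfl⟩
      refine hxt ⟨q.1, q.2.1, q.2.2, lt_of_le_of_lt hq.2 ?_, rfl⟩
      exact pow_lt_pow_left₀ hρ hρ0 two_ne_zero
    have heq : F =ᶠ[𝓝 x] fun _ => 0 := by
      filter_upwards [hK.isClosed.isOpen_compl.mem_nhds hxK] with y hy using hFK y hy
    exact contDiffAt_const.congr_of_eventuallyEq heq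

/-- In tubular coordinates the right side has nonzero normal coordinates and `γ` has zero ones. This
keeps every push-off shorter than `r` disjoint from `γ`. -/
theorem ne_add_normal {s t : ℝ} {v : E3} (hv : inner ℝ v (deriv γ t) = 0) (hv0 : v ≠ 0)
    (hvr : ‖v‖ < r) : γ s ≠ γ t + v := by
  intro heq
  have h1 := h.expand_normal hv
  set a := inner ℝ (β t) v
  set b := inner ℝ (binormal γ β t) v
  have hab : a ^ 2 + b ^ 2 < r ^ 2 := by
    rw [← h.norm_sq_combination t, ← h1]
    exact pow_lt_pow_left₀ hvr (norm_nonneg v) two_ne_zero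
  have h2 : tubeMap γ β (s, 0, 0) = tubeMap γ β (t, a, b) := by
    simp only [tubeMap, zero_smul, add_zero, add_assoc]
    rw [← h1, heq]
  obtain ⟨-, ha, hb⟩ := hr.inj _ _ _ _ _ _ (by simpa using pow_pos hr.pos 2) hab h2
  rw [ha, hb, zero_smul, zero_smul, add_zero] at h1
  exact hv0 h1

end IsTubeRadius

/-! ### The Gauss integral and homotopies -/

theorem intervalIntegral_swap {f : ℝ → ℝ → ℝ} (hf : Continuous f.uncurry) {a b c d : ℝ}
    (hab : a ≤ b) (hcd : c ≤ d) :
    ∫ x in a..b, ∫ y in c..d, f x y = ∫ y in c..d, ∫ x in a..b, f x y := by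
  simp only [intervalIntegral.integral_of_le hab, intervalIntegral.integral_of_le hcd]
  apply MeasureTheory.integral_integral_swap
  rw [MeasureTheory.Measure.prod_restrict]
  exact ((hf.continuousOn (s := Set.Icc a b ×ˢ Set.Icc c d)).integrableOn_compact
    (isCompact_Icc.prod isCompact_Icc)).mono_set
    (Set.prod_mono Set.Ioc_subset_Icc_self Set.Ioc_subset_Icc_self)

theorem hasDerivAt_det3 {u v w : ℝ → E3} {u' v' w' : E3} {x : ℝ} (hu : HasDerivAt u u' x)
    (hv : HasDerivAt v v' x) (hw : HasDerivAt w w' x) :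
    HasDerivAt (fun x => det3 (u x) (v x) (w x))
      (det3 u' (v x) (w x) + det3 (u x) v' (w x) + det3 (u x) (v x) w') x := by
  simp only [det3_eq_coords]
  have u0 := hasDerivAt_coord hu 0
  have u1 := hasDerivAt_coord hu 1
  have u2 := hasDerivAt_coord hu 2
  have v0 := hasDerivAt_coord hv 0
  have v1 := hasDerivAt_coord hv 1
  have v2 := hasDerivAt_coord hv 2
  have w0 := hasDerivAt_coord hw 0
  have w1 := hasDerivAt_coord hw 1
  have w2 := hasDerivAt_coord hw 2
  have h := ((u0.mul ((v1.mul w2).sub (v2.mul w1))).sub (u1.mul ((v0.mul w2).sub (v2.mul w0)))).add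
    (u2.mul ((v0.mul w1).sub (v1.mul w0)))
  convert! h using 1
  simp only [Pi.mul_apply, Pi.sub_apply]
  ring

/-- The solid angle form of 3-space. -/
def gaussForm (u v w : E3) : ℝ := det3 u v w / ‖w‖ ^ 3

/-- The derivative of the solid angle form along a curve. -/
def gaussFormDeriv (u v w u' v' w' : E3) : ℝ :=
  (det3 u' v w + det3 u v' w + det3 u v w') / ‖w‖ ^ 3 -
    3 * det3 u v w * inner ℝ w w' / ‖w‖ ^ 5

theorem hasDerivAt_gaussForm {u v w : ℝ → E3} {u' v' w' : E3} {x : ℝ} (hu : HasDerivAt u u' x)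
    (hv : HasDerivAt v v' x) (hw : HasDerivAt w w' x) (h0 : w x ≠ 0) :
    HasDerivAt (fun x => gaussForm (u x) (v x) (w x))
      (gaussFormDeriv (u x) (v x) (w x) u' v' w') x := by
  have hn : ‖w x‖ ≠ 0 := norm_ne_zero_iff.mpr h0
  have h1 : HasDerivAt (fun x => ‖w x‖) (inner ℝ (w x) w' / ‖w x‖) x := by
    have h2 := hw.norm_sq.sqrt (pow_ne_zero 2 hn)
    simp only [Real.sqrt_sq (norm_nonneg _)] at h2
    convert! h2 using 1
    field_simp
  have h3 := (hasDerivAt_det3 hu hv hw).div (h1.pow 3) (pow_ne_zero 3 hn)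
  unfold gaussForm
  convert! h3 using 1
  unfold gaussFormDeriv
  have h4 : ((fun x => ‖w x‖) ^ 3) x = ‖w x‖ ^ 3 := rfl
  rw [h4]
  simp only [Nat.cast_ofNat]
  field_simp
  ring

theorem continuous_det3 {X : Type*} [TopologicalSpace X] {u v w : X → E3} (hu : Continuous u)
    (hv : Continuous v) (hw : Continuous w) : Continuous fun x => det3 (u x) (v x) (w x) := by
  simp only [det3_eq_coords]
  fun_prop

theorem continuous_gaussForm {X : Type*} [TopologicalSpace X] {u v w : X → E3} (hu : Continuous u)
    (hv : Continuous v) (hw : Continuous w) (h0 : ∀ x, w x ≠ 0) :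
    Continuous fun x => gaussForm (u x) (v x) (w x) :=
  (continuous_det3 hu hv hw).div (hw.norm.pow 3) fun x => pow_ne_zero 3 (norm_ne_zero_iff.mpr (h0 x))

theorem continuous_gaussFormDeriv {X : Type*} [TopologicalSpace X] {u v w u' v' w' : X → E3}
    (hu : Continuous u) (hv : Continuous v) (hw : Continuous w) (hu' : Continuous u')
    (hv' : Continuous v') (hw' : Continuous w') (h0 : ∀ x, w x ≠ 0) :
    Continuous fun x => gaussFormDeriv (u x) (v x) (w x) (u' x) (v' x) (w' x) := by
  have hn : ∀ x, ‖w x‖ ≠ 0 := fun x => norm_ne_zero_iff.mpr (h0 x)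
  refine Continuous.sub (Continuous.div (((continuous_det3 hu' hv hw).add
    (continuous_det3 hu hv' hw)).add (continuous_det3 hu hv hw')) (hw.norm.pow 3)
    fun x => pow_ne_zero 3 (hn x)) (Continuous.div ((continuous_const.mul
    (continuous_det3 hu hv hw)).mul (hw.inner hw')) (hw.norm.pow 5) fun x => pow_ne_zero 5 (hn x))

/-- The solid angle form is closed. -/
theorem gaussForm_closed (a p q m d : E3) (hd : d ≠ 0) :
    gaussFormDeriv a p d 0 m (-q) = gaussFormDeriv a q d 0 m (-p) + gaussFormDeriv p q d 0 0 a := by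
  have hn : ‖d‖ ≠ 0 := norm_ne_zero_iff.mpr hd
  have h2 := norm_sq_eq_coords d
  unfold gaussFormDeriv
  -- The identity after multiplication by `‖d‖ ^ 5`: a polynomial form of the fact that `d / ‖d‖ ^
  -- 3` is divergence free.
  have key : det3 a p (-q) * ‖d‖ ^ 2 - 3 * det3 a p d * inner ℝ d (-q) =
      det3 a q (-p) * ‖d‖ ^ 2 - 3 * det3 a q d * inner ℝ d (-p) +
      (det3 p q a * ‖d‖ ^ 2 - 3 * det3 p q d * inner ℝ d a) := by
    rw [h2]
    simp only [det3_eq_coords, inner_eq_coords, PiLp.neg_apply]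
    ring
  have z : ∀ v w : E3, det3 0 v w = 0 := fun v w => by simp [det3_eq_coords]
  have z' : det3 p 0 d = 0 := by simp [det3_eq_coords]
  simp only [z, z']
  field_simp
  linear_combination key

section Box

variable {γ a : ℝ → E3} {η p q m : ℝ → ℝ → E3}

/-- Stokes' theorem on the cube of parameters `(s, t, l)`. The faces in the `s` direction cancel
because `γ` is closed. Periodicity of `η l` is not assumed, so the faces `t = 0` and `t = 1`
survive; they measure the winding in `winding_eq_zero`. -/
theorem gauss_integral_sub (hγ : ∀ s, HasDerivAt γ (a s) s) (ha : Continuous a)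
    (hp : ∀ l t, HasDerivAt (fun t => η l t) (p l t) t)
    (hq : ∀ l t, HasDerivAt (fun l => η l t) (q l t) l)
    (hpm : ∀ l t, HasDerivAt (fun l => p l t) (m l t) l)
    (hqm : ∀ l t, HasDerivAt (fun t => q l t) (m l t) t)
    (cη : Continuous η.uncurry) (cp : Continuous p.uncurry) (cq : Continuous q.uncurry)
    (cm : Continuous m.uncurry) (hclosed : γ 1 = γ 0) (hne : ∀ s l t, γ s ≠ η l t) :
    (∫ s in (0 : ℝ)..1, ∫ t in (0 : ℝ)..1, gaussForm (a s) (p 1 t) (γ s - η 1 t)) -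
      (∫ s in (0 : ℝ)..1, ∫ t in (0 : ℝ)..1, gaussForm (a s) (p 0 t) (γ s - η 0 t)) =
    ∫ s in (0 : ℝ)..1, ∫ l in (0 : ℝ)..1,
      (gaussForm (a s) (q l 1) (γ s - η l 1) - gaussForm (a s) (q l 0) (γ s - η l 0)) := by
  have hd0 : ∀ s l t, γ s - η l t ≠ 0 := fun s l t => sub_ne_zero.mpr (hne s l t)
  have cγ : Continuous γ := continuous_iff_continuousAt.mpr fun s => (hγ s).continuousAt
  let G' : ℝ → ℝ → ℝ → ℝ := fun s t l =>
    gaussFormDeriv (a s) (p l t) (γ s - η l t) 0 (m l t) (-(q l t))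
  let A' : ℝ → ℝ → ℝ → ℝ := fun s t l =>
    gaussFormDeriv (a s) (q l t) (γ s - η l t) 0 (m l t) (-(p l t))
  let B' : ℝ → ℝ → ℝ → ℝ := fun s t l =>
    gaussFormDeriv (p l t) (q l t) (γ s - η l t) 0 0 (a s)
  have e1 : ∀ f : ℝ → ℝ → E3, Continuous f.uncurry →
      Continuous fun x : ℝ × ℝ × ℝ => f x.2.2 x.2.1 := fun f hf =>
    hf.comp (f := fun x : ℝ × ℝ × ℝ => (x.2.2, x.2.1)) (by fun_prop)
  have cd : Continuous fun x : ℝ × ℝ × ℝ => γ x.1 - η x.2.2 x.2.1 :=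
    (cγ.comp continuous_fst).sub (e1 η cη)
  have ca : Continuous fun x : ℝ × ℝ × ℝ => a x.1 := ha.comp continuous_fst
  have cA : Continuous fun x : ℝ × ℝ × ℝ => A' x.1 x.2.1 x.2.2 :=
    continuous_gaussFormDeriv ca (e1 q cq) cd continuous_const (e1 m cm) (e1 p cp).neg
      fun x => hd0 _ _ _
  have cB : Continuous fun x : ℝ × ℝ × ℝ => B' x.1 x.2.1 x.2.2 :=
    continuous_gaussFormDeriv (e1 p cp) (e1 q cq) cd continuous_const continuous_const ca
      fun x => hd0 _ _ _
  have cA' : ∀ s, Continuous fun x : ℝ × ℝ => A' s x.1 x.2 := fun s =>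
    cA.comp (f := fun x : ℝ × ℝ => (s, x.1, x.2)) (by fun_prop)
  have cB' : ∀ s, Continuous fun x : ℝ × ℝ => B' s x.1 x.2 := fun s =>
    cB.comp (f := fun x : ℝ × ℝ => (s, x.1, x.2)) (by fun_prop)
  have cG : ∀ l, Continuous fun x : ℝ × ℝ => gaussForm (a x.1) (p l x.2) (γ x.1 - η l x.2) :=
    fun l => by
    have f1 : Continuous fun x : ℝ × ℝ => p l x.2 :=
      cp.comp (f := fun x : ℝ × ℝ => (l, x.2)) (by fun_prop)
    have f2 : Continuous fun x : ℝ × ℝ => η l x.2 :=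
      cη.comp (f := fun x : ℝ × ℝ => (l, x.2)) (by fun_prop)
    exact continuous_gaussForm (ha.comp continuous_fst) f1 ((cγ.comp continuous_fst).sub f2)
      fun x => hd0 _ _ _
  have dl : ∀ s t l, HasDerivAt (fun l => gaussForm (a s) (p l t) (γ s - η l t)) (G' s t l) l :=
    fun s t l => hasDerivAt_gaussForm (hasDerivAt_const l (a s)) (hpm l t)
      ((hq l t).const_sub (γ s)) (hd0 s l t)
  have dt : ∀ s t l, HasDerivAt (fun t => gaussForm (a s) (q l t) (γ s - η l t)) (A' s t l) t :=
    fun s t l => hasDerivAt_gaussForm (hasDerivAt_const t (a s)) (hqm l t)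
      ((hp l t).const_sub (γ s)) (hd0 s l t)
  have ds : ∀ s t l, HasDerivAt (fun s => gaussForm (p l t) (q l t) (γ s - η l t)) (B' s t l) s :=
    fun s t l => hasDerivAt_gaussForm (hasDerivAt_const s (p l t)) (hasDerivAt_const s (q l t))
      ((hγ s).sub_const (η l t)) (hd0 s l t)
  have hGAB : ∀ s t l, G' s t l = A' s t l + B' s t l := fun s t l =>
    gaussForm_closed _ _ _ _ _ (hd0 s l t)
  have iA : ∀ s t, IntervalIntegrable (fun l => A' s t l) MeasureTheory.volume 0 1 := fun s t =>
    ((cA' s).comp (f := fun l => (t, l)) (by fun_prop)).intervalIntegrable _ _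
  have iB : ∀ s t, IntervalIntegrable (fun l => B' s t l) MeasureTheory.volume 0 1 := fun s t =>
    ((cB' s).comp (f := fun l => (t, l)) (by fun_prop)).intervalIntegrable _ _
  have hG : ∀ s t, gaussForm (a s) (p 1 t) (γ s - η 1 t) - gaussForm (a s) (p 0 t) (γ s - η 0 t) =
      (∫ l in (0 : ℝ)..1, A' s t l) + ∫ l in (0 : ℝ)..1, B' s t l := fun s t => by
    rw [← intervalIntegral.integral_add (iA s t) (iB s t)]
    rw [show (fun l => A' s t l + B' s t l) = G' s t from funext fun l => (hGAB s t l).symm]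
    refine (intervalIntegral.integral_eq_sub_of_hasDerivAt (fun l _ => dl s t l) ?_).symm
    rw [show G' s t = fun l => A' s t l + B' s t l from funext fun l => hGAB s t l]
    exact (iA s t).add (iB s t)
  have cIA : Continuous fun x : ℝ × ℝ => ∫ l in (0 : ℝ)..1, A' x.1 x.2 l := by
    apply intervalIntegral.continuous_parametric_intervalIntegral_of_continuous'
    exact cA.comp (f := fun x : (ℝ × ℝ) × ℝ => (x.1.1, x.1.2, x.2)) (by fun_prop)
  have cIB : Continuous fun x : ℝ × ℝ => ∫ l in (0 : ℝ)..1, B' x.1 x.2 l := by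
    apply intervalIntegral.continuous_parametric_intervalIntegral_of_continuous'
    exact cB.comp (f := fun x : (ℝ × ℝ) × ℝ => (x.1.1, x.1.2, x.2)) (by fun_prop)
  have cont2 : ∀ {f : ℝ × ℝ → ℝ}, Continuous f → ∀ s, Continuous fun t => f (s, t) :=
    fun hf s => hf.comp (by fun_prop)
  have ii2 : ∀ {f : ℝ × ℝ → ℝ}, Continuous f →
      IntervalIntegrable (fun s => ∫ t in (0 : ℝ)..1, f (s, t)) MeasureTheory.volume 0 1 :=
    fun {f} hf => (intervalIntegral.continuous_parametric_intervalIntegral_of_continuous'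
      (f := fun s t => f (s, t)) hf 0 1).intervalIntegrable _ _
  rw [← intervalIntegral.integral_sub (ii2 (cG 1)) (ii2 (cG 0))]
  have step1 : ∀ s, (∫ t in (0 : ℝ)..1, gaussForm (a s) (p 1 t) (γ s - η 1 t)) -
      (∫ t in (0 : ℝ)..1, gaussForm (a s) (p 0 t) (γ s - η 0 t)) =
      (∫ t in (0 : ℝ)..1, ∫ l in (0 : ℝ)..1, A' s t l) +
        ∫ t in (0 : ℝ)..1, ∫ l in (0 : ℝ)..1, B' s t l := fun s => by
    rw [← intervalIntegral.integral_sub ((cont2 (cG 1) s).intervalIntegrable _ _)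
      ((cont2 (cG 0) s).intervalIntegrable _ _), ← intervalIntegral.integral_add
      ((cont2 cIA s).intervalIntegrable _ _) ((cont2 cIB s).intervalIntegrable _ _)]
    exact intervalIntegral.integral_congr fun t _ => hG s t
  simp only [step1]
  rw [intervalIntegral.integral_add (ii2 cIA) (ii2 cIB)]
  have hB : ∫ s in (0 : ℝ)..1, ∫ t in (0 : ℝ)..1, ∫ l in (0 : ℝ)..1, B' s t l = 0 := by
    rw [intervalIntegral_swap (f := fun s t => ∫ l in (0 : ℝ)..1, B' s t l) cIB zero_le_one
      zero_le_one]
    have : ∀ t, ∫ s in (0 : ℝ)..1, ∫ l in (0 : ℝ)..1, B' s t l = 0 := fun t => by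
      rw [intervalIntegral_swap (f := fun s l => B' s t l)
        (cB.comp (f := fun x : ℝ × ℝ => (x.1, t, x.2)) (by fun_prop)) zero_le_one zero_le_one]
      have : ∀ l, ∫ s in (0 : ℝ)..1, B' s t l = 0 := fun l => by
        rw [intervalIntegral.integral_eq_sub_of_hasDerivAt (fun s _ => ds s t l)
          ((cB.comp (f := fun s => (s, t, l)) (by fun_prop)).intervalIntegrable _ _), hclosed,
          sub_self]
      simp [this]
    simp [this]
  rw [hB, add_zero]
  refine intervalIntegral.integral_congr fun s _ => ?_
  show ∫ t in (0 : ℝ)..1, ∫ l in (0 : ℝ)..1, A' s t l = _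
  rw [intervalIntegral_swap (f := fun t l => A' s t l) (cA' s) zero_le_one zero_le_one]
  refine intervalIntegral.integral_congr fun l _ => ?_
  exact intervalIntegral.integral_eq_sub_of_hasDerivAt (fun t _ => dt s t l)
    (((cA' s).comp (f := fun t => (t, l)) (by fun_prop)).intervalIntegrable _ _)

end Box

theorem linkingNumber_eq {γ η : ℝ → E3} : linkingNumber γ η = (4 * Real.pi)⁻¹ *
    ∫ s in (0 : ℝ)..1, ∫ t in (0 : ℝ)..1, gaussForm (deriv γ s) (deriv η t) (γ s - η t) := rfl

/-- The partial derivatives of a smooth two-parameter family. -/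
theorem exists_partial_derivatives {η : ℝ → ℝ → E3} (hη : ContDiff ℝ ∞ η.uncurry) :
    ∃ p q m : ℝ → ℝ → E3, (∀ l t, HasDerivAt (fun t => η l t) (p l t) t) ∧
      (∀ l t, HasDerivAt (fun l => η l t) (q l t) l) ∧
      (∀ l t, HasDerivAt (fun l => p l t) (m l t) l) ∧
      (∀ l t, HasDerivAt (fun t => q l t) (m l t) t) ∧
      Continuous p.uncurry ∧ Continuous q.uncurry ∧ Continuous m.uncurry := by
  let D := fderiv ℝ η.uncurry
  have hD : ContDiff ℝ ∞ D := hη.fderiv_right (by simp)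
  let D2 := fderiv ℝ D
  have hD2 : ContDiff ℝ ∞ D2 := hD.fderiv_right (by simp)
  have ht : ∀ l t : ℝ, HasDerivAt (fun t => (l, t)) ((0 : ℝ), (1 : ℝ)) t := fun l t =>
    (hasDerivAt_const t l).prodMk (hasDerivAt_id t)
  have hl : ∀ l t : ℝ, HasDerivAt (fun l => (l, t)) ((1 : ℝ), (0 : ℝ)) l := fun l t =>
    (hasDerivAt_id l).prodMk (hasDerivAt_const l t)
  have d1 : ∀ x, HasFDerivAt η.uncurry (D x) x := fun x =>
    (hη.differentiable (by simp) x).hasFDerivAt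
  have d2 : ∀ x, HasFDerivAt D (D2 x) x := fun x => (hD.differentiable (by simp) x).hasFDerivAt
  have hsymm : ∀ x v w, D2 x v w = D2 x w v := fun x v w =>
    (hη.contDiffAt (x := x)).isSymmSndFDerivAt
      (by rw [minSmoothness_of_isRCLikeNormedField]; exact WithTop.coe_le_coe.mpr le_top) v w
  have hev : ∀ (x v w : ℝ × ℝ) (c : ℝ → ℝ × ℝ) (τ : ℝ), HasDerivAt c w τ →
      HasDerivAt (fun τ => D (c τ) v) (D2 (c τ) w v) τ := fun x v w c τ hc =>
    ((ContinuousLinearMap.apply ℝ E3 v).hasFDerivAt.comp_hasDerivAt τ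
      ((d2 (c τ)).comp_hasDerivAt τ hc))
  -- A single `m` serves as both mixed derivatives, by symmetry of the second derivative.
  refine ⟨fun l t => D (l, t) (0, 1), fun l t => D (l, t) (1, 0), fun l t => D2 (l, t) (1, 0) (0, 1),
    fun l t => (d1 (l, t)).comp_hasDerivAt t (ht l t), fun l t => HasFDerivAt.comp_hasDerivAt (l := η.uncurry) l (d1 (l, t)) (hl l t),
    fun l t => hev (l, t) _ _ _ l (hl l t), fun l t => ?_, ?_, ?_, ?_⟩
  · show HasDerivAt (fun t => D (l, t) (1, 0)) (D2 (l, t) (1, 0) (0, 1)) t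
    rw [hsymm]; exact hev (l, t) _ _ _ t (ht l t)
  · exact hD.continuous.clm_apply continuous_const
  · exact hD.continuous.clm_apply continuous_const
  · exact (hD2.continuous.clm_apply continuous_const).clm_apply continuous_const

theorem linkingNumber_homotopy {γ : ℝ → E3} (hγ : IsSmoothClosedCurve γ) {η : ℝ → ℝ → E3}
    (hη : ContDiff ℝ ∞ η.uncurry) (hper : ∀ l, Function.Periodic (η l) 1)
    (hne : ∀ s l t, γ s ≠ η l t) : linkingNumber γ (η 1) = linkingNumber γ (η 0) := by
  obtain ⟨p, q, m, hp, hq, hpm, hqm, cp, cq, cm⟩ := exists_partial_derivatives hη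
  have h := gauss_integral_sub hγ.hasDerivAt hγ.contDiff_deriv.continuous hp hq hpm hqm
    hη.continuous cp cq cm (by simpa using hγ.periodic 0) hne
  have h1 : ∀ l, η l 1 = η l 0 := fun l => by simpa using hper l 0
  have h2 : ∀ l, q l 1 = q l 0 := fun l => by
    have := hq l 0
    simp only [← h1] at this
    exact (hq l 1).unique this
  simp only [h1, h2, sub_self, intervalIntegral.integral_zero] at h
  have h3 : ∀ l, deriv (η l) = p l := fun l => funext fun t => (hp l t).deriv
  rw [linkingNumber_eq, linkingNumber_eq, h3, h3, sub_eq_zero.mp h]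

/-! ### Push-offs along normal fields -/

section PushOff

variable {γ β : ℝ → E3} {r : ℝ}

theorem linkingNumber_pushOff_homotopy (h : IsFramed γ β) (hr : IsTubeRadius γ β r)
    {v : ℝ → ℝ → E3} (hv : ContDiff ℝ ∞ v.uncurry) (hper : ∀ l, Function.Periodic (v l) 1)
    (hnormal : ∀ l t, inner ℝ (v l t) (deriv γ t) = 0) (hv0 : ∀ l t, v l t ≠ 0)
    (hvr : ∀ l t, ‖v l t‖ < r) :
    linkingNumber γ (fun t => γ t + v 1 t) = linkingNumber γ (fun t => γ t + v 0 t) := by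
  refine linkingNumber_homotopy (η := fun l t => γ t + v l t) h.curve
    ((h.curve.smooth.comp contDiff_snd).add hv) (fun l t => ?_)
    (fun s l t => hr.ne_add_normal h (hnormal l t) (hv0 l t) (hvr l t))
  simp only [h.curve.periodic t, hper l t]

theorem pushOff_unit_homotopy (h : IsFramed γ β) (hr : IsTubeRadius γ β r)
    {v : ℝ → ℝ → E3} (hv : ContDiff ℝ ∞ v.uncurry) (hper : ∀ l, Function.Periodic (v l) 1)
    (hnormal : ∀ l t, inner ℝ (v l t) (deriv γ t) = 0) (hv1 : ∀ l t, ‖v l t‖ = 1) {ε : ℝ}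
    (hε : 0 < ε) (hεr : ε < r) :
    linkingNumber γ (fun t => γ t + ε • v 1 t) = linkingNumber γ (fun t => γ t + ε • v 0 t) := by
  refine linkingNumber_pushOff_homotopy (v := fun l t => ε • v l t) h hr (hv.const_smul ε)
    (fun l t => by simp only [hper l t]) (fun l t => by rw [inner_smul_left, hnormal, mul_zero])
    (fun l t h0 => ?_) (fun l t => by rwa [norm_smul, hv1, mul_one, Real.norm_of_nonneg hε.le])
  have := hv1 l t
  rw [(smul_eq_zero.mp h0).resolve_left hε.ne'] at this
  simp at this

theorem pushOff_scale (h : IsFramed γ β) (hr : IsTubeRadius γ β r) {v : ℝ → E3}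
    (hv : IsFramed γ v) {ε ε' : ℝ} (hε : 0 < ε) (hεr : ε < r) (hε' : 0 < ε') (hεr' : ε' < r) :
    linkingNumber γ (fun t => γ t + ε • v t) = linkingNumber γ (fun t => γ t + ε' • v t) := by
  -- A smooth parameter with values in `[0, 1]` for every real `l`, equal to `0` at `0` and `1` at
  -- `1`. The homotopy is required to be admissible for all `l`, so linear interpolation would not
  -- do.
  let σ : ℝ → ℝ := fun l => Real.sin (Real.pi / 2 * l) ^ 2
  have hσ0 : ∀ l, 0 ≤ σ l := fun l => sq_nonneg _
  have hσ1 : ∀ l, σ l ≤ 1 := fun l => Real.sin_sq_le_one _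
  let e : ℝ → ℝ := fun l => (1 - σ l) * ε' + σ l * ε
  have he0 : ∀ l, 0 < e l := fun l => by
    rcases (hσ0 l).eq_or_lt with h0 | h0
    · simp only [e, ← h0]; linarith
    · have := mul_pos h0 hε
      have := mul_nonneg (sub_nonneg.mpr (hσ1 l)) hε'.le
      simp only [e]; linarith
  have her : ∀ l, e l < r := fun l => by
    have h1 := mul_le_mul_of_nonneg_left (le_max_left ε ε') (hσ0 l)
    have h2 := mul_le_mul_of_nonneg_left (le_max_right ε ε') (sub_nonneg.mpr (hσ1 l))
    have h3 : max ε ε' < r := max_lt hεr hεr'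
    simp only [e]; nlinarith
  have hσc : ContDiff ℝ ∞ σ := (Real.contDiff_sin.comp (contDiff_const.mul contDiff_id)).pow 2
  have hec : ContDiff ℝ ∞ e :=
    ((contDiff_const.sub hσc).mul contDiff_const).add (hσc.mul contDiff_const)
  have := linkingNumber_pushOff_homotopy (v := fun l t => e l • v t) h hr
    ((hec.comp contDiff_fst).smul (hv.smooth.comp contDiff_snd))
    (fun l t => by simp only [hv.periodic t]) (fun l t => by rw [inner_smul_left, hv.normal, mul_zero])
    (fun l t h0 => by
      have h1 := hv.norm_eq_one t
      rw [(smul_eq_zero.mp h0).resolve_left (he0 l).ne'] at h1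
      simp at h1)
    (fun l t => by rw [norm_smul, hv.norm_eq_one, mul_one, Real.norm_of_nonneg (he0 l).le]; exact her l)
  simpa [e, σ] using this

/-- The linking number of `γ` with its small push-offs along a smooth unit normal field. -/
theorem IsFramed.exists_pushOffLinkingNumber (h : IsFramed γ β) :
    ∃ n, IsPushOffLinkingNumber γ β n := by
  obtain ⟨r, hr⟩ := h.exists_tubeRadius
  refine ⟨linkingNumber γ fun t => γ t + (r / 2) • β t, ?_⟩
  have := hr.pos
  filter_upwards [Ioo_mem_nhdsGT hr.pos] with ε hε
  exact pushOff_scale h hr h hε.1 hε.2 (by linarith) (by linarith)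

/-- The normal field that makes the angle `φ` with `β`. -/
def rotated (γ β : ℝ → E3) (φ : ℝ) (t : ℝ) : E3 :=
  Real.cos φ • β t + Real.sin φ • binormal γ β t

theorem IsFramed.norm_rotated (h : IsFramed γ β) (φ t : ℝ) : ‖rotated γ β φ t‖ = 1 := by
  have := h.norm_sq_combination t (Real.cos φ) (Real.sin φ)
  rw [Real.cos_sq_add_sin_sq] at this
  exact (pow_eq_one_iff_of_nonneg (norm_nonneg _) two_ne_zero).mp this

theorem IsFramed.rotated_normal (h : IsFramed γ β) (φ t : ℝ) :
    inner ℝ (rotated γ β φ t) (deriv γ t) = 0 := by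
  rw [rotated, inner_add_left, inner_smul_left, inner_smul_left, h.normal, h.binormal_normal]
  simp

theorem IsPushOffLinkingNumber.of_family {n : ℝ} (h : IsFramed γ β) {v : ℝ → ℝ → E3}
    (hv : ContDiff ℝ ∞ v.uncurry) (hper : ∀ l, Function.Periodic (v l) 1)
    (hnormal : ∀ l t, inner ℝ (v l t) (deriv γ t) = 0) (hv1 : ∀ l t, ‖v l t‖ = 1)
    (hn : IsPushOffLinkingNumber γ (v 0) n) : IsPushOffLinkingNumber γ (v 1) n := by
  obtain ⟨r, hr⟩ := h.exists_tubeRadius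
  filter_upwards [hn, Ioo_mem_nhdsGT hr.pos] with ε h1 hε
  rw [← h1]
  exact pushOff_unit_homotopy h hr hv hper hnormal hv1 hε.1 hε.2

/-- A half turn in the normal planes joins `β` to `-β` through unit normal fields. -/
theorem IsPushOffLinkingNumber.neg {n : ℝ} (h : IsFramed γ β) (hn : IsPushOffLinkingNumber γ β n) :
    IsPushOffLinkingNumber γ (fun t => -β t) n := by
  have hb := h.contDiff_binormal
  have hs := h.smooth
  have hcos := Real.contDiff_cos (n := ∞)
  have hsin := Real.contDiff_sin (n := ∞)
  have hv : ContDiff ℝ ∞ (Function.uncurry fun l t => rotated γ β (Real.pi * l) t) := by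
    unfold rotated Function.uncurry
    fun_prop
  have h1 := IsPushOffLinkingNumber.of_family (n := n) h hv
    (fun l t => by simp only [rotated, h.periodic t, h.periodic_binormal t])
    (fun l t => h.rotated_normal _ t) (fun l t => h.norm_rotated _ t)
    (by simpa [rotated] using hn)
  simpa [rotated] using h1

theorem IsPushOffLinkingNumber.unique {v : ℝ → E3} {m n : ℝ} (hm : IsPushOffLinkingNumber γ v m)
    (hn : IsPushOffLinkingNumber γ v n) : m = n := by
  obtain ⟨ε, h1, h2⟩ := (hm.and hn).exists
  rw [← h1, ← h2]

/-! ### The angle between two normal fields -/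

/-- The angle is a primitive of `w = x y' - y x'`. This form is periodic, so the increment of the
angle over a period is constant. -/
theorem exists_angle {x y : ℝ → ℝ} (hx : ContDiff ℝ ∞ x) (hy : ContDiff ℝ ∞ y)
    (hxp : Function.Periodic x 1) (hyp : Function.Periodic y 1) (h1 : ∀ t, x t ^ 2 + y t ^ 2 = 1) :
    ∃ θ : ℝ → ℝ, ContDiff ℝ ∞ θ ∧ (∀ t, x t = Real.cos (θ t)) ∧ (∀ t, y t = Real.sin (θ t)) ∧
      ∀ t, θ (t + 1) - θ t = θ 1 - θ 0 := by
  have hx' := (contDiff_infty_iff_deriv.mp hx).2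
  have hy' := (contDiff_infty_iff_deriv.mp hy).2
  have dx : ∀ t, HasDerivAt x (deriv x t) t := fun t => (hx.differentiable (by simp) t).hasDerivAt
  have dy : ∀ t, HasDerivAt y (deriv y t) t := fun t => (hy.differentiable (by simp) t).hasDerivAt
  let w : ℝ → ℝ := fun t => x t * deriv y t - y t * deriv x t
  have hw : ContDiff ℝ ∞ w := (hx.mul hy').sub (hy.mul hx')
  obtain ⟨θ₀, hc0, hs0⟩ : ∃ θ₀, Real.cos θ₀ = x 0 ∧ Real.sin θ₀ = y 0 := by
    have hz : ‖(⟨x 0, y 0⟩ : ℂ)‖ = 1 := by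
      rw [Complex.norm_def, Complex.normSq_mk, ← sq, ← sq, h1, Real.sqrt_one]
    have hz0 : (⟨x 0, y 0⟩ : ℂ) ≠ 0 := by rw [← norm_ne_zero_iff, hz]; norm_num
    refine ⟨Complex.arg ⟨x 0, y 0⟩, ?_, ?_⟩
    · rw [Complex.cos_arg hz0, hz]; simp
    · rw [Complex.sin_arg, hz]; simp
  let θ : ℝ → ℝ := fun t => θ₀ + ∫ s in (0 : ℝ)..t, w s
  have dθ : ∀ t, HasDerivAt θ (w t) t := fun t =>
    (intervalIntegral.integral_hasDerivAt_right (hw.continuous.intervalIntegrable _ _)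
      (hw.continuous.stronglyMeasurableAtFilter _ _) hw.continuous.continuousAt).const_add θ₀
  have hθ' : deriv θ = w := funext fun t => (dθ t).deriv
  have hθ : ContDiff ℝ ∞ θ := contDiff_infty_iff_deriv.mpr
    ⟨fun t => (dθ t).differentiableAt, by rw [hθ']; exact hw⟩
  have hrel : ∀ t, x t * deriv x t + y t * deriv y t = 0 := fun t => by
    have h2 : HasDerivAt (fun t => x t ^ 2 + y t ^ 2) (2 * x t * deriv x t + 2 * y t * deriv y t) t := by
      convert! ((dx t).pow 2).add ((dy t).pow 2) using 1
      simp
    have h3 : HasDerivAt (fun t => x t ^ 2 + y t ^ 2) 0 t := by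
      simp only [h1]; exact hasDerivAt_const t 1
    linarith [h2.unique h3]
  have ex : ∀ t, deriv x t = -(y t * w t) := fun t => by
    simp only [w]
    linear_combination (-deriv x t) * h1 t + x t * hrel t
  have ey : ∀ t, deriv y t = x t * w t := fun t => by
    simp only [w]
    linear_combination (-deriv y t) * h1 t + y t * hrel t
  have hc : ∀ t, HasDerivAt (fun t => Real.cos (θ t)) (-Real.sin (θ t) * w t) t := fun t => (dθ t).cos
  have hs : ∀ t, HasDerivAt (fun t => Real.sin (θ t)) (Real.cos (θ t) * w t) t := fun t => (dθ t).sin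
  have hθ0 : θ 0 = θ₀ := by simp [θ]
  -- This and `f2` say that the angle between `(x, y)` and `(cos θ, sin θ)` has cosine `1` and sine
  -- `0`.
  have f1 : ∀ t, x t * Real.cos (θ t) + y t * Real.sin (θ t) = 1 := by
    have hd : ∀ t, HasDerivAt (fun t => x t * Real.cos (θ t) + y t * Real.sin (θ t)) 0 t := fun t => by
      have := ((dx t).mul (hc t)).add ((dy t).mul (hs t))
      convert! this using 1
      rw [ex, ey]; ring
    intro t
    have := is_const_of_deriv_eq_zero (fun t => (hd t).differentiableAt) (fun t => (hd t).deriv) t 0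
    rw [this, hθ0, hc0, hs0, ← h1 0]; ring
  have f2 : ∀ t, y t * Real.cos (θ t) - x t * Real.sin (θ t) = 0 := by
    have hd : ∀ t, HasDerivAt (fun t => y t * Real.cos (θ t) - x t * Real.sin (θ t)) 0 t := fun t => by
      have := ((dy t).mul (hc t)).sub ((dx t).mul (hs t))
      convert! this using 1
      rw [ex, ey]; ring
    intro t
    have := is_const_of_deriv_eq_zero (fun t => (hd t).differentiableAt) (fun t => (hd t).deriv) t 0
    rw [this, hθ0, hc0, hs0]; ring
  refine ⟨θ, hθ, fun t => ?_, fun t => ?_, fun t => ?_⟩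
  · have := Real.sin_sq_add_cos_sq (θ t)
    linear_combination (-x t) * this + Real.cos (θ t) * f1 t - Real.sin (θ t) * f2 t
  · have := Real.sin_sq_add_cos_sq (θ t)
    linear_combination (-y t) * this + Real.sin (θ t) * f1 t + Real.cos (θ t) * f2 t
  · have hwp : Function.Periodic w 1 := fun t => by
      simp only [w, hxp t, hyp t, periodic_deriv (hx.differentiable (by simp)) hxp t,
        periodic_deriv (hy.differentiable (by simp)) hyp t]
    have hd : ∀ t, HasDerivAt (fun t => θ (t + 1) - θ t) 0 t := fun t => by
      have := (HasDerivAt.comp_add_const t 1 (dθ (t + 1))).sub (dθ t)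
      rwa [hwp t, sub_self] at this
    have := is_const_of_deriv_eq_zero (fun t => (hd t).differentiableAt) (fun t => (hd t).deriv) t 0
    simpa using this

theorem IsFramed.exists_angle (h : IsFramed γ β) {ν : ℝ → E3} (hν : IsFramed γ ν) :
    ∃ θ : ℝ → ℝ, ContDiff ℝ ∞ θ ∧ (∀ t, ν t = rotated γ β (θ t) t) ∧
      ∀ t, θ (t + 1) - θ t = θ 1 - θ 0 := by
  obtain ⟨θ, hθ, hx, hy, hp⟩ := ProfileCurve.exists_angle (x := fun t => inner ℝ (β t) (ν t))
    (y := fun t => inner ℝ (binormal γ β t) (ν t)) (h.smooth.inner ℝ hν.smooth)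
    (h.contDiff_binormal.inner ℝ hν.smooth) (fun t => by simp only [h.periodic t, hν.periodic t])
    (fun t => by simp only [h.periodic_binormal t, hν.periodic t]) (fun t => by
      rw [← h.norm_sq_combination t, ← h.expand_normal (hν.normal t), hν.norm_eq_one]; norm_num)
  refine ⟨θ, hθ, fun t => ?_, hp⟩
  rw [rotated, ← hx, ← hy]
  exact h.expand_normal (hν.normal t)

end PushOff

/-! ### The linking number with a small meridian -/

theorem abs_det3_le (u v w : E3) : |det3 u v w| ≤ ‖u‖ * (‖v‖ * ‖w‖) := by
  rw [← inner_cross]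
  refine (abs_real_inner_le_norm _ _).trans (mul_le_mul_of_nonneg_left ?_ (norm_nonneg u))
  refine le_of_sq_le_sq ?_ (by positivity)
  rw [mul_pow, norm_sq_eq_coords, norm_sq_eq_coords, norm_sq_eq_coords]
  simp
  nlinarith [sq_nonneg (v 0 * w 0 + v 1 * w 1 + v 2 * w 2)]

theorem const_mul_le_integral {f : ℝ → ℝ} (hf : Continuous f) {a b c : ℝ} (hab : a ≤ b)
    (h : ∀ x ∈ Set.Icc a b, c ≤ f x) : c * (b - a) ≤ ∫ x in a..b, f x := by
  have := intervalIntegral.integral_mono_on (μ := MeasureTheory.volume) (f := fun _ => c) hab intervalIntegrable_const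
    (hf.intervalIntegrable a b) h
  rw [intervalIntegral.integral_const, smul_eq_mul] at this
  linarith

section Meridian

variable {γ β : ℝ → E3}

/-- The velocity and position vectors of a meridian span the normal plane, so their determinant with
`X` sees only the tangential part of `X`. This gives the leading term of the Gauss integrand, of a
fixed sign. -/
theorem IsFramed.det3_rotated (h : IsFramed γ β) (X : E3) (φ t : ℝ) :
    det3 X (rotated γ β (φ + Real.pi / 2) t) (rotated γ β φ t) =
      -inner ℝ X (unitTangent γ t) := by
  have h1 := h.norm_sq_combination t 1 0
  have hb : β t 0 ^ 2 + β t 1 ^ 2 + β t 2 ^ 2 = 1 := by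
    rw [← norm_sq_eq_coords, h.norm_eq_one]; norm_num
  have hT := h.inner_unitTangent t
  rw [inner_eq_coords] at hT
  have hcs := Real.cos_sq_add_sin_sq φ
  simp only [rotated, Real.cos_add_pi_div_two, Real.sin_add_pi_div_two, det3_eq_coords,
    inner_eq_coords, PiLp.add_apply, PiLp.smul_apply, smul_eq_mul, binormal, cross_zero, cross_one,
    cross_two]
  generalize unitTangent γ t = T at hT ⊢
  generalize β t = b at hb hT ⊢
  generalize Real.cos φ = c at hcs ⊢
  generalize Real.sin φ = s at hcs ⊢
  linear_combination (-(X 0 * T 0 + X 1 * T 1 + X 2 * T 2) * (b 0 ^ 2 + b 1 ^ 2 + b 2 ^ 2) +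
    (X 0 * b 0 + X 1 * b 1 + X 2 * b 2) * (T 0 * b 0 + T 1 * b 1 + T 2 * b 2)) * hcs -
    (X 0 * T 0 + X 1 * T 1 + X 2 * T 2) * hb + (X 0 * b 0 + X 1 * b 1 + X 2 * b 2) * hT

/-- The Gauss integrand of `γ` and its meridian of radius `ε` at the parameter `0`. -/
def meridianIntegrand (γ β : ℝ → E3) (ε φ s : ℝ) : ℝ :=
  gaussForm (deriv γ s) (ε • rotated γ β (φ + Real.pi / 2) 0) (γ s - (γ 0 + ε • rotated γ β φ 0))

set_option maxHeartbeats 800000 in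
/-- Near the meridian the Gauss integrand is bounded below by that of a straight line, up to a
constant. -/
theorem IsFramed.meridianIntegrand_near (h : IsFramed γ β) :
    ∃ δ₀ k c : ℝ, 0 < δ₀ ∧ δ₀ ≤ 1 / 2 ∧ 0 < k ∧ 0 < c ∧ ∀ ε φ s, 0 < ε → |s| ≤ δ₀ →
      c * ε ^ 2 / (|s| + ε) ^ 3 - k ≤ meridianIntegrand γ β ε φ s := by
  -- Two Taylor expansions come from these quotients. In `γ s - γ 0 = s γ'(s) + s² g₂(s)` the linear
  -- term dies in the determinant with `γ'(s)`. The form `s γ'(0) + s² g₃(s)` bounds the distance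
  -- from below.
  obtain ⟨g₁, hg₁, e₁⟩ := exists_smooth_factor (f := fun s => γ s - γ 0) (a := 0)
    (h.curve.smooth.sub contDiff_const) (sub_self _)
  simp only [sub_zero] at e₁
  have g₁0 : g₁ 0 = deriv γ 0 := by
    have d1 : HasDerivAt (fun s => γ s - γ 0) (deriv γ 0) 0 := (h.curve.hasDerivAt 0).sub_const _
    have d2 : HasDerivAt (fun s : ℝ => s • g₁ s) ((0 : ℝ) • deriv g₁ 0 + (1 : ℝ) • g₁ 0) 0 :=
      (hasDerivAt_id (0 : ℝ)).smul (hg₁.differentiable (by simp) 0).hasDerivAt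
    rw [show (fun s => γ s - γ 0) = fun s : ℝ => s • g₁ s from funext e₁] at d1
    simpa using d2.unique d1
  obtain ⟨g₂, hg₂, e₂⟩ := exists_smooth_factor (f := fun s => g₁ s - deriv γ s) (a := 0)
    (hg₁.sub h.curve.contDiff_deriv) (by rw [g₁0, sub_self])
  obtain ⟨g₃, hg₃, e₃⟩ := exists_smooth_factor (f := fun s => g₁ s - g₁ 0) (a := 0)
    (hg₁.sub contDiff_const) (sub_self _)
  simp only [sub_zero] at e₂ e₃
  have hbd : ∀ f : ℝ → E3, Continuous f → ∃ C, ∀ s ∈ Set.Icc (-1 : ℝ) 1, ‖f s‖ ≤ C := fun f hf =>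
    isCompact_Icc.exists_bound_of_continuousOn hf.continuousOn
  obtain ⟨C₀, hC₀⟩ := hbd _ h.curve.contDiff_deriv.continuous
  obtain ⟨C₁, hC₁⟩ := hbd _ hg₁.continuous
  obtain ⟨C₂, hC₂⟩ := hbd _ hg₂.continuous
  obtain ⟨C₃, hC₃⟩ := hbd _ hg₃.continuous
  obtain ⟨C, hC1, hC⟩ : ∃ C : ℝ, 1 ≤ C ∧ ∀ s ∈ Set.Icc (-1 : ℝ) 1, ‖deriv γ s‖ ≤ C ∧ ‖g₁ s‖ ≤ C ∧
      ‖g₂ s‖ ≤ C ∧ ‖g₃ s‖ ≤ C := by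
    refine ⟨max 1 (max (max C₀ C₁) (max C₂ C₃)), le_max_left _ _, fun s hs => ?_⟩
    exact ⟨(hC₀ s hs).trans (by simp), (hC₁ s hs).trans (by simp), (hC₂ s hs).trans (by simp),
      (hC₃ s hs).trans (by simp)⟩
  set m := ‖deriv γ 0‖ with hm
  have hm0 : 0 < m := h.norm_deriv_pos 0
  have hin0 : inner ℝ (deriv γ 0) (unitTangent γ 0) = m := by
    rw [unitTangent, inner_smul_right, real_inner_self_eq_norm_sq]
    field_simp
    exact hm.symm
  have hcont : ContinuousAt (fun s => inner ℝ (deriv γ s) (unitTangent γ 0)) 0 :=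
    (h.curve.contDiff_deriv.continuous.inner continuous_const).continuousAt
  obtain ⟨δ₁, hδ₁, hin⟩ := Metric.eventually_nhds_iff.mp (hcont.eventually
    (lt_mem_nhds (show m / 2 < inner ℝ (deriv γ 0) (unitTangent γ 0) by rw [hin0]; linarith)))
  -- Chosen so that `c₀ (|s| + ε)` is at most the length of `s γ'(0) - ε e`, a difference of
  -- orthogonal vectors. The bound on `|s|` then lets the quadratic remainder use up only half of
  -- it.
  set c₀ := min m 1 / 2 with hc₀
  have hc₀0 : 0 < c₀ := by positivity
  have hc₀m : 2 * c₀ ≤ m := by rw [hc₀]; linarith [min_le_left m 1]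
  have hc₀1 : 2 * c₀ ≤ 1 := by rw [hc₀]; linarith [min_le_right m 1]
  have hCpos : 0 < C := by linarith
  refine ⟨min (min (δ₁ / 2) (1 / 2)) (c₀ / (2 * C)), C ^ 2 / (c₀ / 2) ^ 3, m / 2 / C ^ 3,
    by positivity, (min_le_left _ _).trans (min_le_right _ _), by positivity, by positivity, ?_⟩
  intro ε φ s hε hs
  have hs1 : |s| < δ₁ := by
    have := (hs.trans (min_le_left _ _)).trans (min_le_left _ _); linarith
  have hs2 : |s| ≤ 1 / 2 := (hs.trans (min_le_left _ _)).trans (min_le_right _ _)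
  have hs3 : C * |s| ≤ c₀ / 2 := by
    have := hs.trans (min_le_right _ _)
    rw [le_div_iff₀ (by positivity)] at this
    linarith
  obtain ⟨b₀, b₁, b₂, b₃⟩ := hC s ⟨by linarith [(abs_le.mp hs2).1], by linarith [(abs_le.mp hs2).2]⟩
  have hin' := hin (show dist s 0 < δ₁ by rwa [Real.dist_eq, sub_zero])
  set e := rotated γ β φ 0
  set e' := rotated γ β (φ + Real.pi / 2) 0
  have he : ‖e‖ = 1 := h.norm_rotated _ _
  have he' : ‖e'‖ = 1 := h.norm_rotated _ _
  set D := γ s - (γ 0 + ε • e) with hD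
  have hs0 := abs_nonneg s
  have hρ : 0 < |s| + ε := by linarith
  have hDup : ‖D‖ ≤ C * (|s| + ε) := by
    have : D = s • g₁ s - ε • e := by rw [← e₁, hD]; abel
    rw [this]
    refine (norm_sub_le _ _).trans ?_
    rw [norm_smul, norm_smul, he, Real.norm_eq_abs, Real.norm_of_nonneg hε.le]
    nlinarith
  have hDlow : c₀ / 2 * (|s| + ε) ≤ ‖D‖ := by
    have h1 : D = (s • deriv γ 0 - ε • e) + (s ^ 2) • g₃ s := by
      rw [pow_two, mul_smul, ← e₃, smul_sub, ← e₁, g₁0, hD]; abel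
    have h2 : c₀ * (|s| + ε) ≤ ‖s • deriv γ 0 - ε • e‖ := by
      refine le_of_sq_le_sq ?_ (norm_nonneg _)
      rw [norm_sub_sq_real, norm_smul, norm_smul, he, inner_smul_left, inner_smul_right,
        real_inner_comm, h.rotated_normal, Real.norm_eq_abs, Real.norm_of_nonneg hε.le, ← hm]
      have h3 : (2 * c₀ * |s|) ^ 2 ≤ (|s| * m) ^ 2 := by
        apply pow_le_pow_left₀ (by positivity); nlinarith
      have h4 : (2 * c₀ * ε) ^ 2 ≤ ε ^ 2 := by
        apply pow_le_pow_left₀ (by positivity); nlinarith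
      have h5 : c₀ ^ 2 * (|s| - ε) ^ 2 ≥ 0 := by positivity
      simp only [mul_zero, sub_zero, mul_one]
      nlinarith
    have h3 : ‖(s ^ 2) • g₃ s‖ ≤ c₀ / 2 * |s| := by
      rw [norm_smul, Real.norm_of_nonneg (sq_nonneg s), ← sq_abs]
      nlinarith
    have h4 := norm_sub_norm_le (s • deriv γ 0 - ε • e) (-((s ^ 2) • g₃ s))
    rw [norm_neg, sub_neg_eq_add, ← h1] at h4
    nlinarith
  have hD0 : 0 < ‖D‖ := lt_of_lt_of_le (by positivity) hDlow
  have hnum : m / 2 * ε ^ 2 - C ^ 2 * (ε * s ^ 2) ≤ det3 (deriv γ s) (ε • e') D := by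
    have h1 : D = (s ^ 2) • g₂ s + s • deriv γ s - ε • e := by
      rw [pow_two, mul_smul, ← e₂, smul_sub, ← e₁, hD]; abel
    have h2 : det3 (deriv γ s) (ε • e') D = ε * s ^ 2 * det3 (deriv γ s) e' (g₂ s) -
        ε ^ 2 * det3 (deriv γ s) e' e := by
      rw [h1]
      simp only [det3_eq_coords, PiLp.add_apply, PiLp.sub_apply, PiLp.smul_apply, smul_eq_mul]
      ring
    rw [h2, h.det3_rotated]
    have h3 := (abs_le.mp (abs_det3_le (deriv γ s) e' (g₂ s))).1
    rw [he', one_mul] at h3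
    have h4 : ‖deriv γ s‖ * ‖g₂ s‖ ≤ C ^ 2 := by
      rw [pow_two]; exact mul_le_mul b₀ b₂ (norm_nonneg _) hCpos.le
    have h5 : 0 ≤ ε * s ^ 2 := by positivity
    have h6 : 0 < ε ^ 2 := by positivity
    have h7 := mul_le_mul_of_nonneg_left (show -C ^ 2 ≤ det3 (deriv γ s) e' (g₂ s) by linarith) h5
    have h8 := mul_le_mul_of_nonneg_left hin'.le h6.le
    linarith
  unfold meridianIntegrand gaussForm
  have p1 : (c₀ / 2) ^ 3 * (|s| + ε) ^ 3 ≤ ‖D‖ ^ 3 := by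
    rw [← mul_pow]; exact pow_le_pow_left₀ (by positivity) hDlow 3
  have p2 : ‖D‖ ^ 3 ≤ C ^ 3 * (|s| + ε) ^ 3 := by
    rw [← mul_pow]; exact pow_le_pow_left₀ (norm_nonneg _) hDup 3
  calc m / 2 / C ^ 3 * ε ^ 2 / (|s| + ε) ^ 3 - C ^ 2 / (c₀ / 2) ^ 3
      ≤ m / 2 * ε ^ 2 / ‖D‖ ^ 3 - C ^ 2 * (ε * s ^ 2) / ‖D‖ ^ 3 := by
        apply sub_le_sub
        · rw [show m / 2 / C ^ 3 * ε ^ 2 / (|s| + ε) ^ 3 =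
            m / 2 * ε ^ 2 / (C ^ 3 * (|s| + ε) ^ 3) by field_simp]
          exact div_le_div_of_nonneg_left (by positivity) (by positivity) p2
        · rw [div_le_div_iff₀ (by positivity) (by positivity)]
          have : ε * s ^ 2 ≤ (|s| + ε) ^ 3 := by
            rw [← sq_abs s]
            have := pow_nonneg hs0 3
            have : 0 ≤ |s| ^ 2 * ε := by positivity
            have : 0 ≤ |s| * ε ^ 2 := by positivity
            have : 0 ≤ ε ^ 3 := by positivity
            nlinarith
          have h7 : ε * s ^ 2 * (c₀ / 2) ^ 3 ≤ ‖D‖ ^ 3 :=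
            (mul_le_mul_of_nonneg_right this (by positivity)).trans (by linarith)
          have := mul_le_mul_of_nonneg_left h7 (show 0 ≤ C ^ 2 by positivity)
          linarith
    _ = (m / 2 * ε ^ 2 - C ^ 2 * (ε * s ^ 2)) / ‖D‖ ^ 3 := by rw [sub_div]
    _ ≤ _ := div_le_div_of_nonneg_right hnum (by positivity)

/-- Away from the parameter `0` the distance to the meridian is bounded below and the meridian has
speed `ε`, so the integrand is of order `ε`. -/
theorem IsFramed.meridianIntegrand_far (h : IsFramed γ β) {δ : ℝ} (hδ : 0 < δ) :
    ∃ K > 0, ∃ ε₀ > 0, ∀ ε φ s, 0 < ε → ε < ε₀ → δ ≤ |s| → |s| ≤ 1 / 2 →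
      -(K * ε) ≤ meridianIntegrand γ β ε φ s := by
  have hcomp : IsCompact {s : ℝ | δ ≤ |s| ∧ |s| ≤ 1 / 2} := by
    refine Metric.isCompact_of_isClosed_isBounded ((isClosed_le continuous_const continuous_abs).inter
      (isClosed_le continuous_abs continuous_const)) ?_
    refine (Metric.isBounded_closedBall (x := (0 : ℝ)) (r := 1 / 2)).subset fun s hs => ?_
    simpa [Metric.mem_closedBall] using hs.2
  obtain ⟨μ, hμ, hμs⟩ : ∃ μ > 0, ∀ s : ℝ, δ ≤ |s| → |s| ≤ 1 / 2 → μ ≤ ‖γ s - γ 0‖ := by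
    rcases Set.eq_empty_or_nonempty {s : ℝ | δ ≤ |s| ∧ |s| ≤ 1 / 2} with hem | hne
    · refine ⟨1, one_pos, fun s h1 h2 => ?_⟩
      have : s ∈ {s : ℝ | δ ≤ |s| ∧ |s| ≤ 1 / 2} := ⟨h1, h2⟩
      rw [hem] at this; exact this.elim
    · obtain ⟨s₀, hs₀, hmin⟩ := hcomp.exists_isMinOn hne
        ((h.curve.smooth.continuous.sub continuous_const).norm (f := fun s => γ s - γ 0)).continuousOn
      refine ⟨‖γ s₀ - γ 0‖, norm_pos_iff.mpr (sub_ne_zero.mpr fun heq => ?_), fun s h1 h2 =>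
        hmin ⟨h1, h2⟩⟩
      obtain ⟨n, hn⟩ := h.curve.eq_add_int heq
      rw [zero_add] at hn
      have h1 : |(n : ℝ)| < 1 := by rw [← hn]; linarith [hs₀.2]
      have h2 : n = 0 := by rw [← Int.abs_lt_one_iff]; exact_mod_cast h1
      have := hs₀.1
      rw [hn, h2] at this
      simp at this; linarith
  obtain ⟨C, hC⟩ := isCompact_Icc.exists_bound_of_continuousOn (s := Set.Icc (-1 : ℝ) 1)
    h.curve.contDiff_deriv.continuous.continuousOn
  have hC0 : 0 ≤ C := (norm_nonneg _).trans (hC 0 (by simp))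
  refine ⟨(C + 1) / (μ / 2) ^ 2, by positivity, μ / 2, by positivity, ?_⟩
  intro ε φ s hε hε0 hs1 hs2
  have hb := hC s ⟨by linarith [(abs_le.mp hs2).1], by linarith [(abs_le.mp hs2).2]⟩
  unfold meridianIntegrand gaussForm
  set e := rotated γ β φ 0
  set e' := rotated γ β (φ + Real.pi / 2) 0
  have he : ‖e‖ = 1 := h.norm_rotated _ _
  have he' : ‖e'‖ = 1 := h.norm_rotated _ _
  set D := γ s - (γ 0 + ε • e) with hD
  have hDlow : μ / 2 ≤ ‖D‖ := by
    have h1 : D = (γ s - γ 0) - ε • e := by rw [hD]; abel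
    have h2 := norm_sub_norm_le (γ s - γ 0) (ε • e)
    rw [← h1, norm_smul, he, Real.norm_of_nonneg hε.le] at h2
    linarith [hμs s hs1 hs2]
  have hD0 : 0 < ‖D‖ := lt_of_lt_of_le (by positivity) hDlow
  have h3 := (abs_le.mp (abs_det3_le (deriv γ s) (ε • e') D)).1
  rw [norm_smul, he', Real.norm_of_nonneg hε.le, mul_one] at h3
  rw [← neg_le_neg_iff, neg_neg, ← neg_div, div_le_iff₀ (by positivity)]
  have h4 : ‖deriv γ s‖ * (ε * ‖D‖) ≤ (C + 1) * (ε * ‖D‖) :=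
    mul_le_mul_of_nonneg_right (by linarith) (by positivity)
  have h5 : (C + 1) * (ε * ‖D‖) ≤ (C + 1) / (μ / 2) ^ 2 * ε * ‖D‖ ^ 3 := by
    rw [show (C + 1) / (μ / 2) ^ 2 * ε * ‖D‖ ^ 3 =
      (C + 1) * (ε * ‖D‖) * (‖D‖ ^ 2 / (μ / 2) ^ 2) by field_simp]
    refine le_mul_of_one_le_right (by positivity) ?_
    rw [one_le_div (by positivity)]
    exact pow_le_pow_left₀ (by positivity) hDlow 2
  linarith

theorem IsFramed.continuous_meridianIntegrand (h : IsFramed γ β) {r : ℝ} (hr : IsTubeRadius γ β r)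
    {ε : ℝ} (hε : 0 < ε) (hεr : ε < r) :
    Continuous fun x : ℝ × ℝ => meridianIntegrand γ β ε x.1 x.2 := by
  have c1 := h.curve.contDiff_deriv.continuous
  have c2 := h.curve.smooth.continuous
  refine continuous_gaussForm (c1.comp continuous_snd) ?_ ?_ fun x => sub_ne_zero.mpr ?_
  · unfold rotated; fun_prop
  · unfold rotated; fun_prop
  · refine hr.ne_add_normal h ?_ ?_ ?_
    · rw [inner_smul_left, h.rotated_normal, mul_zero]
    · rw [← norm_ne_zero_iff, norm_smul, h.norm_rotated, mul_one]; simpa using hε.ne'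
    · rwa [norm_smul, h.norm_rotated, mul_one, Real.norm_of_nonneg hε.le]

/-- The part `|s| ≤ ε` contributes a fixed positive amount, and everything else is a small error.
Positivity suffices below, so the exact linking number of a meridian is never needed. -/
theorem IsFramed.meridian_integral_pos (h : IsFramed γ β) : ∀ᶠ ε in 𝓝[>] (0 : ℝ), ∀ φ,
    0 < ∫ s in (0 : ℝ)..1, meridianIntegrand γ β ε φ s := by
  obtain ⟨r, hr⟩ := h.exists_tubeRadius
  obtain ⟨δ₀, k, c, hδ₀, hδ₀2, hk, hc, near⟩ := h.meridianIntegrand_near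
  -- With this `δ` the constant `-k` costs at most `c / 16` on `[-δ, δ]`. The two outer intervals
  -- cost at most `c / 16` each, against a gain of `c / 4`.
  set δ := min δ₀ (c / 4 / (8 * k)) with hδdef
  have hδ : 0 < δ := by positivity
  have hδk : 2 * δ * k ≤ c / 16 := by
    have : δ ≤ c / 4 / (8 * k) := min_le_right _ _
    rw [le_div_iff₀ (by positivity)] at this
    linarith
  have hδ2 : δ ≤ 1 / 2 := (min_le_left _ _).trans hδ₀2
  obtain ⟨K, hK, ε₀, hε₀, far⟩ := h.meridianIntegrand_far hδ
  filter_upwards [Ioo_mem_nhdsGT hr.pos, Ioo_mem_nhdsGT hε₀, Ioo_mem_nhdsGT hδ,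
    Ioo_mem_nhdsGT (show 0 < c / 16 / K by positivity)] with ε h1 h2 h3 h4 φ
  have hε := h1.1
  have hεK : K * ε < c / 16 := by
    have := h4.2
    rw [lt_div_iff₀ hK] at this; linarith
  have hcont : Continuous (meridianIntegrand γ β ε φ) :=
    (h.continuous_meridianIntegrand hr h1.1 h1.2).comp (f := fun s => (φ, s)) (by fun_prop)
  have hper : Function.Periodic (meridianIntegrand γ β ε φ) 1 := fun s => by
    simp only [meridianIntegrand, h.curve.periodic_deriv s, h.curve.periodic s]
  have hshift : ∫ s in (0 : ℝ)..1, meridianIntegrand γ β ε φ s =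
      ∫ s in (-(1 / 2) : ℝ)..(1 / 2), meridianIntegrand γ β ε φ s := by
    have := hper.intervalIntegral_add_eq 0 (-(1 / 2))
    rw [zero_add] at this
    rw [this]; norm_num
  have ii : ∀ a b, IntervalIntegrable (meridianIntegrand γ β ε φ) MeasureTheory.volume a b :=
    fun a b => hcont.intervalIntegrable a b
  have hcε : ∀ x : ℝ, c * ε ^ 2 / (|x| + ε) ^ 3 ≥ 0 := fun x => by positivity
  have hδδ : ∀ x : ℝ, |x| ≤ δ → |x| ≤ δ₀ := fun x hx => hx.trans (min_le_left _ _)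
  -- The period is cut at `±δ` and `±ε`. On the middle piece `(|x| + ε) ^ 3 ≤ 8 ε ^ 3`, so the main
  -- term is at least `c / (8 ε)` over length `2 ε`.
  have i1 := const_mul_le_integral hcont (a := -(1 / 2)) (b := -δ) (c := -(K * ε)) (by linarith)
    fun x hx => far ε φ x hε h2.2 (by rw [abs_of_nonpos (by linarith [hx.2])]; linarith [hx.2])
      (by rw [abs_of_nonpos (by linarith [hx.2])]; linarith [hx.1])
  have i2 := const_mul_le_integral hcont (a := -δ) (b := -ε) (c := -k) (by linarith [h3.2])
    fun x hx => (by linarith [hcε x] : -k ≤ c * ε ^ 2 / (|x| + ε) ^ 3 - k).trans (near ε φ x hε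
      (hδδ x (by rw [abs_of_nonpos (by linarith [hx.2])]; linarith [hx.1])))
  have i3 := const_mul_le_integral hcont (a := -ε) (b := ε) (c := c / (8 * ε) - k) (by linarith)
    fun x hx => by
      have hx' : |x| ≤ ε := abs_le.mpr hx
      refine le_trans ?_ (near ε φ x hε (hδδ x (hx'.trans h3.2.le)))
      have hx0 := abs_nonneg x
      apply sub_le_sub_right
      rw [show c / (8 * ε) = c * ε ^ 2 / (ε + ε) ^ 3 by field_simp; ring]
      gcongr
  have i4 := const_mul_le_integral hcont (a := ε) (b := δ) (c := -k) (by linarith [h3.2])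
    fun x hx => (by linarith [hcε x] : -k ≤ c * ε ^ 2 / (|x| + ε) ^ 3 - k).trans (near ε φ x hε
      (hδδ x (by rw [abs_of_nonneg (by linarith [hx.1])]; linarith [hx.2])))
  have i5 := const_mul_le_integral hcont (a := δ) (b := 1 / 2) (c := -(K * ε)) (by linarith)
    fun x hx => far ε φ x hε h2.2 (by rw [abs_of_nonneg (by linarith [hx.1])]; linarith [hx.1])
      (by rw [abs_of_nonneg (by linarith [hx.1])]; linarith [hx.2])
  rw [hshift, ← intervalIntegral.integral_add_adjacent_intervals (ii _ (-δ)) (ii _ _),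
    ← intervalIntegral.integral_add_adjacent_intervals (ii (-δ) (-ε)) (ii _ _),
    ← intervalIntegral.integral_add_adjacent_intervals (ii (-ε) ε) (ii _ _),
    ← intervalIntegral.integral_add_adjacent_intervals (ii ε δ) (ii _ _)]
  have hmid : (c / (8 * ε) - k) * (ε - -ε) = c / 4 - 2 * (k * ε) := by field_simp; ring
  have q1 : K * ε * (1 / 2 - δ) ≤ c / 16 * 1 := by
    apply mul_le_mul hεK.le (by linarith) (by linarith) (by positivity)
  rw [hmid] at i3
  nlinarith

/-! ### The effect of the winding of a normal field on the linking number -/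

/-- The fields at angle `l * θ` interpolate between `β` and `ν`, but close up only if the winding
vanishes. The boundary term left by Stokes' theorem is the meridian integral from `θ 0` to `θ 1`.
Equal linking numbers make it zero, while its integrand in `φ` is positive. -/
theorem IsFramed.winding_eq_zero (h : IsFramed γ β) {ν : ℝ → E3} {θ : ℝ → ℝ}
    (hθ : ContDiff ℝ ∞ θ) (hνθ : ∀ t, ν t = rotated γ β (θ t) t) {n : ℝ}
    (h1 : IsPushOffLinkingNumber γ β n) (h2 : IsPushOffLinkingNumber γ ν n) : θ 1 = θ 0 := by
  obtain ⟨r, hr⟩ := h.exists_tubeRadius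
  obtain ⟨ε, ⟨⟨⟨hl1, hl2⟩, hM⟩, hε, hεr⟩⟩ :=
    (((h1.and h2).and h.meridian_integral_pos).and (Ioo_mem_nhdsGT hr.pos)).exists
  let η : ℝ → ℝ → E3 := fun l t => γ t + ε • rotated γ β (l * θ t) t
  have hb := h.contDiff_binormal
  have hs := h.smooth
  have hγs := h.curve.smooth
  have hcos := Real.contDiff_cos (n := ∞)
  have hsin := Real.contDiff_sin (n := ∞)
  have hη : ContDiff ℝ ∞ η.uncurry := by
    unfold η rotated Function.uncurry
    fun_prop
  obtain ⟨p, q, m, hp, hq, hpm, hqm, cp, cq, cm⟩ := exists_partial_derivatives hη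
  have hne : ∀ s l t, γ s ≠ η l t := fun s l t => by
    refine hr.ne_add_normal h ?_ ?_ ?_
    · rw [inner_smul_left, h.rotated_normal, mul_zero]
    · rw [← norm_ne_zero_iff, norm_smul, h.norm_rotated, mul_one]; simpa using hε.ne'
    · rwa [norm_smul, h.norm_rotated, mul_one, Real.norm_of_nonneg hε.le]
  have hbox := gauss_integral_sub h.curve.hasDerivAt h.curve.contDiff_deriv.continuous hp hq hpm hqm
    hη.continuous cp cq cm (by simpa using h.curve.periodic 0) hne
  have hp' : ∀ l, deriv (η l) = p l := fun l => funext fun t => (hp l t).deriv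
  have e0 : η 0 = fun t => γ t + ε • β t := by funext t; simp [η, rotated]
  have e1 : η 1 = fun t => γ t + ε • ν t := by funext t; simp [η, hνθ]
  have hzero : ∫ s in (0 : ℝ)..1, ∫ l in (0 : ℝ)..1, (gaussForm (deriv γ s) (q l 1) (γ s - η l 1) -
      gaussForm (deriv γ s) (q l 0) (γ s - η l 0)) = 0 := by
    rw [← hbox, sub_eq_zero, ← hp', ← hp']
    have hpi : (4 * Real.pi)⁻¹ ≠ 0 := inv_ne_zero (by positivity)
    apply mul_left_cancel₀ hpi
    rw [← linkingNumber_eq, ← linkingNumber_eq, e0, e1, hl1, hl2]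
  have hr1 : ∀ φ, rotated γ β φ 1 = rotated γ β φ 0 := fun φ => by
    have t1 := h.periodic 0
    have t2 := h.periodic_binormal 0
    rw [zero_add] at t1 t2
    rw [rotated, rotated, t1, t2]
  have hγ1 : γ 1 = γ 0 := by simpa using h.curve.periodic 0
  have hqt : ∀ l t, q l t = θ t • ε • rotated γ β (l * θ t + Real.pi / 2) t := fun l t => by
    have d1 : HasDerivAt (fun l => l * θ t) (θ t) l := by simpa using (hasDerivAt_id l).mul_const (θ t)
    have d2 : HasDerivAt (fun l => η l t) _ l :=
      ((((d1.cos).smul_const (β t)).add ((d1.sin).smul_const (binormal γ β t))).const_smul ε).const_add (γ t)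
    rw [(hq l t).unique d2, rotated, Real.cos_add_pi_div_two, Real.sin_add_pi_div_two]
    module
  have hlin : ∀ (a X d : E3) (x : ℝ), gaussForm a (x • X) d = x * gaussForm a X d := fun a X d x => by
    simp only [gaussForm, det3_eq_coords, PiLp.smul_apply, smul_eq_mul]; ring
  have hcM := h.continuous_meridianIntegrand hr hε hεr
  have hcφ : ∀ s, Continuous fun φ => meridianIntegrand γ β ε φ s := fun s =>
    hcM.comp (f := fun φ => (φ, s)) (by fun_prop)
  -- The substitution `φ = l * θ` at each end turns the two faces into integrals over `[0, θ 1]` and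
  -- `[0, θ 0]` of the same meridian integrand.
  have hinner : ∀ s, ∫ l in (0 : ℝ)..1, (gaussForm (deriv γ s) (q l 1) (γ s - η l 1) -
      gaussForm (deriv γ s) (q l 0) (γ s - η l 0)) =
      ∫ φ in (θ 0)..(θ 1), meridianIntegrand γ β ε φ s := fun s => by
    have k1 : ∀ l, gaussForm (deriv γ s) (q l 1) (γ s - η l 1) =
        θ 1 • meridianIntegrand γ β ε (l * θ 1) s := fun l => by
      rw [hqt, hlin, hr1, meridianIntegrand, smul_eq_mul]
      simp only [η, hr1, hγ1]
    have k0 : ∀ l, gaussForm (deriv γ s) (q l 0) (γ s - η l 0) =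
        θ 0 • meridianIntegrand γ β ε (l * θ 0) s := fun l => by
      rw [hqt, hlin, meridianIntegrand, smul_eq_mul]
    have ci : ∀ x : ℝ, IntervalIntegrable (fun l => x • meridianIntegrand γ β ε (l * x) s)
        MeasureTheory.volume 0 1 := fun x =>
      (((hcφ s).comp (f := fun l => l * x) (by fun_prop)).const_smul x).intervalIntegrable _ _
    simp only [k1, k0]
    rw [intervalIntegral.integral_sub (ci _) (ci _), intervalIntegral.integral_smul,
      intervalIntegral.integral_smul,
      intervalIntegral.smul_integral_comp_mul_right (f := fun φ => meridianIntegrand γ β ε φ s),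
      intervalIntegral.smul_integral_comp_mul_right (f := fun φ => meridianIntegrand γ β ε φ s),
      zero_mul, zero_mul, one_mul, one_mul]
    exact intervalIntegral.integral_interval_sub_left ((hcφ s).intervalIntegrable _ _)
      ((hcφ s).intervalIntegrable _ _)
  simp only [hinner] at hzero
  have hcM' : Continuous fun φ => ∫ s in (0 : ℝ)..1, meridianIntegrand γ β ε φ s :=
    intervalIntegral.continuous_parametric_intervalIntegral_of_continuous'
      (f := fun φ s => meridianIntegrand γ β ε φ s) hcM 0 1
  have hcM2 : Continuous (Function.uncurry fun s φ => meridianIntegrand γ β ε φ s) :=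
    hcM.comp (f := fun x : ℝ × ℝ => (x.2, x.1)) (by fun_prop)
  rcases lt_trichotomy (θ 0) (θ 1) with hlt | heq | hgt
  · rw [intervalIntegral_swap hcM2 zero_le_one hlt.le] at hzero
    exact absurd hzero (intervalIntegral.intervalIntegral_pos_of_pos (hcM'.intervalIntegrable _ _)
      hM hlt).ne'
  · exact heq.symm
  · simp only [intervalIntegral.integral_symm (θ 1) (θ 0)] at hzero
    rw [intervalIntegral.integral_neg, neg_eq_zero, intervalIntegral_swap hcM2 zero_le_one hgt.le] at hzero
    exact absurd hzero (intervalIntegral.intervalIntegral_pos_of_pos (hcM'.intervalIntegrable _ _)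
      hM hgt).ne'

end Meridian

/-! ### The writhe and the surface linking number -/

theorem IsBlackboardFraming.isFramed {γ β : ℝ → E3} (hβ : IsBlackboardFraming γ β)
    (hγ : IsSmoothClosedCurve γ) (hs : ContDiff ℝ ∞ β) : IsFramed γ β :=
  ⟨hγ, hs, hβ.periodic, hβ.norm_eq_one, hβ.normal⟩

theorem isWrithe_of_pushOff {γ β : ℝ → E3} (hγ : IsSmoothClosedCurve γ)
    (hfin : (verticalParams γ).Finite) (hβ : IsBlackboardFraming γ β) (hs : ContDiff ℝ ∞ β) {w : ℝ}
    (hw : IsPushOffLinkingNumber γ β w) : IsWrithe γ w := by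
  refine ⟨⟨β, hβ⟩, fun β' hβ' => ?_⟩
  rcases blackboardFraming_unique hγ hfin hβ hβ' with rfl | rfl
  · exact hw
  · exact hw.neg (hβ.isFramed hγ hs)

theorem IsUnitNormalField.isFramed {F : Set E3} (hF : IsSmoothSurface F) {ν : E3 → E3}
    (hν : IsUnitNormalField F ν) {γ : ℝ → E3} (hγ : IsSmoothClosedCurve γ) (hγF : ∀ t, γ t ∈ F) :
    IsFramed γ fun t => ν (γ t) :=
  ⟨hγ, hν.contDiff_comp hF hγ.smooth hγF, fun t => by simp only [hγ.periodic t],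
    fun t => hν.norm_eq_one _ (hγF t), fun t => hν.inner_deriv hγ.smooth hγF t⟩

theorem isSurfaceLinkingNumber_of_pushOff {F : Set E3} (hF : IsSmoothSurface F) {ν : E3 → E3}
    (hν : IsUnitNormalField F ν) {γ : ℝ → E3} (hγ : IsSmoothClosedCurve γ) (hγF : ∀ t, γ t ∈ F)
    {l : ℝ} (hl : IsPushOffLinkingNumber γ (fun t => ν (γ t)) l) :
    IsSurfaceLinkingNumber γ F l := by
  refine ⟨⟨ν, hν⟩, fun ν' hν' => ?_⟩
  rcases hν.unique_along hF hν' hγ.smooth.continuous hγF with h | h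
  · rw [h]; exact hl
  · rw [h]; exact hl.neg (hν.isFramed hF hγ hγF)

/-! ### Transport of normal fields by isotopies -/

/-- The derivative at time `s` of a family of maps of 3-space. -/
def spaceDeriv (K : ℝ → E3 → E3) (s : ℝ) (x : E3) : E3 →L[ℝ] E3 :=
  (fderiv ℝ (Function.uncurry K) (s, x)).comp (ContinuousLinearMap.inr ℝ ℝ E3)

theorem hasFDerivAt_spaceDeriv {K : ℝ → E3 → E3} (hK : ContDiff ℝ ∞ (Function.uncurry K)) (s : ℝ)
    (x : E3) : HasFDerivAt (K s) (spaceDeriv K s x) x :=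
  HasFDerivAt.comp (g := Function.uncurry K) x
    (hK.differentiable (by simp) (s, x)).hasFDerivAt (hasFDerivAt_prodMk_right s x)

theorem fderiv_mem_tangentVectors {F : Set E3} {Φ Ψ : E3 → E3} (hΨ : ContDiff ℝ ∞ Ψ)
    (hΨΦ : ∀ x, Ψ (Φ x) = x) {p v : E3} (hv : v ∈ tangentVectors (Φ '' F) p) :
    fderiv ℝ Ψ p v ∈ tangentVectors F (Ψ p) := by
  obtain ⟨c, hc, rfl, hcF, rfl⟩ := hv
  refine ⟨fun τ => Ψ (c τ), hΨ.contDiffAt.comp 0 hc, rfl, ?_, ?_⟩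
  · filter_upwards [hcF] with τ hτ
    obtain ⟨x, hx, hxe⟩ := hτ
    rw [← hxe, hΨΦ]; exact hx
  · exact ((hΨ.differentiable (by simp) (c 0)).hasFDerivAt.comp_hasDerivAt (0 : ℝ)
      (hc.differentiableAt (by simp)).hasDerivAt).deriv

/-- A normal is transported as a covector: `ν` composed with the derivative of the inverse map `K s`
annihilates the tangent vectors of the moved surface. It never vanishes because that derivative is
invertible, and it stays normal to `γ` because `γ` is fixed. Normalizing gives a homotopy of
framings. -/
theorem exists_transported_framing {F₀ F₁ : Set E3} (hF₀ : IsSmoothSurface F₀) {ν : E3 → E3}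
    (hν : IsUnitNormalField F₀ ν) {γ : ℝ → E3} (hγ : IsSmoothClosedCurve γ) (hγF : ∀ t, γ t ∈ F₀)
    (hiso : IsotopicFixing (Set.range γ) F₀ F₁) {l : ℝ}
    (hl : IsPushOffLinkingNumber γ (fun t => ν (γ t)) l) :
    ∃ n : ℝ → E3, IsFramed γ n ∧ IsPushOffLinkingNumber γ n l ∧
      ∀ t, ∀ v ∈ tangentVectors F₁ (γ t), inner ℝ (n t) v = 0 := by
  obtain ⟨H, K, hH, hK, hKH, hHK, hH0, hfix, rfl⟩ := hiso
  have hνs := hν.isFramed hF₀ hγ hγF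
  have hKγ : ∀ s t, K s (γ t) = γ t := fun s t => by
    conv_lhs => rw [← hfix s (γ t) ⟨t, rfl⟩]
    exact hKH s _
  have hK0 : ∀ x, K 0 x = x := fun x => by
    conv_lhs => rw [← hH0 x]
    exact hKH 0 x
  let L : ℝ → ℝ → E3 →L[ℝ] E3 := fun s t => spaceDeriv K s (γ t)
  have hL : ContDiff ℝ ∞ fun x : ℝ × ℝ => L x.1 x.2 := by
    have h1 : ContDiff ℝ ∞ (fderiv ℝ (Function.uncurry K)) := hK.fderiv_right (by simp)
    exact (h1.comp (contDiff_fst.prodMk (hγ.smooth.comp contDiff_snd))).clm_comp contDiff_const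
  have hdK : ∀ s t, HasFDerivAt (K s) (L s t) (γ t) := fun s t => hasFDerivAt_spaceDeriv hK s (γ t)
  let n : ℝ → ℝ → E3 := fun s t =>
    (InnerProductSpace.toDual ℝ E3).symm ((innerSL ℝ (ν (γ t))).comp (L s t))
  have hn : ContDiff ℝ ∞ fun x : ℝ × ℝ => n x.1 x.2 :=
    (InnerProductSpace.toDual ℝ E3).symm.toContinuousLinearEquiv.contDiff.comp
      (((innerSL ℝ).contDiff.comp (hνs.smooth.comp contDiff_snd)).clm_comp hL)
  have hin : ∀ s t v, inner ℝ (n s t) v = inner ℝ (ν (γ t)) (L s t v) := fun s t v => by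
    simp only [n, InnerProductSpace.toDual_symm_apply]; simp
  have hn0 : ∀ s t, n s t ≠ 0 := fun s t h0 => by
    have h1 := hin s t (spaceDeriv H s (γ t) (ν (γ t)))
    have h2 : HasFDerivAt (fun x => K s (H s x)) ((L s t).comp (spaceDeriv H s (γ t))) (γ t) := by
      refine HasFDerivAt.comp (g := K s) (γ t) ?_ (hasFDerivAt_spaceDeriv hH s (γ t))
      rw [hfix s _ ⟨t, rfl⟩]; exact hdK s t
    simp only [hKH] at h2
    have h3 := h2.unique (hasFDerivAt_id (γ t))
    have h4 : L s t (spaceDeriv H s (γ t) (ν (γ t))) = ν (γ t) := congrArg (fun A => A (ν (γ t))) h3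
    rw [h4, h0, inner_zero_left, real_inner_self_eq_norm_sq, hν.norm_eq_one _ (hγF t)] at h1
    norm_num at h1
  have hnnormal : ∀ s t, inner ℝ (n s t) (deriv γ t) = 0 := fun s t => by
    have h1 : HasDerivAt (fun t => K s (γ t)) (L s t (deriv γ t)) t :=
      (hdK s t).comp_hasDerivAt t (hγ.hasDerivAt t)
    simp only [hKγ] at h1
    rw [hin, h1.unique (hγ.hasDerivAt t)]
    exact hνs.normal t
  have hnper : ∀ s, Function.Periodic (n s) 1 := fun s t => by
    simp only [n, L, hγ.periodic t]
  have hnzero : ∀ t, n 0 t = ν (γ t) := fun t => by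
    refine ext_inner_right ℝ fun v => ?_
    have h1 := hdK 0 t
    rw [show K 0 = id from funext hK0] at h1
    rw [hin, h1.unique (hasFDerivAt_id _)]; rfl
  let v : ℝ → ℝ → E3 := fun s t => ‖n s t‖⁻¹ • n s t
  have hvc : ContDiff ℝ ∞ v.uncurry := by
    have h1 : ContDiff ℝ ∞ fun x : ℝ × ℝ => ‖n x.1 x.2‖⁻¹ :=
      (hn.norm ℝ fun x => hn0 _ _).inv fun x => norm_ne_zero_iff.mpr (hn0 _ _)
    exact h1.smul hn
  have hvper : ∀ s, Function.Periodic (v s) 1 := fun s t => by simp only [v, hnper s t]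
  have hvnorm : ∀ s t, ‖v s t‖ = 1 := fun s t => by
    rw [norm_smul, norm_inv, norm_norm, inv_mul_cancel₀ (norm_ne_zero_iff.mpr (hn0 s t))]
  have hvnormal : ∀ s t, inner ℝ (v s t) (deriv γ t) = 0 := fun s t => by
    rw [inner_smul_left, hnnormal, mul_zero]
  refine ⟨v 1, ⟨hγ, hvc.comp (f := fun t => (1, t)) (contDiff_const.prodMk contDiff_id), hvper 1,
    hvnorm 1, hvnormal 1⟩, IsPushOffLinkingNumber.of_family hνs hvc hvper hvnormal hvnorm ?_, ?_⟩
  · have : v 0 = fun t => ν (γ t) := funext fun t => by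
      simp only [v, hnzero, hν.norm_eq_one _ (hγF t), inv_one, one_smul]
    rwa [this]
  · intro t u hu
    rw [inner_smul_left, hin]
    have hK1 : ContDiff ℝ ∞ (K 1) := hK.comp (f := fun x => (1, x)) (contDiff_const.prodMk contDiff_id)
    have := fderiv_mem_tangentVectors (F := F₀) hK1 (hKH 1) hu
    rw [(hdK 1 t).fderiv, hKγ] at this
    rw [hν.normal _ (hγF t) _ this, mul_zero]

/-- Along a profile curve `e3` is tangent, so the transported normal is horizontal and thus a
blackboard framing. -/
theorem writhe_eq_of_profileCurve {F₀ F₁ : Set E3} (hF₀ : IsSmoothSurface F₀) {ν : E3 → E3}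
    (hν : IsUnitNormalField F₀ ν) {γ : ℝ → E3} (hγ : IsSmoothClosedCurve γ) (hγF : ∀ t, γ t ∈ F₀)
    (hiso : IsotopicFixing (Set.range γ) F₀ F₁) (hprof : IsProfileCurve F₁ (Set.range γ)) {w l : ℝ}
    (hw : IsWrithe γ w) (hl : IsPushOffLinkingNumber γ (fun t => ν (γ t)) l) : w = l := by
  obtain ⟨n, hn, hnl, htan⟩ := exists_transported_framing hF₀ hν hγ hγF hiso hl
  obtain ⟨p, -, hp⟩ := hprof
  have hvert : ∀ t, e3 ∈ tangentVectors F₁ (γ t) := fun t => by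
    have h1 : γ t ∈ connectedComponentIn (contour F₁) p := hp ▸ ⟨t, rfl⟩
    exact (connectedComponentIn_subset _ _ h1).2
  have hblack : IsBlackboardFraming γ n :=
    ⟨hn.smooth.continuous, hn.periodic, hn.norm_eq_one, fun t => by
      rw [← inner_e3]; exact htan t _ (hvert t), hn.normal⟩
  exact (hw.2 n hblack).unique hnl

/-! ### Ambient isotopies -/

/-- `H` is a smooth ambient isotopy of 3-space, with inverse `K`, that fixes `C` pointwise. -/
structure IsIsotopy (C : Set E3) (H K : ℝ → E3 → E3) : Prop where
  smooth : ContDiff ℝ ∞ (fun q : ℝ × E3 => H q.1 q.2)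
  smooth_inv : ContDiff ℝ ∞ (fun q : ℝ × E3 => K q.1 q.2)
  left_inv : ∀ s x, K s (H s x) = x
  right_inv : ∀ s x, H s (K s x) = x
  zero : ∀ x, H 0 x = x
  fixes : ∀ s, ∀ x ∈ C, H s x = x

namespace IsIsotopy

variable {C : Set E3} {H K H' K' : ℝ → E3 → E3}

theorem isotopicFixing (h : IsIsotopy C H K) (F : Set E3) : IsotopicFixing C F (H 1 '' F) :=
  ⟨H, K, h.smooth, h.smooth_inv, h.left_inv, h.right_inv, h.zero, h.fixes, rfl⟩

theorem comp (h : IsIsotopy C H K) (h' : IsIsotopy C H' K') :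
    IsIsotopy C (fun s x => H' s (H s x)) fun s x => K s (K' s x) where
  smooth := h'.smooth.comp (contDiff_fst.prodMk h.smooth)
  smooth_inv := h.smooth_inv.comp (contDiff_fst.prodMk h'.smooth_inv)
  left_inv s x := by rw [h'.left_inv, h.left_inv]
  right_inv s x := by rw [h.right_inv, h'.right_inv]
  zero x := by rw [h.zero, h'.zero]
  fixes s x hx := by rw [h.fixes s x hx, h'.fixes s x hx]

theorem contDiff_apply (h : IsIsotopy C H K) (s : ℝ) : ContDiff ℝ ∞ (H s) :=
  h.smooth.comp (f := fun x => (s, x)) (contDiff_const.prodMk contDiff_id)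

theorem contDiff_inv (h : IsIsotopy C H K) (s : ℝ) : ContDiff ℝ ∞ (K s) :=
  h.smooth_inv.comp (f := fun x => (s, x)) (contDiff_const.prodMk contDiff_id)

theorem inv_fixes (h : IsIsotopy C H K) (s : ℝ) {x : E3} (hx : x ∈ C) : K s x = x := by
  conv_lhs => rw [← h.fixes s x hx]
  exact h.left_inv s x

end IsIsotopy

theorem IsLocalEquation.image {F : Set E3} {Φ Ψ : E3 → E3} (hΦ : ContDiff ℝ ∞ Φ)
    (hΨ : ContDiff ℝ ∞ Ψ) (hΨΦ : ∀ x, Ψ (Φ x) = x) (hΦΨ : ∀ x, Φ (Ψ x) = x) {p : E3} {g : E3 → ℝ}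
    (hg : IsLocalEquation F (Ψ p) g) : IsLocalEquation (Φ '' F) p (fun x => g (Ψ x)) := by
  obtain ⟨U, hU, hpU, hgU, hd, hmem⟩ := hg
  refine ⟨Ψ ⁻¹' U, hU.preimage hΨ.continuous, hpU, hgU.comp hΨ.contDiffOn (fun x hx => hx),
    fun x hx h0 => hd (Ψ x) hx ?_, fun x hx => ?_⟩
  · have h1 : HasFDerivAt g (fderiv ℝ g (Ψ x)) (Ψ x) :=
      ((hgU.contDiffAt (hU.mem_nhds hx)).differentiableAt (by simp)).hasFDerivAt
    have h2 : HasFDerivAt (fun x => g (Ψ x)) ((fderiv ℝ g (Ψ x)).comp (fderiv ℝ Ψ x)) x :=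
      h1.comp x (hΨ.differentiable (by simp) x).hasFDerivAt
    have h3 : HasFDerivAt Φ (fderiv ℝ Φ (Ψ x)) (Ψ x) := (hΦ.differentiable (by simp) _).hasFDerivAt
    have h4 : HasFDerivAt (fun y => Ψ (Φ y)) ((fderiv ℝ Ψ x).comp (fderiv ℝ Φ (Ψ x))) (Ψ x) := by
      refine HasFDerivAt.comp (g := Ψ) _ ?_ h3
      rw [hΦΨ]; exact (hΨ.differentiable (by simp) x).hasFDerivAt
    simp only [hΨΦ] at h4
    have h5 := h4.unique (hasFDerivAt_id _)
    rw [h2.fderiv] at h0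
    rw [← ContinuousLinearMap.comp_id (fderiv ℝ g (Ψ x)), ← h5, ← ContinuousLinearMap.comp_assoc, h0,
      ContinuousLinearMap.zero_comp]
  · rw [← hmem (Ψ x) hx]
    constructor
    · rintro ⟨y, hy, rfl⟩; rwa [hΨΦ]
    · intro h; exact ⟨Ψ x, h, hΦΨ x⟩

theorem IsSmoothSurface.image {F : Set E3} (hF : IsSmoothSurface F) {Φ Ψ : E3 → E3}
    (hΦ : ContDiff ℝ ∞ Φ) (hΨ : ContDiff ℝ ∞ Ψ) (hΨΦ : ∀ x, Ψ (Φ x) = x)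
    (hΦΨ : ∀ x, Φ (Ψ x) = x) : IsSmoothSurface (Φ '' F) := by
  rintro _ ⟨x, hx, rfl⟩
  obtain ⟨g, hg⟩ := hF x hx
  exact ⟨_, IsLocalEquation.image hΦ hΨ hΨΦ hΦΨ (by rwa [hΨΦ])⟩

/-! ### Twisting a tube -/

theorem exists_cutoff {a b : ℝ} (hab : a < b) : ∃ ψ : ℝ → ℝ, ContDiff ℝ ∞ ψ ∧
    (∀ u, u ≤ a → ψ u = 1) ∧ ∀ u, b ≤ u → ψ u = 0 := by
  have hba : 0 < b - a := sub_pos.mpr hab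
  refine ⟨fun u => 1 - Real.smoothTransition ((u - a) / (b - a)), ?_, fun u hu => ?_, fun u hu => ?_⟩
  · exact contDiff_const.sub (Real.smoothTransition.contDiff.comp
      ((contDiff_id.sub contDiff_const).div_const _))
  · beta_reduce
    rw [Real.smoothTransition.zero_of_nonpos
      (div_nonpos_of_nonpos_of_nonneg (sub_nonpos.mpr hu) hba.le), sub_zero]
  · beta_reduce
    rw [Real.smoothTransition.one_of_one_le ((one_le_div hba).mpr (by linarith)), sub_self]

theorem rotation_sq (a b φ : ℝ) : (Real.cos φ * a - Real.sin φ * b) ^ 2 +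
    (Real.sin φ * a + Real.cos φ * b) ^ 2 = a ^ 2 + b ^ 2 := by
  linear_combination (a ^ 2 + b ^ 2) * Real.cos_sq_add_sin_sq φ

/-- Each normal disc is rotated by `s θ` times a radial cutoff. A rotation preserves the radius and
the parameter `t`, hence also the angle, so `R (-s)` inverts `R s`. -/
theorem exists_twist {γ β : ℝ → E3} (h : IsFramed γ β) {r : ℝ} (hr : IsTubeRadius γ β r) {θ : ℝ → ℝ}
    (hθ : ContDiff ℝ ∞ θ) (hθp : Function.Periodic θ 1) :
    ∃ (R : ℝ → E3 → E3) (ρ : ℝ), 0 < ρ ∧ ContDiff ℝ ∞ (fun q : ℝ × E3 => R q.1 q.2) ∧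
      (∀ s x, R (-s) (R s x) = x) ∧ (∀ x, R 0 x = x) ∧
      ∀ s t a b, a ^ 2 + b ^ 2 < ρ ^ 2 → R s (tubeMap γ β (t, a, b)) =
        tubeMap γ β (t, Real.cos (s * θ t) * a - Real.sin (s * θ t) * b,
          Real.sin (s * θ t) * a + Real.cos (s * θ t) * b) := by
  have hr0 := hr.pos
  obtain ⟨ψ, hψ, hψ1, hψ0⟩ := exists_cutoff (a := (r / 4) ^ 2) (b := (r / 3) ^ 2) (by
    apply pow_lt_pow_left₀ _ (by positivity) two_ne_zero; linarith)
  -- The cutoff `ζ` is `1` wherever `ψ` is nonzero. So the globally defined `Y` and `Z` are the true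
  -- normal vector and its quarter turn wherever the angle `Θ` matters.
  obtain ⟨ζ, hζ, hζ1, hζ0⟩ := exists_cutoff (a := (r / 3) ^ 2) (b := (r / 2) ^ 2) (by
    apply pow_lt_pow_left₀ _ (by positivity) two_ne_zero; linarith)
  have hβ := h.smooth
  have hκ := h.contDiff_binormal
  obtain ⟨Θ, hΘ, -, hΘt, hΘ0⟩ := hr.transfer h
    (G := fun q => θ q.1 * ψ (q.2.1 ^ 2 + q.2.2 ^ 2)) (by fun_prop)
    (fun t a b => by simp only [hθp t]) (ρ := r / 2) (by linarith) (by positivity) (fun t a b hab => by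
      rw [hψ0 _ (le_trans (by nlinarith) hab), mul_zero])
  obtain ⟨Y, hY, -, hYt, -⟩ := hr.transfer h
    (G := fun q => ζ (q.2.1 ^ 2 + q.2.2 ^ 2) • (q.2.1 • β q.1 + q.2.2 • binormal γ β q.1))
    (by fun_prop) (fun t a b => by simp only [h.periodic t, h.periodic_binormal t])
    (ρ := r / 2) (by linarith) (by positivity) (fun t a b hab => by rw [hζ0 _ hab, zero_smul])
  obtain ⟨Z, hZ, -, hZt, -⟩ := hr.transfer h
    (G := fun q => ζ (q.2.1 ^ 2 + q.2.2 ^ 2) • (q.2.1 • binormal γ β q.1 - q.2.2 • β q.1))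
    (by fun_prop) (fun t a b => by simp only [h.periodic t, h.periodic_binormal t])
    (ρ := r / 2) (by linarith) (by positivity) (fun t a b hab => by rw [hζ0 _ hab, zero_smul])
  let R : ℝ → E3 → E3 := fun s x =>
    x + (Real.cos (s * Θ x) - 1) • Y x + Real.sin (s * Θ x) • Z x
  have hcos := Real.contDiff_cos (n := ∞)
  have hsin := Real.contDiff_sin (n := ∞)
  have hRid : ∀ s x, Θ x = 0 → R s x = x := fun s x hx => by simp [R, hx]
  have hRt : ∀ s t a b, a ^ 2 + b ^ 2 < r ^ 2 → R s (tubeMap γ β (t, a, b)) =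
      tubeMap γ β (t, Real.cos (s * (θ t * ψ (a ^ 2 + b ^ 2))) * a -
        Real.sin (s * (θ t * ψ (a ^ 2 + b ^ 2))) * b,
        Real.sin (s * (θ t * ψ (a ^ 2 + b ^ 2))) * a +
        Real.cos (s * (θ t * ψ (a ^ 2 + b ^ 2))) * b) := by
    intro s t a b hab
    by_cases hcase : a ^ 2 + b ^ 2 ≤ (r / 3) ^ 2
    · simp only [R]
      rw [hΘt t a b hab, hYt t a b hab, hZt t a b hab]
      simp only [hζ1 _ hcase, one_smul, tubeMap]
      module
    · have hz := hψ0 _ (not_le.mp hcase).le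
      rw [hRid s _ (by rw [hΘt t a b hab]; simp [hz])]
      simp [hz]
  refine ⟨R, r / 4, by positivity, by fun_prop, fun s x => ?_, fun x => by simp [R], ?_⟩
  · by_cases hx : x ∈ tube γ β r
    · obtain ⟨t, a, b, hab, rfl⟩ := hx
      rw [hRt s t a b hab, hRt (-s) _ _ _ (by rwa [rotation_sq]), rotation_sq]
      generalize θ t * ψ (a ^ 2 + b ^ 2) = φ
      rw [neg_mul, Real.cos_neg, Real.sin_neg]
      have := Real.cos_sq_add_sin_sq (s * φ)
      congr 3
      · linear_combination a * this
      · linear_combination b * this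
    · rw [hRid s x (hΘ0 x hx), hRid (-s) x (hΘ0 x hx)]
  · intro s t a b hab
    have hab' : a ^ 2 + b ^ 2 < r ^ 2 := hab.trans (by nlinarith)
    rw [hRt s t a b hab', hψ1 _ hab.le, mul_one]

/-- The normal plane of a framed curve can be turned by any periodic angle function, by an ambient
isotopy that fixes the curve. -/
theorem IsFramed.exists_rotation_isotopy {γ β : ℝ → E3} (h : IsFramed γ β) {θ : ℝ → ℝ}
    (hθ : ContDiff ℝ ∞ θ) (hθp : Function.Periodic θ 1) :
    ∃ H K : ℝ → E3 → E3, IsIsotopy (Set.range γ) H K ∧ ∀ t, fderiv ℝ (K 1) (γ t) (deriv γ t) = deriv γ t ∧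
      fderiv ℝ (K 1) (γ t) (β t) = rotated γ β (θ t) t ∧
      fderiv ℝ (K 1) (γ t) (binormal γ β t) = rotated γ β (θ t + Real.pi / 2) t := by
  obtain ⟨r, hr⟩ := h.exists_tubeRadius
  obtain ⟨R, ρ, hρ, hR, hinv, h0, hRt⟩ := exists_twist h hr hθ hθp
  have hγ0 : ∀ t, tubeMap γ β (t, 0, 0) = γ t := fun t => by simp [tubeMap]
  have hfix : ∀ s t, R s (γ t) = γ t := fun s t => by
    have := hRt s t 0 0 (by simpa using pow_pos hρ 2)
    simpa [hγ0] using this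
  have hsm : ContDiff ℝ ∞ (fun q : ℝ × E3 => R (-q.1) q.2) :=
    hR.comp (f := fun q : ℝ × E3 => (-q.1, q.2)) (contDiff_fst.neg.prodMk contDiff_snd)
  have hR1 : ContDiff ℝ ∞ (R 1) := hR.comp (f := fun x => (1, x)) (contDiff_const.prodMk contDiff_id)
  have hd : ∀ t, HasFDerivAt (R 1) (fderiv ℝ (R 1) (γ t)) (γ t) := fun t =>
    (hR1.differentiable (by simp) _).hasFDerivAt
  have hline : ∀ (t : ℝ) (u w : E3), (∀ᶠ τ in 𝓝 (0 : ℝ), R 1 (γ t + τ • u) = γ t + τ • w) →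
      fderiv ℝ (R 1) (γ t) u = w := fun t u w hev => by
    have d0 : ∀ u : E3, HasDerivAt (fun τ : ℝ => γ t + τ • u) u 0 := fun u => by
      simpa using ((hasDerivAt_id (0 : ℝ)).smul_const u).const_add (γ t)
    have d1 : HasDerivAt (fun τ : ℝ => R 1 (γ t + τ • u)) (fderiv ℝ (R 1) (γ t) u) 0 := by
      refine HasFDerivAt.comp_hasDerivAt (l := R 1) (0 : ℝ) ?_ (d0 u)
      simpa using hd t
    exact d1.unique ((d0 w).congr_of_eventuallyEq hev)
  have hsmall : ∀ᶠ τ in 𝓝 (0 : ℝ), τ ^ 2 < ρ ^ 2 :=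
    (continuous_pow 2).continuousAt.eventually (gt_mem_nhds (by simpa using pow_pos hρ 2))
  -- The twist serves as the inverse family: it is `K`, not `H`, that pulls tangent vectors back to
  -- the original surface.
  refine ⟨fun s => R (-s), R, ⟨hsm, hR, fun s x => by have := hinv (-s) x; rwa [neg_neg] at this,
    hinv, fun x => by simp only [neg_zero, h0], ?_⟩, fun t => ⟨?_, hline t _ _ ?_, hline t _ _ ?_⟩⟩
  · rintro s _ ⟨t, rfl⟩; exact hfix _ t
  · have d1 : HasDerivAt (fun t => R 1 (γ t)) (fderiv ℝ (R 1) (γ t) (deriv γ t)) t :=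
      (hd t).comp_hasDerivAt t (h.curve.hasDerivAt t)
    simp only [hfix] at d1
    exact d1.unique (h.curve.hasDerivAt t)
  · filter_upwards [hsmall] with τ hτ
    have := hRt 1 t τ 0 (by simpa using hτ)
    simp only [tubeMap, zero_smul, add_zero, mul_zero, sub_zero, one_mul] at this
    rw [this, rotated]
    module
  · filter_upwards [hsmall] with τ hτ
    have := hRt 1 t 0 τ (by simpa using hτ)
    simp only [tubeMap, zero_smul, add_zero, mul_zero, zero_sub, zero_add, one_mul] at this
    rw [this, rotated, Real.cos_add_pi_div_two, Real.sin_add_pi_div_two]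
    module

/-- `β` is normal to `F` along `γ`. -/
def IsNormalAlong (F : Set E3) (γ β : ℝ → E3) : Prop :=
  ∀ t, ∀ v ∈ tangentVectors F (γ t), inner ℝ (β t) v = 0

/-- A surface can be turned around a curve so that the given field becomes normal to it. -/
theorem exists_isotopy_normalAlong {F : Set E3} {γ β : ℝ → E3} (h : IsFramed γ β) {θ : ℝ → ℝ}
    (hθ : ContDiff ℝ ∞ θ) (hθp : Function.Periodic θ 1)
    (hν : IsNormalAlong F γ fun t => rotated γ β (θ t) t) :
    ∃ H K : ℝ → E3 → E3, IsIsotopy (Set.range γ) H K ∧ IsNormalAlong (H 1 '' F) γ β := by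
  obtain ⟨H, K, hI, hd⟩ := h.exists_rotation_isotopy hθ hθp
  refine ⟨H, K, hI, fun t v hv => ?_⟩
  have h1 := fderiv_mem_tangentVectors (hI.contDiff_inv 1) (hI.left_inv 1) hv
  rw [hI.inv_fixes 1 ⟨t, rfl⟩] at h1
  have h2 := hν t _ h1
  obtain ⟨d1, d2, d3⟩ := hd t
  have hT : fderiv ℝ (K 1) (γ t) (unitTangent γ t) = unitTangent γ t := by
    rw [unitTangent, map_smul, d1]
  rw [h.expand t v] at h2
  simp only [map_add, map_smul, hT, d2, d3, inner_add_right, inner_smul_right] at h2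
  have e1 : inner ℝ (rotated γ β (θ t) t) (unitTangent γ t) = 0 := by
    rw [unitTangent, inner_smul_right, h.rotated_normal, mul_zero]
  have e2 : inner ℝ (rotated γ β (θ t) t) (rotated γ β (θ t) t) = (1 : ℝ) := by
    rw [real_inner_self_eq_norm_sq, h.norm_rotated]; norm_num
  have e3 : inner ℝ (rotated γ β (θ t) t) (rotated γ β (θ t + Real.pi / 2) t) = (0 : ℝ) := by
    rw [rotated, rotated, Real.cos_add_pi_div_two, Real.sin_add_pi_div_two, inner_add_left,
      inner_smul_left, inner_smul_left, (h.inner_combination t _ _).1, (h.inner_combination t _ _).2]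
    simp; ring
  -- The derivative of `K 1` carries the frame `(T, β, κ)` to the one turned by `θ t`, so pairing
  -- with the old normal reads off `⟨β, v⟩`.
  rw [e1, e2, e3] at h2
  simpa using h2

/-! ### Small perturbations of the identity and shears -/

/-- A perturbation of the identity with Lipschitz constant `1 / 2` is bijective by the contraction
principle. -/
theorem bijective_id_add {φ : E3 → E3} (hφ : ContDiff ℝ ∞ φ) (hd : ∀ x, ‖fderiv ℝ φ x‖ ≤ 1 / 2) :
    Function.Bijective fun x => x + φ x := by
  have hlip : LipschitzWith (1 / 2) φ :=
    lipschitzWith_of_nnnorm_fderiv_le (hφ.differentiable (by simp)) fun x => by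
      rw [← NNReal.coe_le_coe]; simpa using hd x
  have happ : ApproximatesLinearOn (fun x => x + φ x)
      ((ContinuousLinearEquiv.refl ℝ E3 : E3 ≃L[ℝ] E3) : E3 →L[ℝ] E3) Set.univ (1 / 2) := by
    rw [ApproximatesLinearOn.approximatesLinearOn_iff_lipschitzOnWith, lipschitzOnWith_univ]
    convert! hlip using 1
    ext1 x; simp
  have hc : (1 / 2 : NNReal) <
      ‖(((ContinuousLinearEquiv.refl ℝ E3).symm : E3 ≃L[ℝ] E3) : E3 →L[ℝ] E3)‖₊⁻¹ := by
    rw [show (((ContinuousLinearEquiv.refl ℝ E3).symm : E3 ≃L[ℝ] E3) : E3 →L[ℝ] E3) =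
      ContinuousLinearMap.id ℝ E3 from rfl, ContinuousLinearMap.nnnorm_id, inv_one]
    exact NNReal.half_lt_self one_ne_zero
  exact ⟨Set.injOn_univ.mp (happ.injOn (Or.inr hc)), happ.surjective (Or.inr hc)⟩

theorem exists_isotopy_id_add {C : Set E3} {φ : E3 → E3} (hφ : ContDiff ℝ ∞ φ)
    (hd : ∀ x, ‖fderiv ℝ φ x‖ ≤ 1 / 2) (hC : ∀ x ∈ C, φ x = 0) :
    ∃ H K : ℝ → E3 → E3, IsIsotopy C H K ∧ ∀ x, H 1 x = x + φ x := by
  -- A time function bounded by `1` on the whole line, so that every `x + χ s • φ x` is bijective,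
  -- with `χ 0 = 0` and `χ 1 = 1`.
  let χ : ℝ → ℝ := fun s => Real.sin (Real.pi / 2 * s)
  have hχ : ContDiff ℝ ∞ χ := Real.contDiff_sin.comp (contDiff_const.mul contDiff_id)
  have hχ1 : ∀ s, |χ s| ≤ 1 := fun s => Real.abs_sin_le_one _
  have hdφ : ∀ x, HasFDerivAt φ (fderiv ℝ φ x) x := fun x => (hφ.differentiable (by simp) x).hasFDerivAt
  have hbij : ∀ s, Function.Bijective fun x => x + χ s • φ x := fun s => by
    refine bijective_id_add (φ := fun x => χ s • φ x) (hφ.const_smul (χ s)) fun x => ?_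
    rw [show (fun x => χ s • φ x) = χ s • φ from rfl, ((hdφ x).const_smul (χ s)).fderiv, norm_smul, Real.norm_eq_abs]
    have := mul_le_mul (hχ1 s) (hd x) (norm_nonneg _) zero_le_one
    linarith
  let e : ℝ → E3 ≃ E3 := fun s => Equiv.ofBijective _ (hbij s)
  -- The inverse must be smooth jointly in time and space, so the inverse function theorem is
  -- applied to the whole family at once.
  let f : ℝ × E3 → ℝ × E3 := fun q => (q.1, q.2 + χ q.1 • φ q.2)
  have hf : ContDiff ℝ ∞ f :=
    contDiff_fst.prodMk (contDiff_snd.add ((hχ.comp contDiff_fst).smul (hφ.comp contDiff_snd)))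
  have hfd : ∀ q v, fderiv ℝ f q v = 0 → v = 0 := by
    intro q v hv
    have h1 : HasFDerivAt (fun q : ℝ × E3 => q.2 + χ q.1 • φ q.2) _ q :=
      hasFDerivAt_snd.add (((hχ.differentiable (by simp) q.1).hasFDerivAt.comp q
        (hasFDerivAt_fst (𝕜 := ℝ) (p := q))).smul ((hdφ q.2).comp q (hasFDerivAt_snd (𝕜 := ℝ) (p := q))))
    have h2 : HasFDerivAt f _ q := (hasFDerivAt_fst (𝕜 := ℝ) (p := q)).prodMk h1
    rw [h2.fderiv] at hv
    have hv1 : v.1 = 0 := congrArg Prod.fst hv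
    have hv2 : v.2 + χ q.1 • fderiv ℝ φ q.2 v.2 = 0 := by
      have := congrArg Prod.snd hv
      simpa [hv1] using this
    have h3 : ‖v.2‖ ≤ 1 / 2 * ‖v.2‖ := by
      have h4 : v.2 = -(χ q.1 • fderiv ℝ φ q.2 v.2) := eq_neg_of_add_eq_zero_left hv2
      conv_lhs => rw [h4]
      rw [norm_neg, norm_smul, Real.norm_eq_abs]
      have h5 := (fderiv ℝ φ q.2).le_of_opNorm_le (hd q.2) v.2
      have h6 := mul_le_mul (hχ1 q.1) h5 (norm_nonneg _) zero_le_one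
      linarith
    have h4 : ‖v.2‖ = 0 := by linarith [norm_nonneg v.2]
    exact Prod.ext hv1 (norm_eq_zero.mp h4)
  refine ⟨fun s => e s, fun s => (e s).symm, ⟨hf.snd, ?_, fun s x => (e s).symm_apply_apply x,
    fun s x => (e s).apply_symm_apply x, fun x => ?_, fun s x hx => ?_⟩, fun x => ?_⟩
  · rw [contDiff_iff_contDiffAt]
    rintro ⟨s, y⟩
    obtain ⟨E, hE, hsrc, hsm⟩ := exists_smooth_local_inverse rfl (hf.contDiffAt (x := (s, (e s).symm y)))
      (hfd _)
    have hfy : f (s, (e s).symm y) = (s, y) := Prod.ext rfl ((e s).apply_symm_apply y)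
    rw [hfy] at hsm
    have htgt : (s, y) ∈ E.target := by
      rw [← hfy, ← hE]; exact E.map_source hsrc
    have heq : (fun q : ℝ × E3 => (e q.1).symm q.2) =ᶠ[𝓝 (s, y)] fun q => (E.symm q).2 := by
      filter_upwards [E.open_target.mem_nhds htgt] with q hq
      have h1 := E.right_inv hq
      rw [hE] at h1
      have h2 : (f (E.symm q)).1 = q.1 := by rw [h1]
      change (E.symm q).1 = q.1 at h2
      rw [Equiv.symm_apply_eq]
      have h3 : (f (E.symm q)).2 = q.2 := by rw [h1]
      change (E.symm q).2 + χ (E.symm q).1 • φ (E.symm q).2 = q.2 at h3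
      rw [h2] at h3
      exact h3.symm
    exact hsm.snd.congr_of_eventuallyEq heq
  · show x + χ 0 • φ x = x
    simp [χ]
  · show x + χ s • φ x = x
    rw [hC x hx, smul_zero, add_zero]
  · show x + χ 1 • φ x = x + φ x
    simp [χ]

theorem HasCompactSupport.exists_norm_bounds {V : Type*} [NormedAddCommGroup V] [NormedSpace ℝ V]
    {F : E3 → V} (hF : ContDiff ℝ ∞ F) (hc : HasCompactSupport F) :
    ∃ M, ∀ x, ‖F x‖ ≤ M ∧ ‖fderiv ℝ F x‖ ≤ M := by
  obtain ⟨M₁, h1⟩ := hc.exists_bound_of_continuous hF.continuous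
  obtain ⟨M₂, h2⟩ := (hc.fderiv (𝕜 := ℝ)).exists_bound_of_continuous (hF.continuous_fderiv (by simp))
  exact ⟨max M₁ M₂, fun x => ⟨(h1 x).trans (le_max_left _ _), (h2 x).trans (le_max_right _ _)⟩⟩

/-- There is an ambient isotopy that fixes a framed curve, is the identity to first order along it,
and shears the square of the second normal coordinate in the direction of the first one by a given
amount. -/
theorem IsFramed.exists_shear {γ β : ℝ → E3} (h : IsFramed γ β) {c : ℝ → ℝ} (hc : ContDiff ℝ ∞ c)
    (hcp : Function.Periodic c 1) :
    ∃ H K : ℝ → E3 → E3, IsIsotopy (Set.range γ) H K ∧ ∃ (b : E3 → ℝ) (w : E3 → E3), ContDiff ℝ ∞ b ∧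
      ContDiff ℝ ∞ w ∧ (∀ y, K 1 y = y - b y ^ 2 • w y) ∧ ∀ t, b (γ t) = 0 ∧
      (∀ v, fderiv ℝ b (γ t) v = inner ℝ (binormal γ β t) v) ∧ w (γ t) = c t • β t := by
  obtain ⟨r, hr⟩ := h.exists_tubeRadius
  have hr0 := hr.pos
  obtain ⟨ζ, hζ, hζ1, hζ0⟩ := exists_cutoff (a := (r / 3) ^ 2) (b := (r / 2) ^ 2) (by
    apply pow_lt_pow_left₀ _ (by positivity) two_ne_zero; linarith)
  have hβ := h.smooth
  obtain ⟨B, hB, hBc, hBt, -⟩ := hr.transfer h (G := fun q => ζ (q.2.1 ^ 2 + q.2.2 ^ 2) * q.2.2)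
    (by fun_prop) (fun t a b => rfl) (ρ := r / 2) (by linarith) (by positivity)
    (fun t a b hab => by rw [hζ0 _ hab, zero_mul])
  obtain ⟨W, hW, hWc, hWt, -⟩ := hr.transfer h
    (G := fun q => (ζ (q.2.1 ^ 2 + q.2.2 ^ 2) * c q.1) • β q.1) (by fun_prop)
    (fun t a b => by simp only [h.periodic t, hcp t]) (ρ := r / 2) (by linarith) (by positivity)
    (fun t a b hab => by rw [hζ0 _ hab, zero_mul, zero_smul])
  have hγ0 : ∀ t, tubeMap γ β (t, 0, 0) = γ t := fun t => by simp [tubeMap]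
  have hr2 : (0 : ℝ) ^ 2 + 0 ^ 2 < r ^ 2 := by simpa using pow_pos hr0 2
  have hBγ : ∀ t, B (γ t) = 0 := fun t => by rw [← hγ0, hBt _ _ _ hr2, mul_zero]
  have hWγ : ∀ t, W (γ t) = c t • β t := fun t => by
    rw [← hγ0, hWt _ _ _ hr2, hζ1 _ (by simpa using sq_nonneg (r / 3)), one_mul]
  have hBd : ∀ x, HasFDerivAt B (fderiv ℝ B x) x := fun x => (hB.differentiable (by simp) x).hasFDerivAt
  have hsmall : ∀ᶠ τ in 𝓝 (0 : ℝ), τ ^ 2 < (r / 3) ^ 2 :=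
    (continuous_pow 2).continuousAt.eventually
      (gt_mem_nhds (show (0 : ℝ) ^ 2 < (r / 3) ^ 2 by rw [zero_pow two_ne_zero]; positivity))
  have hr3 : (r / 3) ^ 2 < r ^ 2 := by nlinarith
  have hline : ∀ (t : ℝ) (u : E3) (x : ℝ), (∀ᶠ τ in 𝓝 (0 : ℝ), B (γ t + τ • u) = τ * x) →
      fderiv ℝ B (γ t) u = x := fun t u x hev => by
    have d0 : HasDerivAt (fun τ : ℝ => γ t + τ • u) u 0 := by
      simpa using ((hasDerivAt_id (0 : ℝ)).smul_const u).const_add (γ t)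
    have d1 : HasDerivAt (fun τ : ℝ => B (γ t + τ • u)) (fderiv ℝ B (γ t) u) 0 := by
      refine HasFDerivAt.comp_hasDerivAt (l := B) (0 : ℝ) ?_ d0
      simpa using hBd (γ t)
    have d2 : HasDerivAt (fun τ : ℝ => τ * x) x 0 := by simpa using (hasDerivAt_id (0 : ℝ)).mul_const x
    exact d1.unique (d2.congr_of_eventuallyEq hev)
  have hDB : ∀ t v, fderiv ℝ B (γ t) v = inner ℝ (binormal γ β t) v := fun t v => by
    have t1 : fderiv ℝ B (γ t) (deriv γ t) = 0 := by
      have d1 : HasDerivAt (fun t => B (γ t)) (fderiv ℝ B (γ t) (deriv γ t)) t :=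
        (hBd (γ t)).comp_hasDerivAt t (h.curve.hasDerivAt t)
      simp only [hBγ] at d1
      exact d1.unique (hasDerivAt_const t 0)
    have t2 : fderiv ℝ B (γ t) (β t) = 0 := by
      refine hline t _ 0 ?_
      filter_upwards [hsmall] with τ hτ
      have := hBt t τ 0 (by linarith)
      simp only [tubeMap, zero_smul, add_zero, mul_zero] at this
      rw [this, mul_zero]
    have t3 : fderiv ℝ B (γ t) (binormal γ β t) = 1 := by
      refine hline t _ 1 ?_
      filter_upwards [hsmall] with τ hτ
      have := hBt t 0 τ (by linarith)
      simp only [tubeMap, zero_smul, add_zero] at this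
      rw [this, hζ1 _ (by linarith)]; ring
    conv_lhs => rw [h.expand t v]
    rw [map_add, map_add, map_smul, map_smul, map_smul, t2, t3, unitTangent, map_smul, t1]
    simp
  obtain ⟨M₁, hM₁⟩ := HasCompactSupport.exists_norm_bounds hB hBc
  obtain ⟨M₂, hM₂⟩ := HasCompactSupport.exists_norm_bounds hW hWc
  obtain ⟨M, hM0, hM1, hM2⟩ : ∃ M : ℝ, 1 ≤ M ∧ M₁ ≤ M ∧ M₂ ≤ M :=
    ⟨max 1 (max M₁ M₂), le_max_left _ _, (le_max_left _ _).trans (le_max_right _ _),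
      (le_max_right _ _).trans (le_max_right _ _)⟩
  -- Replacing `B` by `S = ρ sin (B / ρ)` keeps its value and differential along `γ` but makes it of
  -- size `ρ`. The differential of `S ^ 2 • W` is then at most `2 ρ M² + ρ² M ≤ 3 / 8`.
  let ρ : ℝ := 1 / (8 * M ^ 2)
  have hρ : 0 < ρ := by positivity
  have hρM : ρ * M ^ 2 = 1 / 8 := by simp only [ρ]; field_simp
  let S : E3 → ℝ := fun x => ρ * Real.sin (B x / ρ)
  have hS : ContDiff ℝ ∞ S := contDiff_const.mul (Real.contDiff_sin.comp (hB.div_const ρ))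
  have hSd : ∀ x, HasFDerivAt S (Real.cos (B x / ρ) • fderiv ℝ B x) x := fun x => by
    have h1 := (((hBd x).mul_const ρ⁻¹).sin).const_mul ρ
    convert! h1 using 1
    rw [smul_smul, smul_smul]
    congr 1
    field_simp
  have hSb : ∀ x, |S x| ≤ ρ := fun x => by
    rw [abs_mul, abs_of_pos hρ]
    exact mul_le_of_le_one_right hρ.le (Real.abs_sin_le_one _)
  let φ : E3 → E3 := fun x => S x ^ 2 • W x
  have hφ : ContDiff ℝ ∞ φ := (hS.pow 2).smul hW
  have hφd : ∀ x, ‖fderiv ℝ φ x‖ ≤ 1 / 2 := fun x => by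
    have d1 : HasFDerivAt φ _ x := ((hSd x).pow 2).smul (hW.differentiable (by simp) x).hasFDerivAt
    rw [d1.fderiv]
    refine ContinuousLinearMap.opNorm_le_bound _ (by norm_num) fun v => ?_
    have hb1 : ‖fderiv ℝ B x v‖ ≤ M * ‖v‖ :=
      (fderiv ℝ B x).le_of_opNorm_le ((hM₁ x).2.trans hM1) v
    have hb2 : ‖fderiv ℝ W x v‖ ≤ M * ‖v‖ :=
      (fderiv ℝ W x).le_of_opNorm_le ((hM₂ x).2.trans hM2) v
    have hb3 : ‖W x‖ ≤ M := (hM₂ x).1.trans hM2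
    have hb4 : |Real.cos (B x / ρ)| ≤ 1 := Real.abs_cos_le_one _
    have hb5 : S x ^ 2 ≤ ρ ^ 2 := by rw [← sq_abs]; exact pow_le_pow_left₀ (abs_nonneg _) (hSb x) 2
    simp only [_root_.add_apply, _root_.smul_apply,
      ContinuousLinearMap.smulRight_apply, smul_eq_mul]
    refine (norm_add_le _ _).trans ?_
    rw [norm_smul, norm_smul, Real.norm_of_nonneg (sq_nonneg (S x))]
    simp only [norm_mul, Real.norm_eq_abs] at *
    have hv := norm_nonneg v
    have k1 : S x ^ 2 * ‖fderiv ℝ W x v‖ ≤ ρ ^ 2 * (M * ‖v‖) :=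
      mul_le_mul hb5 hb2 (norm_nonneg _) (by positivity)
    have k2 : |Real.cos (B x / ρ)| * |fderiv ℝ B x v| ≤ 1 * (M * ‖v‖) :=
      mul_le_mul hb4 hb1 (abs_nonneg _) zero_le_one
    have k3 : |S x| * (|Real.cos (B x / ρ)| * |fderiv ℝ B x v|) ≤ ρ * (1 * (M * ‖v‖)) :=
      mul_le_mul (hSb x) k2 (by positivity) hρ.le
    have k4 : |S x| * (|Real.cos (B x / ρ)| * |fderiv ℝ B x v|) * ‖W x‖ ≤ ρ * (1 * (M * ‖v‖)) * M :=
      mul_le_mul k3 hb3 (norm_nonneg _) (by positivity)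
    have k5 : ρ * (1 * (M * ‖v‖)) * M = 1 / 8 * ‖v‖ := by
      rw [← hρM]; ring
    have k6 : ρ ^ 2 * (M * ‖v‖) ≤ 1 / 8 * ‖v‖ := by
      rw [← hρM]
      have hρ1 : ρ ≤ M := by
        have : ρ ≤ ρ * M ^ 2 := le_mul_of_one_le_right hρ.le (one_le_pow₀ hM0)
        linarith
      have : ρ * ρ * M * ‖v‖ ≤ ρ * M * M * ‖v‖ := by gcongr
      nlinarith
    norm_num
    nlinarith
  have hφγ : ∀ x ∈ Set.range γ, φ x = 0 := by
    rintro _ ⟨t, rfl⟩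
    simp [φ, S, hBγ]
  obtain ⟨H, K, hI, hH1⟩ := exists_isotopy_id_add hφ hφd hφγ
  have hK1 := hI.contDiff_inv 1
  have hKγ : ∀ t, K 1 (γ t) = γ t := fun t => hI.inv_fixes 1 ⟨t, rfl⟩
  have hKf : ∀ y, K 1 y = y - S (K 1 y) ^ 2 • W (K 1 y) := fun y => by
    have h1 := hH1 (K 1 y)
    rw [hI.right_inv] at h1
    exact eq_sub_of_add_eq h1.symm
  have hbγ : ∀ t, S (K 1 (γ t)) = 0 := fun t => by rw [hKγ]; simp [S, hBγ]
  have hbc : ContDiff ℝ ∞ fun y => S (K 1 y) := hS.comp hK1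
  have hwc : ContDiff ℝ ∞ fun y => W (K 1 y) := hW.comp hK1
  -- Solving `H 1 x = x + S x ^ 2 • W x` for `x = K 1 y` gives the displayed formula with `b` and
  -- `w` composed with `K 1`. As `K 1` is tangent to the identity along `γ`, the first-order data
  -- are unchanged.
  refine ⟨H, K, hI, fun y => S (K 1 y), fun y => W (K 1 y), hbc, hwc, hKf, fun t => ⟨hbγ t, fun v => ?_,
    by simp only [hKγ, hWγ]⟩⟩
  have hdK : HasFDerivAt (K 1) (ContinuousLinearMap.id ℝ E3) (γ t) := by
    have d1 := (hasFDerivAt_id (𝕜 := ℝ) (γ t)).sub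
      (((hbc.differentiable (by simp) (γ t)).hasFDerivAt.pow 2).smul
        (hwc.differentiable (by simp) (γ t)).hasFDerivAt)
    rw [show K 1 = fun y => y - S (K 1 y) ^ 2 • W (K 1 y) from funext hKf]
    convert! d1 using 1
    ext1 v
    simp [hbγ]
  have d2 : HasFDerivAt (fun y => S (K 1 y)) _ (γ t) :=
    HasFDerivAt.comp (g := S) (γ t) (hSd (K 1 (γ t))) hdK
  rw [d2.fderiv, hKγ, hBγ]
  simp [hDB]

/-! ### Vertical derivatives along a curve with a horizontal normal -/

theorem contDiffAt_dz {g : E3 → ℝ} {p : E3} (hg : ContDiffAt ℝ ∞ g p) : ContDiffAt ℝ ∞ (dz g) p := by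
  have : ContDiffAt ℝ ∞ (fderiv ℝ g) p := hg.fderiv_right (by simp)
  exact this.clm_apply contDiffAt_const

theorem hasFDerivAt_fderiv_apply {g : E3 → ℝ} {p : E3} (hg : ContDiffAt ℝ ∞ g p) (a : E3) :
    HasFDerivAt (fun x => fderiv ℝ g x a) ((fderiv ℝ (fderiv ℝ g) p).flip a) p := by
  have h1 : ContDiffAt ℝ ∞ (fderiv ℝ g) p := hg.fderiv_right (by simp)
  have h2 := (h1.differentiableAt (by simp)).hasFDerivAt.clm_apply (hasFDerivAt_const a p)
  convert! h2 using 1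
  ext v; simp

theorem fderiv_dz {g : E3 → ℝ} {p : E3} (hg : ContDiffAt ℝ ∞ g p) (v : E3) :
    fderiv ℝ (dz g) p v = fderiv ℝ (fderiv ℝ g) p e3 v := by
  rw [show dz g = fun x => fderiv ℝ g x e3 from rfl, (hasFDerivAt_fderiv_apply hg e3).fderiv,
    ContinuousLinearMap.flip_apply]
  exact hg.isSymmSndFDerivAt (by rw [minSmoothness_of_isRCLikeNormedField]; exact WithTop.coe_le_coe.mpr (le_top : (2 : ℕ∞) ≤ ⊤)) v e3

theorem IsLocalEquation.neg {F : Set E3} {p : E3} {g : E3 → ℝ} (h : IsLocalEquation F p g) :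
    IsLocalEquation F p fun x => -g x := by
  obtain ⟨U, hU, hp, hg, hd, hmem⟩ := h
  refine ⟨U, hU, hp, hg.neg, fun x hx => ?_, fun x hx => ?_⟩
  · rw [fderiv_fun_neg]; exact neg_ne_zero.mpr (hd x hx)
  · rw [hmem x hx, neg_eq_zero]

/-- The differential of any local equation is a multiple of `⟨β, ·⟩`; the factor `ρ = dg(β)` is the
density by which local equations differ. -/
theorem IsNormalAlong.fderiv_eq {F : Set E3} {γ β : ℝ → E3} (hn : IsNormalAlong F γ β) {t : ℝ}
    (hβ : ‖β t‖ = 1) (ht : γ t ∈ F) {g : E3 → ℝ} (hg : IsLocalEquation F (γ t) g) (v : E3) :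
    fderiv ℝ g (γ t) v = fderiv ℝ g (γ t) (β t) * inner ℝ (β t) v := by
  rw [← inner_gradient g _ v, gradient_eq_smul_of_normal ht hβ (hn t) hg, inner_smul_left,
    real_inner_comm, inner_gradient]
  simp

theorem IsNormalAlong.fderiv_ne {F : Set E3} {γ β : ℝ → E3} (hn : IsNormalAlong F γ β) {t : ℝ}
    (hβ : ‖β t‖ = 1) (ht : γ t ∈ F) {g : E3 → ℝ} (hg : IsLocalEquation F (γ t) g) :
    fderiv ℝ g (γ t) (β t) ≠ 0 := fun h0 =>
  hg.fderiv_ne (ContinuousLinearMap.ext fun v => by rw [hn.fderiv_eq hβ ht hg, h0, zero_mul]; rfl)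

/-- `γ` is a closed curve on the surface `F`, and the horizontal field `β` is normal to `F` along
it. -/
structure IsVerticalStrip (F : Set E3) (γ β : ℝ → E3) : Prop where
  surface : IsSmoothSurface F
  framed : IsFramed γ β
  horizontal : ∀ t, β t 2 = 0
  mem : ∀ t, γ t ∈ F
  normal : IsNormalAlong F γ β

namespace IsVerticalStrip

variable {F : Set E3} {γ β : ℝ → E3} (h : IsVerticalStrip F γ β)
include h

theorem fderiv_eq {t : ℝ} {g : E3 → ℝ} (hg : IsLocalEquation F (γ t) g) (v : E3) :
    fderiv ℝ g (γ t) v = fderiv ℝ g (γ t) (β t) * inner ℝ (β t) v :=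
  h.normal.fderiv_eq (h.framed.norm_eq_one t) (h.mem t) hg v

theorem dz_eq_zero {t : ℝ} {g : E3 → ℝ} (hg : IsLocalEquation F (γ t) g) : dz g (γ t) = 0 := by
  rw [dz, h.fderiv_eq hg, inner_e3, h.horizontal, mul_zero]

theorem eventually {t₀ : ℝ} {g : E3 → ℝ} (hg : IsLocalEquation F (γ t₀) g) :
    ∀ᶠ t in 𝓝 t₀, IsLocalEquation F (γ t) g :=
  h.framed.curve.smooth.continuous.continuousAt.eventually hg.eventually

theorem contDiffAt_density {t₀ : ℝ} {g : E3 → ℝ} (hg : IsLocalEquation F (γ t₀) g) :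
    ContDiffAt ℝ ∞ (fun t => fderiv ℝ g (γ t) (β t)) t₀ := by
  have h1 : ContDiffAt ℝ ∞ (fderiv ℝ g) (γ t₀) := hg.contDiffAt.fderiv_right (by simp)
  exact (h1.comp t₀ h.framed.curve.smooth.contDiffAt).clm_apply h.framed.smooth.contDiffAt

theorem exists_positive_equation (t₀ : ℝ) :
    ∃ g, IsLocalEquation F (γ t₀) g ∧ ∀ᶠ t in 𝓝 t₀, 0 < fderiv ℝ g (γ t) (β t) := by
  obtain ⟨g, hg⟩ := h.surface _ (h.mem t₀)
  rcases lt_or_gt_of_ne (h.normal.fderiv_ne (h.framed.norm_eq_one t₀) (h.mem t₀) hg) with h0 | h0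
  · refine ⟨_, hg.neg, (h.contDiffAt_density hg.neg).continuousAt.eventually_const_lt ?_⟩
    beta_reduce
    rw [fderiv_fun_neg]
    simpa using h0
  · exact ⟨g, hg, (h.contDiffAt_density hg).continuousAt.eventually_const_lt h0⟩

/-- At a point where `γ` is vertical, the derivatives of a local equation are determined by those of
the curve. -/
theorem derivatives_of_vertical {t₀ : ℝ} (hv : IsVerticalAt γ t₀) {g : E3 → ℝ}
    (hg : IsLocalEquation F (γ t₀) g) :
    dz (dz g) (γ t₀) = 0 ∧
    HasDerivAt (fun t => dz (dz g) (γ t)) (deriv γ t₀ 2 * dz (dz (dz g)) (γ t₀)) t₀ ∧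
    fderiv ℝ (dz g) (γ t₀) (deriv (deriv γ) t₀) = -(deriv γ t₀ 2 ^ 2 * dz (dz (dz g)) (γ t₀)) ∧
    2 * deriv γ t₀ 2 * fderiv ℝ (dz g) (γ t₀) (deriv (deriv γ) t₀) =
      -(fderiv ℝ g (γ t₀) (β t₀) * inner ℝ (β t₀) (deriv (deriv (deriv γ)) t₀)) ∧
    inner ℝ (β t₀) (deriv (deriv γ) t₀) = 0 := by
  have hc := h.framed.curve
  have hβd : ∀ t, HasDerivAt β (deriv β t) t := fun t =>
    (h.framed.smooth.differentiable (by simp) t).hasDerivAt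
  have hβ2 : ContDiff ℝ ∞ (deriv β) := (contDiff_infty_iff_deriv.mp h.framed.smooth).2
  have hβd2 : HasDerivAt (deriv β) (deriv (deriv β) t₀) t₀ := (hβ2.differentiable (by simp) t₀).hasDerivAt
  have hd3 : HasDerivAt (deriv (deriv γ)) (deriv (deriv (deriv γ)) t₀) t₀ :=
    (hc.contDiff_deriv_two.differentiable (by simp) t₀).hasDerivAt
  set z := deriv γ t₀ 2 with hz
  have hγ' : deriv γ t₀ = z • e3 := ext_coords (by simp [hv.1]) (by simp [hv.2]) (by simp [hz])
  have hz0 : z ≠ 0 := fun h0 => hc.regular t₀ (by rw [hγ', h0, zero_smul])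
  have hev := h.eventually hg
  have hgp := hg.contDiffAt
  have hS := contDiffAt_dz hgp
  have hQ := contDiffAt_dz hS
  have hββ' : ∀ t, deriv β t 2 = 0 := fun t => by
    have h1 := hasDerivAt_coord (hβd t) 2
    simp only [h.horizontal] at h1
    exact h1.unique (hasDerivAt_const t 0)
  have hββ'' : deriv (deriv β) t₀ 2 = 0 := by
    have h1 := hasDerivAt_coord hβd2 2
    simp only [hββ'] at h1
    exact h1.unique (hasDerivAt_const t₀ 0)
  -- the relation `⟨β, γ'⟩ = 0`
  have hn1 : ∀ t, inner ℝ (β t) (deriv (deriv γ) t) + inner ℝ (deriv β t) (deriv γ t) = 0 := fun t => by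
    have h1 := (hβd t).inner ℝ (hc.hasDerivAt_deriv t)
    simp only [h.framed.normal] at h1
    exact h1.unique (hasDerivAt_const t 0)
  have hn2 : inner ℝ (β t₀) (deriv (deriv (deriv γ)) t₀) +
      2 * inner ℝ (deriv β t₀) (deriv (deriv γ) t₀) = 0 := by
    have h1 := ((hβd t₀).inner ℝ hd3).add (hβd2.inner ℝ (hc.hasDerivAt_deriv t₀))
    have h2 := (h1.congr_of_eventuallyEq (f₁ := fun _ => (0 : ℝ))
      (Eventually.of_forall fun t => (hn1 t).symm)).unique (hasDerivAt_const t₀ 0)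
    have h3 : inner ℝ (deriv (deriv β) t₀) (deriv γ t₀) = 0 := by
      rw [hγ', inner_smul_right, inner_e3, hββ'', mul_zero]
    rw [h3] at h2
    linarith
  have ha : inner ℝ (β t₀) (deriv (deriv γ) t₀) = 0 := by
    have h1 := hn1 t₀
    rwa [hγ', inner_smul_right, inner_e3, hββ', mul_zero, add_zero] at h1
  -- the relation `g_z = 0` along the curve
  have hSγ : ∀ᶠ t in 𝓝 t₀, fderiv ℝ (dz g) (γ t) (deriv γ t) = 0 := by
    have hev1 : ∀ᶠ t in 𝓝 t₀, dz g (γ t) = 0 := hev.mono fun t ht => h.dz_eq_zero ht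
    filter_upwards [hev1.eventually_nhds, hev] with t ht hgt
    have h1 : HasDerivAt (fun t => dz g (γ t)) (fderiv ℝ (dz g) (γ t) (deriv γ t)) t :=
      ((contDiffAt_dz hgt.contDiffAt).differentiableAt (by simp)).hasFDerivAt.comp_hasDerivAt t
        (hc.hasDerivAt t)
    exact (h1.congr_of_eventuallyEq (f₁ := fun _ => (0 : ℝ)) (ht.mono fun _ hx => hx.symm)).unique
      (hasDerivAt_const t 0)
  -- The function `g_z` is constant along `γ`, and `γ'` is a nonzero multiple of `e3` here, so the
  -- derivative of `g_z` in the direction `e3` vanishes.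
  have hQ0 : dz (dz g) (γ t₀) = 0 := by
    have h1 := hSγ.self_of_nhds
    rw [hγ', map_smul, smul_eq_mul] at h1
    exact (mul_eq_zero.mp h1).resolve_left hz0
  have hf : HasDerivAt (fun t => dz (dz g) (γ t)) (z * dz (dz (dz g)) (γ t₀)) t₀ := by
    have h1 : HasDerivAt (fun t => dz (dz g) (γ t)) (fderiv ℝ (dz (dz g)) (γ t₀) (deriv γ t₀)) t₀ :=
      (hQ.differentiableAt (by simp)).hasFDerivAt.comp_hasDerivAt t₀ (hc.hasDerivAt t₀)
    rwa [hγ', map_smul, smul_eq_mul] at h1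
  refine ⟨hQ0, hf, ?_, ?_, ha⟩
  · have h1 : HasDerivAt (fun t => fderiv ℝ (dz g) (γ t)) (fderiv ℝ (fderiv ℝ (dz g)) (γ t₀) (deriv γ t₀))
        t₀ := ((hS.fderiv_right (m := ∞) (by simp)).differentiableAt
          (by simp)).hasFDerivAt.comp_hasDerivAt t₀ (hc.hasDerivAt t₀)
    have h2 := ((h1.clm_apply (hc.hasDerivAt_deriv t₀)).congr_of_eventuallyEq (f₁ := fun _ => (0 : ℝ))
      (hSγ.mono fun _ hx => hx.symm)).unique (hasDerivAt_const t₀ 0)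
    have h3 : fderiv ℝ (fderiv ℝ (dz g)) (γ t₀) (deriv γ t₀) (deriv γ t₀) =
        z ^ 2 * dz (dz (dz g)) (γ t₀) := by
      rw [hγ', map_smul, map_smul, _root_.smul_apply, ← fderiv_dz hS, smul_eq_mul, smul_eq_mul]
      rw [dz]; ring
    rw [h3] at h2
    linarith
  · have h1 : HasDerivAt (fun t => fderiv ℝ g (γ t) (deriv (deriv γ) t₀))
        (z * fderiv ℝ (dz g) (γ t₀) (deriv (deriv γ) t₀)) t₀ := by
      have h2 := (hasFDerivAt_fderiv_apply hgp (deriv (deriv γ) t₀)).comp_hasDerivAt t₀ (hc.hasDerivAt t₀)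
      convert! h2 using 1
      rw [fderiv_dz hgp, hγ', map_smul, ContinuousLinearMap.flip_apply, smul_eq_mul]
    have h2 := ((h.contDiffAt_density hg).differentiableAt (by simp)).hasDerivAt.mul
      ((hβd t₀).inner ℝ (hasDerivAt_const t₀ (deriv (deriv γ) t₀)))
    have h3 := h1.unique (h2.congr_of_eventuallyEq (hev.mono fun t ht => h.fderiv_eq ht _))
    rw [ha, inner_zero_right] at h3
    linear_combination 2 * h3 + fderiv ℝ g (γ t₀) (β t₀) * hn2

/-- The sign of the third vertical derivative at a cusp is governed by the chirality. -/
theorem cuspDet_mul {t₀ : ℝ} (hv : IsVerticalAt γ t₀) {g : E3 → ℝ}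
    (hg : IsLocalEquation F (γ t₀) g) :
    fderiv ℝ g (γ t₀) (β t₀) * cuspDet γ t₀ = 2 * deriv γ t₀ 2 ^ 3 * dz (dz (dz g)) (γ t₀) *
      (deriv (deriv γ) t₀ 0 * β t₀ 1 - deriv (deriv γ) t₀ 1 * β t₀ 0) := by
  obtain ⟨-, -, h1, h2, h3⟩ := h.derivatives_of_vertical hv hg
  have hβ := norm_sq_eq_coords (β t₀)
  rw [h.framed.norm_eq_one, h.horizontal] at hβ
  rw [inner_eq_coords, h.horizontal] at h2 h3
  rw [h1] at h2
  rw [cuspDet_eq]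
  set a := deriv (deriv γ) t₀
  set b := deriv (deriv (deriv γ)) t₀
  set ρ := fderiv ℝ g (γ t₀) (β t₀)
  linear_combination (a 0 * β t₀ 1 - a 1 * β t₀ 0) * h2 + ρ * (a 0 * b 1 - a 1 * b 0) * hβ +
    ρ * (β t₀ 0 * b 1 - β t₀ 1 * b 0) * h3

/-- By `cuspDet_mul` neither `g_zzz` nor the vertical speed can vanish. The vector `γ''` separates
the two differentials: `dg` kills it and `d(g_z)` does not. -/
theorem isCuspPoint {t₀ : ℝ} (hv : IsVerticalAt γ t₀) (hdet : cuspDet γ t₀ ≠ 0) {g : E3 → ℝ}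
    (hg : IsLocalEquation F (γ t₀) g) :
    dz (dz g) (γ t₀) = 0 ∧ dz (dz (dz g)) (γ t₀) ≠ 0 ∧
      LinearIndependent ℝ ![fderiv ℝ g (γ t₀), fderiv ℝ (dz g) (γ t₀)] := by
  obtain ⟨h0, -, h1, -, h3⟩ := h.derivatives_of_vertical hv hg
  have hρ := h.normal.fderiv_ne (h.framed.norm_eq_one t₀) (h.mem t₀) hg
  have h4 := h.cuspDet_mul hv hg
  have h5 : dz (dz (dz g)) (γ t₀) ≠ 0 := fun h0 => by
    rw [h0, mul_zero, zero_mul] at h4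
    exact mul_ne_zero hρ hdet h4
  have h6 : deriv γ t₀ 2 ≠ 0 := fun h0 => by
    rw [h0, zero_pow three_ne_zero, mul_zero, zero_mul, zero_mul] at h4
    exact mul_ne_zero hρ hdet h4
  refine ⟨h0, h5, LinearIndependent.pair_iff.mpr fun s r hsr => ?_⟩
  have h7 := DFunLike.congr_fun hsr (deriv (deriv γ) t₀)
  rw [_root_.add_apply, _root_.smul_apply, _root_.smul_apply,
    h.fderiv_eq hg, h3, h1] at h7
  have hr : r = 0 := by
    simp only [mul_zero, zero_add, smul_eq_mul, _root_.zero_apply] at h7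
    exact (mul_eq_zero.mp h7).resolve_right (neg_ne_zero.mpr (mul_ne_zero (pow_ne_zero 2 h6) h5))
  rw [hr, zero_smul, add_zero] at hsr
  exact ⟨(smul_eq_zero.mp hsr).resolve_right hg.fderiv_ne, hr⟩

end IsVerticalStrip

/-! ### Making the contour generic -/

/-- The product of the two difference quotients tends to `f' * k' > 0`, and it differs from `f * k`
by the factor `(t - t₀) ^ 2`. -/
theorem eventually_mul_nonneg_of_simple_zeros {f k : ℝ → ℝ} {f' k' t₀ : ℝ} (hf : HasDerivAt f f' t₀)
    (hk : HasDerivAt k k' t₀) (hf0 : f t₀ = 0) (hk0 : k t₀ = 0) (h : 0 < f' * k') :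
    ∀ᶠ t in 𝓝 t₀, 0 ≤ f t * k t := by
  rw [hasDerivAt_iff_tendsto_slope] at hf hk
  have h1 := (hf.mul hk).eventually_const_lt h
  rw [eventually_nhdsWithin_iff] at h1
  filter_upwards [h1] with t ht
  rcases eq_or_ne t t₀ with rfl | hne
  · rw [hf0, zero_mul]
  · have h2 := ht hne
    rw [slope_def_field, slope_def_field, hf0, hk0, sub_zero, sub_zero, div_mul_div_comm] at h2
    have h3 : 0 < (t - t₀) * (t - t₀) := mul_self_pos.mpr (sub_ne_zero.mpr hne)
    exact ((div_pos_iff_of_pos_right h3).mp h2).le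

/-- With `β` horizontal, the vertical component of the binormal is, up to sign, the horizontal speed
of `γ` divided by its speed. It is a smooth function that vanishes exactly at the vertical points.
-/
theorem binormal_two_sq {γ β : ℝ → E3} (h : IsFramed γ β) {t : ℝ} (hβ : β t 2 = 0) :
    ‖deriv γ t‖ ^ 2 * binormal γ β t 2 ^ 2 = deriv γ t 0 ^ 2 + deriv γ t 1 ^ 2 := by
  have h1 := norm_sq_eq_coords (β t)
  rw [h.norm_eq_one, hβ] at h1
  have h2 := h.normal t
  rw [inner_eq_coords, hβ] at h2
  have h3 : ‖deriv γ t‖ * binormal γ β t 2 = deriv γ t 0 * β t 1 - deriv γ t 1 * β t 0 := by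
    have := h.norm_deriv_pos t
    rw [binormal, cross_two, unitTangent]
    simp
    field_simp
  rw [← mul_pow, h3]
  linear_combination (-(deriv γ t 0 ^ 2 + deriv γ t 1 ^ 2)) * h1 -
    (β t 0 * deriv γ t 0 + β t 1 * deriv γ t 1) * h2

theorem binormal_two_eq_zero_iff {γ β : ℝ → E3} (h : IsFramed γ β) {t : ℝ} (hβ : β t 2 = 0) :
    binormal γ β t 2 = 0 ↔ IsVerticalAt γ t := by
  have h1 := binormal_two_sq h hβ
  have h2 := h.norm_deriv_pos t
  constructor
  · intro h0
    rw [h0] at h1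
    constructor <;> nlinarith [sq_nonneg (deriv γ t 0), sq_nonneg (deriv γ t 1)]
  · rintro ⟨h3, h4⟩
    rw [h3, h4] at h1
    have h5 : binormal γ β t 2 ^ 2 = 0 := by
      refine (mul_eq_zero.mp (h1.trans (by ring))).resolve_left (by positivity)
    exact pow_eq_zero_iff two_ne_zero |>.mp h5

namespace IsVerticalStrip

variable {F : Set E3} {γ β : ℝ → E3} (h : IsVerticalStrip F γ β)
include h

/-- Near a cusp both `g_zz` and the binormal height vanish, and their derivatives have a sign
relation fixed by the chirality, so any positive `Λ` works. Elsewhere the height is nonzero and a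
large `Λ` wins. -/
theorem exists_local_bound {χ : ℝ} (hχ : ∀ t, IsVerticalAt γ t → 0 < χ * cuspDet γ t) (t₀ : ℝ) :
    ∃ g Λ₀, ∀ᶠ t in 𝓝 t₀, IsLocalEquation F (γ t) g ∧ 0 < fderiv ℝ g (γ t) (β t) ∧
      ∀ Λ, Λ₀ ≤ Λ → binormal γ β t 2 ≠ 0 →
        0 < χ * binormal γ β t 2 * dz (dz g) (γ t) +
          2 * Λ * binormal γ β t 2 ^ 4 * fderiv ℝ g (γ t) (β t) := by
  obtain ⟨g, hg, hpos⟩ := h.exists_positive_equation t₀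
  have hev := h.eventually hg
  set e : ℝ → ℝ := fun t => binormal γ β t 2 with he
  have hec : ContDiff ℝ ∞ e := ContDiff.coord h.framed.contDiff_binormal 2
  set ρ : ℝ → ℝ := fun t => fderiv ℝ g (γ t) (β t) with hρ
  by_cases hv : IsVerticalAt γ t₀
  · refine ⟨g, 1, ?_⟩
    obtain ⟨h0, h1, -⟩ := h.derivatives_of_vertical hv hg
    have hcd := h.cuspDet_mul hv hg
    let k : ℝ → ℝ := fun t => deriv γ t 0 * β t 1 - deriv γ t 1 * β t 0
    have hk : HasDerivAt k (deriv (deriv γ) t₀ 0 * β t₀ 1 - deriv (deriv γ) t₀ 1 * β t₀ 0) t₀ := by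
      have d0 := h.framed.curve.hasDerivAt_deriv t₀
      have d1 := (h.framed.smooth.differentiable (by simp) t₀).hasDerivAt
      have := ((hasDerivAt_coord d0 0).mul (hasDerivAt_coord d1 1)).sub
        ((hasDerivAt_coord d0 1).mul (hasDerivAt_coord d1 0))
      convert! this using 1
      rw [hv.1, hv.2]; ring
    have hk0 : k t₀ = 0 := by simp only [k, hv.1, hv.2]; ring
    have hek : ∀ t, e t = ‖deriv γ t‖⁻¹ * k t := fun t => by
      simp only [he, k, binormal, cross_two, unitTangent, PiLp.smul_apply, smul_eq_mul]; ring
    -- Up to the positive factor `2 γ'_z ^ 2`, this product of the derivatives of `g_zz` and `χ k`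
    -- is `ρ χ cuspDet`, by `cuspDet_mul`.
    have hsign : 0 < deriv γ t₀ 2 * dz (dz (dz g)) (γ t₀) *
        (χ * (deriv (deriv γ) t₀ 0 * β t₀ 1 - deriv (deriv γ) t₀ 1 * β t₀ 0)) := by
      have h2 := mul_pos hpos.self_of_nhds (hχ t₀ hv)
      have hz : deriv γ t₀ 2 ≠ 0 := fun hz => by
        rw [hz] at hcd
        have : 0 = fderiv ℝ g (γ t₀) (β t₀) * (χ * cuspDet γ t₀) := by
          linear_combination (-χ) * hcd
        exact h2.ne this
      have h3 : 0 < 2 * deriv γ t₀ 2 ^ 2 := by positivity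
      refine pos_of_mul_pos_right (a := 2 * deriv γ t₀ 2 ^ 2) ?_ h3.le
      convert! h2 using 1
      linear_combination (-χ) * hcd
    have hnn := eventually_mul_nonneg_of_simple_zeros h1 (hk.const_mul χ) h0
      (by simp only [hk0, mul_zero]) hsign
    filter_upwards [hev, hpos, hnn] with t htg htρ htn
    refine ⟨htg, htρ, fun Λ hΛ het => ?_⟩
    have k1 : 0 ≤ χ * e t * dz (dz g) (γ t) := by
      rw [hek]
      have := mul_nonneg (inv_nonneg.mpr (norm_nonneg (deriv γ t))) htn
      linarith
    have k2 : 0 < e t ^ 4 := by positivity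
    have k3 : 0 < 2 * Λ * e t ^ 4 * ρ t := by positivity
    exact add_pos_of_nonneg_of_pos k1 k3
  · have he0 : e t₀ ≠ 0 := fun h0 =>
      hv ((binormal_two_eq_zero_iff h.framed (h.horizontal t₀)).mp h0)
    have hρ0 : 0 < ρ t₀ := hpos.self_of_nhds
    have he4 : 0 < e t₀ ^ 4 := by positivity
    set A := χ * e t₀ * dz (dz g) (γ t₀) with hA
    have hΛ₀ : ∃ Λ₀, 0 < A + 2 * Λ₀ * e t₀ ^ 4 * ρ t₀ := by
      refine ⟨(1 - A) / (2 * e t₀ ^ 4 * ρ t₀), ?_⟩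
      have : A + 2 * ((1 - A) / (2 * e t₀ ^ 4 * ρ t₀)) * e t₀ ^ 4 * ρ t₀ = 1 := by
        field_simp; ring
      rw [this]; exact one_pos
    obtain ⟨Λ₀, hΛ₀⟩ := hΛ₀
    refine ⟨g, Λ₀, ?_⟩
    have hcont : ContinuousAt (fun t => χ * e t * dz (dz g) (γ t) + 2 * Λ₀ * e t ^ 4 * ρ t) t₀ := by
      have c1 : ContinuousAt e t₀ := hec.continuous.continuousAt
      have c2 : ContinuousAt (fun t => dz (dz g) (γ t)) t₀ :=
        ContinuousAt.comp (contDiffAt_dz (contDiffAt_dz hg.contDiffAt)).continuousAt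
          h.framed.curve.smooth.continuous.continuousAt
      have c3 : ContinuousAt ρ t₀ := (h.contDiffAt_density hg).continuousAt
      exact ((continuousAt_const.mul c1).mul c2).add ((continuousAt_const.mul (c1.pow 4)).mul c3)
    filter_upwards [hev, hpos, hcont.eventually_const_lt hΛ₀] with t htg htρ htn
    refine ⟨htg, htρ, fun Λ hΛ het => htn.trans_le ?_⟩
    have k2 : 0 ≤ e t ^ 4 * ρ t := mul_nonneg (by positivity) htρ.le
    have k3 : 0 ≤ (Λ - Λ₀) * (e t ^ 4 * ρ t) := mul_nonneg (sub_nonneg.mpr hΛ) k2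
    show _ ≤ χ * e t * dz (dz g) (γ t) + 2 * Λ * e t ^ 4 * ρ t
    linarith

/-- Compactness of a period gives one `Λ` for the whole curve. The set property carries a threshold
`Λ₀`, as only an upward closed condition survives finite unions. -/
theorem exists_bound {χ : ℝ} (hχ : ∀ t, IsVerticalAt γ t → 0 < χ * cuspDet γ t) :
    ∃ Λ, ∀ t, ∃ g, IsLocalEquation F (γ t) g ∧ (binormal γ β t 2 ≠ 0 →
      0 < χ * binormal γ β t 2 * dz (dz g) (γ t) +
        2 * Λ * binormal γ β t 2 ^ 4 * fderiv ℝ g (γ t) (β t)) := by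
  have key : ∃ Λ₀ : ℝ, ∀ Λ, Λ₀ ≤ Λ → ∀ t ∈ Set.Icc (0 : ℝ) 1, ∃ g, IsLocalEquation F (γ t) g ∧
      (binormal γ β t 2 ≠ 0 → 0 < χ * binormal γ β t 2 * dz (dz g) (γ t) +
        2 * Λ * binormal γ β t 2 ^ 4 * fderiv ℝ g (γ t) (β t)) := by
    refine isCompact_Icc.induction_on (p := fun s => ∃ Λ₀ : ℝ, ∀ Λ, Λ₀ ≤ Λ → ∀ t ∈ s, ∃ g,
      IsLocalEquation F (γ t) g ∧ (binormal γ β t 2 ≠ 0 → 0 < χ * binormal γ β t 2 * dz (dz g) (γ t) +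
        2 * Λ * binormal γ β t 2 ^ 4 * fderiv ℝ g (γ t) (β t))) ⟨0, by simp⟩ ?_ ?_ ?_
    · rintro s s' hss ⟨Λ₀, hΛ⟩
      exact ⟨Λ₀, fun Λ hl t ht => hΛ Λ hl t (hss ht)⟩
    · rintro s s' ⟨Λ₀, hΛ⟩ ⟨Λ₁, hΛ'⟩
      refine ⟨max Λ₀ Λ₁, fun Λ hl t ht => ht.elim (hΛ Λ ((le_max_left _ _).trans hl) t)
        (hΛ' Λ ((le_max_right _ _).trans hl) t)⟩
    · intro t₀ _
      obtain ⟨g, Λ₀, hev⟩ := h.exists_local_bound hχ t₀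
      exact ⟨_, mem_nhdsWithin_of_mem_nhds hev, Λ₀, fun Λ hl t ht => ⟨g, ht.1, ht.2.2 Λ hl⟩⟩
  obtain ⟨Λ, hΛ⟩ := key
  refine ⟨Λ, fun t => ?_⟩
  have h1 := hΛ Λ le_rfl (Int.fract t) ⟨Int.fract_nonneg t, (Int.fract_lt_one t).le⟩
  have e1 := h.framed.curve.periodic.sub_zsmul_eq ⌊t⌋ (x := t)
  have e2 := h.framed.periodic_binormal.sub_zsmul_eq ⌊t⌋ (x := t)
  have e3 := h.framed.periodic.sub_zsmul_eq ⌊t⌋ (x := t)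
  simp only [zsmul_eq_mul, mul_one] at e1 e2 e3
  rwa [Int.fract, e1, e2, e3] at h1

end IsVerticalStrip

/-- The second vertical derivative after a substitution that is tangent to the identity. -/
theorem dz_dz_shear {g b : E3 → ℝ} {w K : E3 → E3} {p : E3} (hg : ContDiffAt ℝ ∞ g p)
    (hb : ContDiff ℝ ∞ b) (hw : ContDiff ℝ ∞ w) (hK : ∀ y, K y = y - b y ^ 2 • w y) (hbp : b p = 0) :
    dz (dz fun y => g (K y)) p = dz (dz g) p - 2 * fderiv ℝ b p e3 ^ 2 * fderiv ℝ g p (w p) := by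
  have hKp : K p = p := by rw [hK, hbp]; simp
  have hbd : ∀ y, HasFDerivAt b (fderiv ℝ b y) y := fun y => (hb.differentiable (by simp) y).hasFDerivAt
  have hwd : ∀ y, HasFDerivAt w (fderiv ℝ w y) y := fun y => (hw.differentiable (by simp) y).hasFDerivAt
  have hKc : ContDiff ℝ ∞ K := by
    rw [show K = fun y => y - b y ^ 2 • w y from funext hK]
    fun_prop
  have hKd : ∀ y, HasFDerivAt K (fderiv ℝ K y) y := fun y => (hKc.differentiable (by simp) y).hasFDerivAt
  let V : E3 → E3 := fun y => e3 - ((2 * b y * fderiv ℝ b y e3) • w y + b y ^ 2 • fderiv ℝ w y e3)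
  have hV : ∀ y, fderiv ℝ K y e3 = V y := fun y => by
    have h1 := (hasFDerivAt_id (𝕜 := ℝ) y).sub (((hbd y).pow 2).smul (hwd y))
    rw [show K = fun y => y - b y ^ 2 • w y from funext hK]
    have h2 := HasFDerivAt.fderiv h1
    have h3 := DFunLike.congr_fun h2 e3
    refine h3.trans ?_
    simp [V]
    abel
  have hVd : HasFDerivAt V (-((2 * fderiv ℝ b p e3) • (fderiv ℝ b p).smulRight (w p))) p := by
    have c1 : ContDiff ℝ ∞ fun y => fderiv ℝ b y e3 :=
      (hb.fderiv_right (m := ∞) (by simp)).clm_apply contDiff_const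
    have c2 : ContDiff ℝ ∞ fun y => fderiv ℝ w y e3 :=
      (hw.fderiv_right (m := ∞) (by simp)).clm_apply contDiff_const
    have d1 := ((((hbd p).const_mul 2).mul (c1.differentiable (by simp) p).hasFDerivAt).smul (hwd p)).add
      (((hbd p).pow 2).smul (c2.differentiable (by simp) p).hasFDerivAt)
    have d2 := d1.const_sub e3
    convert! d2 using 1
    ext1 v
    simp [hbp, smul_smul]
    ring_nf
  have hev : (dz fun y => g (K y)) =ᶠ[𝓝 p] fun y => fderiv ℝ g (K y) (V y) := by
    have h1 : ∀ᶠ y in 𝓝 p, DifferentiableAt ℝ g (K y) := by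
      have h2 : ∀ᶠ y in 𝓝 p, DifferentiableAt ℝ g y :=
        ((hg.of_le (m := 1) (by simp)).eventually (by simp)).mono fun y hy => hy.differentiableAt (by simp)
      have h3 : Tendsto K (𝓝 p) (𝓝 p) := by
        have := hKc.continuous.tendsto p
        rwa [hKp] at this
      exact h3.eventually h2
    filter_upwards [h1] with y hy
    have h2 : HasFDerivAt (fun y => g (K y)) ((fderiv ℝ g (K y)).comp (fderiv ℝ K y)) y :=
      HasFDerivAt.comp (g := g) y hy.hasFDerivAt (hKd y)
    rw [dz, h2.fderiv, ContinuousLinearMap.comp_apply, hV]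
  have hD : HasFDerivAt (fun y => fderiv ℝ g (K y)) ((fderiv ℝ (fderiv ℝ g) p).comp (fderiv ℝ K p)) p := by
    have h1 : ContDiffAt ℝ ∞ (fderiv ℝ g) (K p) := by rw [hKp]; exact hg.fderiv_right (by simp)
    have h2 := HasFDerivAt.comp (g := fderiv ℝ g) p (h1.differentiableAt (by simp)).hasFDerivAt (hKd p)
    rwa [hKp] at h2
  have hfin := (hD.clm_apply hVd).congr_of_eventuallyEq hev
  have hVp : V p = e3 := by simp [V, hbp]
  rw [dz, hfin.fderiv]
  rw [show dz (dz g) p = fderiv ℝ (dz g) p e3 from rfl, fderiv_dz hg]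
  simp [hV, hVp, hKp]
  ring

/-- A surface that is vertical along a curve with cusps of one chirality can be deformed, rel the
curve, so that its contour is generic there. -/
theorem IsVerticalStrip.exists_generic {F : Set E3} {γ β : ℝ → E3} (h : IsVerticalStrip F γ β) {χ : ℝ}
    (hχ2 : χ ^ 2 = 1) (hχ : ∀ t, IsVerticalAt γ t → 0 < χ * cuspDet γ t) :
    ∃ H K : ℝ → E3 → E3, IsIsotopy (Set.range γ) H K ∧ IsVerticalStrip (H 1 '' F) γ β ∧
      ∀ t, ¬ IsVerticalAt γ t → ∃ g, IsLocalEquation (H 1 '' F) (γ t) g ∧ dz (dz g) (γ t) ≠ 0 := by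
  obtain ⟨Λ, hΛ⟩ := h.exists_bound hχ
  -- By `dz_dz_shear` this amount changes `g_zz` by `2 χ Λ e³ ρ`. Multiplied by `χ e`, with `χ ^ 2 =
  -- 1`, the new `g_zz` is the expression bounded in `exists_bound`.
  have hc : ContDiff ℝ ∞ fun t => -(χ * Λ * binormal γ β t 2) :=
    (contDiff_const.mul (ContDiff.coord h.framed.contDiff_binormal 2)).neg
  obtain ⟨H, K, hI, b, w, hb, hw, hK, hbγ⟩ := h.framed.exists_shear hc
    (fun t => by simp only [h.framed.periodic_binormal t])
  have hKγ : ∀ t, K 1 (γ t) = γ t := fun t => hI.inv_fixes 1 ⟨t, rfl⟩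
  have hdK : ∀ t, HasFDerivAt (K 1) (ContinuousLinearMap.id ℝ E3) (γ t) := fun t => by
    have d1 := (hasFDerivAt_id (𝕜 := ℝ) (γ t)).sub
      (((hb.differentiable (by simp) (γ t)).hasFDerivAt.pow 2).smul
        (hw.differentiable (by simp) (γ t)).hasFDerivAt)
    rw [show K 1 = fun y => y - b y ^ 2 • w y from funext hK]
    convert! d1 using 1
    ext1 v
    simp [(hbγ t).1]
  refine ⟨H, K, hI, ⟨h.surface.image (hI.contDiff_apply 1) (hI.contDiff_inv 1) (hI.left_inv 1)
    (hI.right_inv 1), h.framed, h.horizontal, fun t => ⟨γ t, h.mem t, hI.fixes 1 _ ⟨t, rfl⟩⟩,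
    fun t v hv => ?_⟩, fun t ht => ?_⟩
  · have h1 := fderiv_mem_tangentVectors (hI.contDiff_inv 1) (hI.left_inv 1) hv
    rw [hKγ, (hdK t).fderiv] at h1
    exact h.normal t v h1
  · obtain ⟨g, hg, hpos⟩ := hΛ t
    refine ⟨fun y => g (K 1 y), IsLocalEquation.image (hI.contDiff_apply 1) (hI.contDiff_inv 1)
      (hI.left_inv 1) (hI.right_inv 1) (by rwa [hKγ]), fun h0 => ?_⟩
    have h1 := hpos fun h0 => ht ((binormal_two_eq_zero_iff h.framed (h.horizontal t)).mp h0)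
    rw [dz_dz_shear hg.contDiffAt hb hw hK (hbγ t).1, (hbγ t).2.1, (hbγ t).2.2, inner_e3, map_smul,
      smul_eq_mul] at h0
    refine h1.ne ?_
    linear_combination (-χ * binormal γ β t 2) * h0 +
      (2 * Λ * binormal γ β t 2 ^ 4 * fderiv ℝ g (γ t) (β t)) * hχ2

/-! ### Recognizing profile curves -/

/-- Two functionals that vanish on a plane spanned by `u` and `v` are both multiples of the pairing
with its normal, hence dependent. -/
theorem eq_zero_of_independent {α δ : E3 →L[ℝ] ℝ} (hli : LinearIndependent ℝ ![α, δ]) {u v : E3}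
    (hu : u ≠ 0) (hαu : α u = 0) (hδu : δ u = 0) (hαv : α v = 0) (hδv : δ v = 0)
    (huv : inner ℝ u v = 0) : v = 0 := by
  by_contra hv
  set a := ‖u‖⁻¹ • u with ha
  set b := ‖v‖⁻¹ • v with hb
  have ha1 : ‖a‖ = 1 := norm_smul_inv_norm (𝕜 := ℝ) hu
  have hb1 : ‖b‖ = 1 := norm_smul_inv_norm (𝕜 := ℝ) hv
  have hab : inner ℝ a b = 0 := by rw [ha, hb, inner_smul_left, inner_smul_right, huv]; simp
  have hc1 : ‖cross a b‖ = 1 := by rw [norm_cross hab, ha1, hb1, one_mul]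
  have hexp := orthonormal_expand ha1 hb1 hc1 hab (inner_cross_left a b) (inner_cross_right a b)
  have hfun : ∀ η : E3 →L[ℝ] ℝ, η u = 0 → η v = 0 → ∀ x, η x = inner ℝ (cross a b) x * η (cross a b) := by
    intro η h1 h2 x
    conv_lhs => rw [hexp x]
    rw [map_add, map_add, map_smul, map_smul, map_smul, ha, hb, map_smul, map_smul, h1, h2]
    simp
  have h1 := LinearIndependent.pair_iff.mp hli (δ (cross a b)) (-α (cross a b)) (by
    ext1 x
    rw [_root_.add_apply, _root_.smul_apply, _root_.smul_apply, hfun α hαu hαv x, hfun δ hδu hδv x]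
    simp only [smul_eq_mul, _root_.zero_apply]; ring)
  have hα : α = 0 := by
    ext1 x
    rw [hfun α hαu hαv x, neg_eq_zero.mp h1.2, mul_zero]; rfl
  exact hli.ne_zero 0 hα

/-- A closed curve in the contour along which the contour is cut out transversally is a profile
curve. -/
theorem isProfileCurve_of_transverse {F : Set E3} {γ : ℝ → E3} (hγ : IsSmoothClosedCurve γ)
    (hγF : ∀ t, γ t ∈ F) (h : ∀ t, ∃ g, IsLocalEquation F (γ t) g ∧ dz g (γ t) = 0 ∧
      LinearIndependent ℝ ![fderiv ℝ g (γ t), fderiv ℝ (dz g) (γ t)]) :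
    IsProfileCurve F (Set.range γ) := by
  have hcont : ∀ t, γ t ∈ contour F := fun t => by
    obtain ⟨g, hg, hz, -⟩ := h t
    exact ⟨hγF t, mem_tangentVectors_of_fderiv (hγF t) hg hz⟩
  have hloc : ∀ t₀, ∀ᶠ x in 𝓝 (γ t₀), x ∈ contour F → x ∈ Set.range γ := by
    intro t₀
    obtain ⟨g, hg, -, hli⟩ := h t₀
    have hgγ : ∀ᶠ t in 𝓝 t₀, IsLocalEquation F (γ t) g :=
      hγ.smooth.continuous.continuousAt.eventually hg.eventually
    have hz : ∀ x, x ∈ contour F → IsLocalEquation F x g → g x = 0 ∧ dz g x = 0 := fun x hx hgx =>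
      ⟨hgx.eventually_mem_iff.self_of_nhds.mp hx.1, fderiv_of_mem_tangentVectors hgx hx.2⟩
    have hγd := hγ.hasDerivAt t₀
    have hS := contDiffAt_dz hg.contDiffAt
    have hgd := (hg.contDiffAt.differentiableAt (by simp)).hasFDerivAt
    have hSd := (hS.differentiableAt (by simp)).hasFDerivAt
    have hα : fderiv ℝ g (γ t₀) (deriv γ t₀) = 0 :=
      (hgd.comp_hasDerivAt t₀ hγd).unique ((hasDerivAt_const t₀ 0).congr_of_eventuallyEq
        (hgγ.mono fun t ht => (hz _ (hcont t) ht).1))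
    have hδ : fderiv ℝ (dz g) (γ t₀) (deriv γ t₀) = 0 :=
      (hSd.comp_hasDerivAt t₀ hγd).unique ((hasDerivAt_const t₀ 0).congr_of_eventuallyEq
        (hgγ.mono fun t ht => (hz _ (hcont t) ht).2))
    let L : E3 →L[ℝ] ℝ := innerSL ℝ (deriv γ t₀)
    -- In the chart `(g, g_z, ⟨γ'(t₀), ·⟩)` the contour lies on the third axis, and `γ` covers a
    -- neighbourhood of the base point on this axis. So locally the contour contains nothing but
    -- `γ`.
    let f : E3 → ℝ × ℝ × ℝ := fun x => (g x, dz g x, L x)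
    have hf : ContDiffAt ℝ ∞ f (γ t₀) := hg.contDiffAt.prodMk (hS.prodMk L.contDiff.contDiffAt)
    have hfd : HasFDerivAt f _ (γ t₀) := hgd.prodMk (hSd.prodMk L.hasFDerivAt)
    obtain ⟨e, he, hsrc, -⟩ := exists_smooth_local_inverse (by simp) hf fun v hv => by
      rw [hfd.fderiv] at hv
      exact eq_zero_of_independent hli (hγ.regular t₀) hα hδ (congrArg Prod.fst hv)
        (congrArg (fun q => q.2.1) hv) (congrArg (fun q => q.2.2) hv)
    have hφ : HasStrictDerivAt (fun t => L (γ t)) (L (deriv γ t₀)) t₀ :=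
      L.hasStrictFDerivAt.comp_hasStrictDerivAt t₀
        (hγ.smooth.contDiffAt.hasStrictDerivAt (by simp))
    have hL0 : L (deriv γ t₀) ≠ 0 := inner_self_ne_zero.mpr (hγ.regular t₀)
    have hmap := hφ.map_nhds_eq hL0
    have hA : ∀ᶠ t in 𝓝 t₀, γ t ∈ e.source ∧ IsLocalEquation F (γ t) g :=
      (hγ.smooth.continuous.continuousAt.eventually (e.open_source.mem_nhds hsrc)).and hgγ
    have himg : (fun t => L (γ t)) '' {t | γ t ∈ e.source ∧ IsLocalEquation F (γ t) g} ∈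
        𝓝 (L (γ t₀)) := by
      rw [← hmap]; exact image_mem_map hA
    filter_upwards [e.open_source.mem_nhds hsrc, hg.eventually,
      L.continuous.continuousAt.eventually himg] with x hxs hxg hxL hx
    obtain ⟨t, ⟨hts, htg⟩, htL⟩ := hxL
    refine ⟨t, e.injOn hts hxs ?_⟩
    rw [he]
    have h1 := hz _ (hcont t) htg
    have h2 := hz _ hx hxg
    simp only [f]
    rw [h1.1, h1.2, h2.1, h2.2]
    exact congrArg (fun y : ℝ => ((0 : ℝ), (0 : ℝ), y)) htL
  have hrange : IsPreconnected (Set.range γ) := isPreconnected_range hγ.smooth.continuous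
  have hcpt : IsClosed (Set.range γ) := by
    have h1 : Set.range γ = γ '' Set.Icc 0 1 := by
      refine Set.Subset.antisymm ?_ (Set.image_subset_range _ _)
      rintro _ ⟨t, rfl⟩
      have e1 := hγ.periodic.sub_zsmul_eq ⌊t⌋ (x := t)
      simp only [zsmul_eq_mul, mul_one] at e1
      exact ⟨Int.fract t, ⟨Int.fract_nonneg t, (Int.fract_lt_one t).le⟩, e1⟩
    rw [h1]
    exact (isCompact_Icc.image hγ.smooth.continuous).isClosed
  refine ⟨γ 0, hcont 0, Set.Subset.antisymm (hrange.subset_connectedComponentIn ⟨0, rfl⟩ ?_) ?_⟩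
  · rintro _ ⟨t, rfl⟩; exact hcont t
  -- The curve is closed, and within the contour it is also open, being cut out by `U`. A connected
  -- subset of the contour that meets it cannot leave it.
  · let U : Set E3 := interior {x | x ∈ contour F → x ∈ Set.range γ}
    have hγU : Set.range γ ⊆ U := by
      rintro _ ⟨t, rfl⟩
      exact mem_interior_iff_mem_nhds.mpr (hloc t)
    by_contra hcon
    obtain ⟨x, hx, hxγ⟩ := Set.not_subset.mp hcon
    have hsub := connectedComponentIn_subset (contour F) (γ 0)
    obtain ⟨y, hy, hyU, hyγ⟩ := isPreconnected_connectedComponentIn U (Set.range γ)ᶜ isOpen_interior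
      hcpt.isOpen_compl (fun y _ => (em (y ∈ Set.range γ)).imp (fun hy => hγU hy) id)
      ⟨γ 0, mem_connectedComponentIn (hcont 0), hγU ⟨0, rfl⟩⟩ ⟨x, hx, hxγ⟩
    exact hyγ (interior_subset hyU (hsub hy))

theorem IsVerticalStrip.isGenericProfileCurve {F : Set E3} {γ β : ℝ → E3} (h : IsVerticalStrip F γ β)
    (hcusp : ∀ t, IsVerticalAt γ t → cuspDet γ t ≠ 0)
    (hfold : ∀ t, ¬ IsVerticalAt γ t → ∃ g, IsLocalEquation F (γ t) g ∧ dz (dz g) (γ t) ≠ 0) :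
    IsGenericProfileCurve F (Set.range γ) := by
  refine ⟨isProfileCurve_of_transverse h.framed.curve h.mem fun t => ?_, ?_⟩
  · by_cases ht : IsVerticalAt γ t
    · obtain ⟨g, hg⟩ := h.surface _ (h.mem t)
      exact ⟨g, hg, h.dz_eq_zero hg, (h.isCuspPoint ht (hcusp t ht) hg).2.2⟩
    · obtain ⟨g, hg, hzz⟩ := hfold t ht
      refine ⟨g, hg, h.dz_eq_zero hg, LinearIndependent.pair_iff.mpr fun s r hsr => ?_⟩
      have h1 := DFunLike.congr_fun hsr e3
      rw [_root_.add_apply, _root_.smul_apply, _root_.smul_apply] at h1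
      have h2 : s * dz g (γ t) + r * dz (dz g) (γ t) = 0 := h1
      rw [h.dz_eq_zero hg, mul_zero, zero_add] at h2
      have hr := (mul_eq_zero.mp h2).resolve_right hzz
      rw [hr, zero_smul, add_zero] at hsr
      exact ⟨(smul_eq_zero.mp hsr).resolve_right hg.fderiv_ne, hr⟩
  · rintro _ ⟨t, rfl⟩
    by_cases ht : IsVerticalAt γ t
    · obtain ⟨g, hg⟩ := h.surface _ (h.mem t)
      exact Or.inr ⟨h.mem t, g, hg, h.dz_eq_zero hg, h.isCuspPoint ht (hcusp t ht) hg⟩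
    · obtain ⟨g, hg, hzz⟩ := hfold t ht
      exact Or.inl ⟨h.mem t, g, hg, h.dz_eq_zero hg, hzz⟩

/-! ### From equality of the linking numbers to a generic profile curve. -/

theorem HasEvenCuspsOfOneChirality.exists_sign {γ : ℝ → E3} (hγ : IsSmoothClosedCurve γ)
    (h : HasEvenCuspsOfOneChirality γ) :
    ∃ χ : ℝ, χ ^ 2 = 1 ∧ ∀ t, IsVerticalAt γ t → 0 < χ * cuspDet γ t := by
  rcases h.2.2 with hR | hL
  · refine ⟨1, by norm_num, fun t ht => ?_⟩
    have := (hR _ (hγ.fract_mem_verticalParams ht)).2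
    rw [hγ.cuspDet_eq_fract] at this
    linarith
  · refine ⟨-1, by norm_num, fun t ht => ?_⟩
    have := (hL _ (hγ.fract_mem_verticalParams ht)).2
    rw [hγ.cuspDet_eq_fract] at this
    linarith

theorem exists_generic_profileCurve {F : Set E3} (hF : IsSmoothSurface F) {ν : E3 → E3}
    (hν : IsUnitNormalField F ν) {γ β : ℝ → E3} (hγ : IsSmoothClosedCurve γ) (hγF : ∀ t, γ t ∈ F)
    (hcusp : HasEvenCuspsOfOneChirality γ) (hβ : IsBlackboardFraming γ β) (hβs : ContDiff ℝ ∞ β)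
    {n : ℝ} (hw : IsPushOffLinkingNumber γ β n)
    (hl : IsPushOffLinkingNumber γ (fun t => ν (γ t)) n) :
    ∃ F₁ : Set E3, IsotopicFixing (Set.range γ) F F₁ ∧ IsGenericProfileCurve F₁ (Set.range γ) := by
  have hfr := hβ.isFramed hγ hβs
  have hνfr := hν.isFramed hF hγ hγF
  obtain ⟨θ, hθ, hνθ, hθ1⟩ := hfr.exists_angle hνfr
  have h01 := hfr.winding_eq_zero hθ hνθ hw hl
  -- Zero winding makes the angle periodic, so the twist by `θ` is defined around the whole tube.
  obtain ⟨H, K, hI, hN⟩ := exists_isotopy_normalAlong (F := F) hfr hθ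
    (fun t => by linarith [hθ1 t]) (fun t v hv => by
      have := hν.normal _ (hγF t) v hv
      rwa [hνθ t] at this)
  have hstrip : IsVerticalStrip (H 1 '' F) γ β :=
    ⟨hF.image (hI.contDiff_apply 1) (hI.contDiff_inv 1) (hI.left_inv 1) (hI.right_inv 1), hfr,
      hβ.horizontal, fun t => ⟨γ t, hγF t, hI.fixes 1 _ ⟨t, rfl⟩⟩, hN⟩
  obtain ⟨χ, hχ2, hχ⟩ := hcusp.exists_sign hγ
  obtain ⟨H', K', hI', hstrip', hfold⟩ := hstrip.exists_generic hχ2 hχ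
  refine ⟨_, (hI.comp hI').isotopicFixing F, ?_⟩
  rw [← Set.image_image (H' 1) (H 1) F]
  exact hstrip'.isGenericProfileCurve (fun t ht h0 => (hχ t ht).ne' (by rw [h0, mul_zero])) hfold

end ProfileCurve

end

theorem theorem4p3 (F₀ : Set E3) (hF₀ : IsSmoothSurface F₀) (hor : IsOrientable F₀)
    (γ : ℝ → E3) (hγ : IsSmoothClosedCurve γ) (hγF : ∀ t, γ t ∈ F₀)
    (hcusp : HasEvenCuspsOfOneChirality γ) :
    ∃ w l : ℝ, IsWrithe γ w ∧ IsSurfaceLinkingNumber γ F₀ l ∧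
      List.TFAE
        [∃ F₁ : Set E3, IsotopicFixing (Set.range γ) F₀ F₁ ∧ IsProfileCurve F₁ (Set.range γ),
         ∃ F₁ : Set E3, IsotopicFixing (Set.range γ) F₀ F₁ ∧
           IsGenericProfileCurve F₁ (Set.range γ),
         w = l] := by
  obtain ⟨ν, hν⟩ := hor
  obtain ⟨β, hβ, hβs⟩ := exists_blackboardFraming hγ hcusp
  obtain ⟨w, hw⟩ := (hβ.isFramed hγ hβs).exists_pushOffLinkingNumber
  obtain ⟨l, hl⟩ := (hν.isFramed hF₀ hγ hγF).exists_pushOffLinkingNumber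
  have hwr := isWrithe_of_pushOff hγ hcusp.1 hβ hβs hw
  refine ⟨w, l, hwr, isSurfaceLinkingNumber_of_pushOff hF₀ hν hγ hγF hl, ?_⟩
  -- The cycle `2 → 1 → 3 → 2` shows that genericity costs nothing: any profile curve already forces
  -- the equality that produces a generic one.
  tfae_have 2 → 1 := fun ⟨F₁, hiso, hgen⟩ => ⟨F₁, hiso, hgen.1⟩
  tfae_have 1 → 3 := fun ⟨F₁, hiso, hprof⟩ =>
    writhe_eq_of_profileCurve hF₀ hν hγ hγF hiso hprof hwr hl
  tfae_have 3 → 2 := fun hwl =>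
    exists_generic_profileCurve hF₀ hν hγ hγF hcusp hβ hβs (hwl ▸ hw) hl
  tfae_finish
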